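/- Let $\Gamma\subset\mathbb{R}^3$ be a compact smooth surface without boundary, given as the zero level set (with $\nabla d\neq 0$ on it) of a smooth signed distance function $d$, $|d|=\mathrm{dist}(\cdot,\Gamma)$, on an open set $U\supset\Gamma$. Let $\nu=\nabla d$, $\xi(x)=x-d(x)\nu(x)$, and let $w:\Gamma\to\mathbb{R}^3$ be a continuous tangential velocity field ($w\cdot\nu=0$) with $\nabla_\Gamma\cdot w=0$ almost everywhere. Its inverse lift is $w^{-l}=w\circ\xi$. Consider conforming triangulations $\mathcal{T}_h$, by planar triangles with vertices on $\Gamma$, of closed polyhedral surfaces $\Gamma_h\subset U$ (each edge belongs to exactly two triangles) such that $\xi:\Gamma_h\to\Gamma$ is bijective; $h$ is the largest diameter of a triangle. The triangulations are assumed shape regular with constant $\sigma$: every triangle has diameter at most $\sigma$ times the diameter of its inscribed circle. For an edge $e_h$ of $K_h\in\mathcal{T}_h$, let $n_h^+$ be the outward unit conormal of $K_h$ (tangential to $K_h$ and normal to $e_h$), $n_h^-$ that of the neighbouring triangle across $e_h$, and $$n_{e_h}^+=\frac{\frac12(n_h^+-n_h^-)}{\left|\frac12(n_h^+-n_h^-)\right|}.$$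 With $x_0$ a vertex of $K_h$ and $e_0,e_1$ the edge vectors issuing from it, let $RT^0(K_h)=\{\,x\mapsto p_0e_0+p_1e_1+t(x-x_0):p_0,p_1,t\in\mathbb{R}\}$. The zero-order surface Raviart–Thomas interpolant $\Pi^0_{K_h}w^{-l}\in RT^0(K_h)$ is defined by $$\int_{e_h}\Pi^0_{K_h}w^{-l}\cdot n_h^+\,ds_h=\int_{e_h}w^{-l}\cdot n_{e_h}^+\,ds_h\qquad\text{for each edge } e_h\subset\partial K_h .$$ Then there is a constant $C>0$, depending on $\Gamma$ (with $d$ and $U$), $w$ and $\sigma$ but not on the triangulation or on $h$, such that for every such triangulation and every $K_h\in\mathcal{T}_h$ with $w^{-l}\in[W^{1,\infty}(K_h)]^3$, the interpolant $\Pi^0_{K_h}w^{-l}$ exists, is unique, and satisfies $$\left\|\nabla_{\Gamma_h}\cdot\Pi^0_{K_h}w^{-l}\right\|_{L^\infty(K_h)}\le C\,h .$$ In particular, if $w^{-l}\in[W^{1,\infty}(K_h)]^3$ for all $K_h\in\mathcal{T}_h$ and the discrete velocity field $w_h$ is given by $w_h|_{K_h}=\Pi^0_{K_h}w^{-l}$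 for all $K_h\in\mathcal{T}_h$, then the bound $\|\nabla_{\Gamma_h}\cdot w_h\|_{L^\infty(K_h)}\le C\,h^{p_2}$ for all $K_h\in\mathcal{T}_h$ holds with $p_2=1$ and $C$ independent of the triangulation. -/

import Mathlib

open MeasureTheory Metric Set
open scoped ContDiff ENNReal NNReal RealInnerProductSpace

namespace SurfaceDG

noncomputable section

/-- The ambient Euclidean space `ℝ³`. -/
abbrev E3 : Type := EuclideanSpace ℝ (Fin 3)

/-- The plane `ℝ²` that contains the reference element. -/
abbrev E2 : Type := EuclideanSpace ℝ (Fin 2)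

/-- The divergence of `v` along the tangent space `T` at `x`: the trace of `P ∇v`, where `P` is
the orthogonal projection of `ℝ³` onto `T`.  With `T` the tangent plane of a surface at `x` this is
the surface divergence `∇_Γ · v (x) = ∑ᵢ (P ∇vᵢ)ᵢ`. -/
def tangentialDiv (T : Submodule ℝ E3) (v : E3 → E3) (x : E3) : ℝ :=
  LinearMap.trace ℝ E3 ((T.starProjection ∘L fderiv ℝ v x : E3 →L[ℝ] E3) : E3 →ₗ[ℝ] E3)

/-! ### The smooth surface -/

/-- A compact smooth surface without boundary in `ℝ³`: the regular zero level set of a smooth signed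
distance function `d` (`|d| = dist(·, Γ)`) on an open set `U`. -/
structure SmoothSurface where
  /-- the surface `Γ` -/
  carrier : Set E3
  /-- the neighbourhood `U` of `Γ` -/
  nhd : Set E3
  /-- the signed distance function -/
  d : E3 → ℝ
  isCompact : IsCompact carrier
  isOpen : IsOpen nhd
  smooth : ContDiffOn ℝ ∞ d nhd
  carrier_eq : carrier = {x ∈ nhd | d x = 0}
  abs_d : ∀ x ∈ nhd, |d x| = infDist x carrier
  gradient_ne_zero : ∀ x ∈ carrier, gradient d x ≠ 0

namespace SmoothSurface

/-- The unit normal `ν = ∇d`, extended to `U`. -/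
def normal (S : SmoothSurface) (x : E3) : E3 := gradient S.d x

/-- The projection `ξ(x) = x - d(x) ν(x)` of `U` onto `Γ`. -/
def proj (S : SmoothSurface) (x : E3) : E3 := x - S.d x • S.normal x

/-- The tangent plane of `Γ` at `x`; the orthogonal projection onto it is `P = I - ν ⊗ ν`. -/
def tangent (S : SmoothSurface) (x : E3) : Submodule ℝ E3 := (ℝ ∙ S.normal x)ᗮ

/-- The inverse lift `w⁻ˡ(x) = w(ξ(x))` of a field on `Γ`.  On all of `U` this is the extension of
`w` that is constant along the normals of `Γ`. -/
def invLift (S : SmoothSurface) (w : E3 → E3) (x : E3) : E3 := w (S.proj x)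

/-- `w` is purely tangential to `Γ`. -/
def IsTangential (S : SmoothSurface) (w : E3 → E3) : Prop :=
  ∀ x ∈ S.carrier, ⟪w x, S.normal x⟫ = 0

/-- `∇_Γ · w = 0` almost everywhere on `Γ` (with respect to surface area). The derivatives of `w`
are those of its extension constant along normals; they exist almost everywhere where `w` is locally
Lipschitz, and where they do not exist nothing is required of `w`. -/
def IsDivFree (S : SmoothSurface) (w : E3 → E3) : Prop :=
  ∀ᵐ x ∂((Measure.hausdorffMeasure 2 : Measure E3).restrict S.carrier),
    tangentialDiv (S.tangent x) (S.invLift w) x = 0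

end SmoothSurface

/-! ### Planar triangles -/

/-- A nondegenerate planar triangle in `ℝ³`, given by its three (ordered) vertices. -/
abbrev Tri : Type := Affine.Triangle ℝ E3

namespace Tri

/-- The closed triangle `K_h` as a subset of `ℝ³`. -/
def carrier (K : Tri) : Set E3 := convexHull ℝ (range K.points)

/-- The tangent plane of `K_h`; the orthogonal projection onto it is `P_h = I - ν_h ⊗ ν_h`. -/
def plane (K : Tri) : Submodule ℝ E3 := vectorSpan ℝ (range K.points)

/-- The affine map `F_K(x) = x₀ + x₁ e₀ + x₂ e₁` from the reference element onto `K_h`. -/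
def param (K : Tri) (x : E2) : E3 :=
  K.points 0 + x 0 • (K.points 1 - K.points 0) + x 1 • (K.points 2 - K.points 0)

/-- The vertices of the `i`-th edge (the one opposite to the `i`-th vertex). -/
def edge (K : Tri) (i : Fin 3) : Set E3 := K.points '' {i}ᶜ

/-- The integral of `f` over the `i`-th edge with respect to arc length. -/
def edgeIntegral (K : Tri) (i : Fin 3) (f : E3 → ℝ) : ℝ :=
  dist (K.points (i + 1)) (K.points (i + 2)) *
    ∫ t in (0 : ℝ)..1, f (AffineMap.lineMap (K.points (i + 1)) (K.points (i + 2)) t)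

/-- The outward unit conormal `n_h` of `K_h` on its `i`-th edge: the normalised vector from the
`i`-th vertex to the foot of the altitude through that vertex. -/
def conormal (K : Tri) (i : Fin 3) : E3 :=
  ‖K.altitudeFoot i - K.points i‖⁻¹ • (K.altitudeFoot i - K.points i)

/-- The surface divergence `∇_{Γ_h} · v` on `K_h`. -/
def surfDiv (K : Tri) (v : E3 → E3) (x : E3) : ℝ := tangentialDiv K.plane v x

/-- The norm of `L^∞(K_h)`. (Only the null sets of the area measure matter.) -/
def normLinf (K : Tri) (f : E3 → ℝ) : ℝ≥0∞ :=
  eLpNorm f ∞ ((Measure.hausdorffMeasure 2 : Measure E3).restrict K.carrier)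

/-- The lowest order Raviart–Thomas space `RT⁰(K_h)`: the fields `∇F_K p + (x - x₀) t` with `p ∈ ℝ²`
and `t ∈ ℝ` constant.  A field is identified with its affine formula on `ℝ³`, which its values on
`K_h` determine. -/
def RT0 (K : Tri) : Set (E3 → E3) :=
  {v | ∃ (p : Fin 2 → ℝ) (t : ℝ), v = fun x =>
    (p 0 • (K.points 1 - K.points 0) + p 1 • (K.points 2 - K.points 0)) + t • (x - K.points 0)}

/-- `conormal` is a unit vector. -/
theorem norm_conormal (K : Tri) (i : Fin 3) : ‖K.conormal i‖ = 1 := by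
  have h : K.altitudeFoot i - K.points i ≠ 0 :=
    sub_ne_zero.mpr (Affine.Simplex.ne_altitudeFoot K i).symm
  rw [conormal, norm_smul, norm_inv, norm_norm, inv_mul_cancel₀ (norm_ne_zero_iff.mpr h)]

/-- `conormal` is tangential to the triangle. -/
theorem conormal_mem_plane (K : Tri) (i : Fin 3) : K.conormal i ∈ K.plane := by
  refine Submodule.smul_mem _ _ ?_
  have h := AffineSubspace.vsub_mem_direction (K.altitudeFoot_mem_affineSpan i)
    (mem_affineSpan ℝ (mem_range_self (f := K.points) i))
  rwa [direction_affineSpan] at h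

/-- `conormal` points out of the triangle: `n_h · (y - x) ≤ 0` for `x ∈ e_h` and `y ∈ K_h`. -/
theorem inner_conormal_le (K : Tri) (i : Fin 3) {x y : E3} (hx : x ∈ convexHull ℝ (K.edge i))
    (hy : y ∈ K.carrier) : ⟪K.conormal i, y - x⟫ ≤ 0 := by
  set a : E3 := K.altitudeFoot i - K.points i with ha
  have h0 : ∀ j, i ≠ j → ⟪a, K.points j - K.altitudeFoot i⟫ = 0 := by
    intro j hj
    have h := K.inner_vsub_altitudeFoot_vsub_altitudeFoot_eq_zero hj
    have h' : ⟪K.points j - K.altitudeFoot i, K.points i - K.altitudeFoot i⟫ = 0 := by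
      simpa using h
    rw [ha, ← neg_sub, inner_neg_left, real_inner_comm, h', neg_zero]
  have hxa : ⟪a, x⟫ = ⟪a, K.altitudeFoot i⟫ := by
    have hsub : K.edge i ⊆ {z | innerSL ℝ a z = ⟪a, K.altitudeFoot i⟫} := by
      rintro _ ⟨j, hj, rfl⟩
      have h := h0 j (fun h => hj h.symm)
      rw [inner_sub_right, sub_eq_zero] at h
      exact h
    exact convexHull_min hsub (convex_hyperplane (innerSL ℝ a).isLinear _) hx
  have hya : ⟪a, y⟫ ≤ ⟪a, K.altitudeFoot i⟫ := by
    have hsub : range K.points ⊆ {z | innerSL ℝ a z ≤ ⟪a, K.altitudeFoot i⟫} := by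
      rintro _ ⟨j, rfl⟩
      change ⟪a, K.points j⟫ ≤ _
      by_cases hj : i = j
      · subst hj
        rw [← sub_nonneg, ← inner_sub_right]
        exact real_inner_self_nonneg
      · have h := h0 j hj
        rw [inner_sub_right, sub_eq_zero] at h
        exact h.le
    exact convexHull_min hsub (convex_halfSpace_le (innerSL ℝ a).isLinear _) hy
  rw [conormal, real_inner_smul_left, inner_sub_right, hxa]
  exact mul_nonpos_of_nonneg_of_nonpos (by positivity) (sub_nonpos.mpr hya)

end Tri

/-! ### Sobolev regularity -/

/-- `g ∈ W^{1,∞}(Ω)`: `g` is essentially bounded on `Ω` and has an essentially bounded weak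
derivative there. -/
def MemW1Inf (Ω : Set E2) (g : E2 → E3) : Prop :=
  MemLp g ∞ (volume.restrict Ω) ∧
    ∃ Dg : E2 → E2 →L[ℝ] E3, MemLp Dg ∞ (volume.restrict Ω) ∧
      ∀ φ : E2 → ℝ, ContDiff ℝ ∞ φ → HasCompactSupport φ → tsupport φ ⊆ Ω →
        ∀ e : E2, ∫ x in Ω, fderiv ℝ φ x e • g x = -∫ x in Ω, φ x • Dg x e

/-- The interior of the reference element. -/
def refInterior : Set E2 := {x | 0 < x 0 ∧ 0 < x 1 ∧ x 0 + x 1 < 1}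

/-- `f ∈ [W^{1,∞}(K_h)]³`, in the coordinates given by the affine parametrisation of `K_h`. -/
def Tri.MemW1Inf (K : Tri) (f : E3 → E3) : Prop := SurfaceDG.MemW1Inf refInterior (f ∘ K.param)

/-! ### The discrete surface -/

/-- A conforming triangulation of a closed polyhedral surface `Γ_h ⊆ U` with vertices on `Γ`, for
which `ξ : Γ_h → Γ` is a bijection. -/
structure SurfaceMesh (S : SmoothSurface) where
  /-- the set `𝒯_h` of triangles -/
  triangles : Finset Tri
  /-- different elements have different vertices (the order of the vertices is immaterial) -/
  vertices_ne : ∀ K ∈ triangles, ∀ K' ∈ triangles, K ≠ K' → range K.points ≠ range K'.points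
  /-- two elements meet in a common vertex, in a common edge, or not at all -/
  conforming : ∀ K ∈ triangles, ∀ K' ∈ triangles, K ≠ K' →
    K.carrier ∩ K'.carrier = convexHull ℝ (range K.points ∩ range K'.points)
  /-- the surface is closed: across each of its edges an element has exactly one neighbour -/
  closed : ∀ K ∈ triangles, ∀ i : Fin 3,
    ∃! p : Tri × Fin 3, p.1 ∈ triangles ∧ p.1 ≠ K ∧ p.1.edge p.2 = K.edge i
  vertices_mem : ∀ K ∈ triangles, ∀ i, K.points i ∈ S.carrier
  subset_nhd : (⋃ K ∈ triangles, K.carrier) ⊆ S.nhd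
  bijOn_proj : BijOn S.proj (⋃ K ∈ triangles, K.carrier) S.carrier

namespace SurfaceMesh

variable {S : SmoothSurface}

/-- The mesh size `h = max_K diam K`. -/
def meshSize (M : SurfaceMesh S) : ℝ≥0 := M.triangles.sup fun K => (diam K.carrier).toNNReal

/-- Shape regularity with constant `σ`: the diameter of each element is at most `σ` times the
diameter of its inscribed circle. -/
def IsRegular (M : SurfaceMesh S) (σ : ℝ) : Prop :=
  ∀ K ∈ M.triangles, diam K.carrier ≤ σ * (2 * K.inradius)

/-- The average conormal `n_e⁺ = ½(n⁺ - n⁻) / |½(n⁺ - n⁻)|`. -/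
def avgConormal (np nm : E3) : E3 :=
  ‖(1 / 2 : ℝ) • (np - nm)‖⁻¹ • ((1 / 2 : ℝ) • (np - nm))

/-- `v` is the zero-order local surface Raviart–Thomas interpolant of `f` on the element `K`: it lies
in `RT⁰(K)` and `∫_e v · n_h⁺ = ∫_e f · n_e⁺` on each edge `e` of `K`, where `n_h⁺` is the conormal
of `K` and `n_e⁺` the average conormal formed with the conormal `n_h⁻` of the neighbour across `e`.
-/
def IsRTInterpolant (M : SurfaceMesh S) (f : E3 → E3) (K : Tri) (v : E3 → E3) : Prop :=
  v ∈ K.RT0 ∧ ∀ i j : Fin 3, ∀ K' ∈ M.triangles, K' ≠ K → K'.edge j = K.edge i →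
    K.edgeIntegral i (fun x => ⟪v x, K.conormal i⟫) =
      K.edgeIntegral i (fun x => ⟪f x, avgConormal (K.conormal i) (K'.conormal j)⟫)

end SurfaceMesh

/-- The assumption `‖∇_{Γ_h} · w_h‖_{L^∞(K_h)} ≲ h^{p₂}` for each `K_h ∈ 𝒯_h`, for the discrete
velocity field `w_h` given on each element by the zero-order surface Raviart–Thomas interpolant of
`w⁻ˡ`, on meshes of shape regularity `σ` for which `w⁻ˡ` is elementwise in `W^{1,∞}`. -/
def DivergenceAssumption (S : SmoothSurface) (w : E3 → E3) (σ p₂ : ℝ) : Prop :=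
  ∃ C : ℝ, 0 < C ∧ ∀ M : SurfaceMesh S, M.IsRegular σ →
    (∀ K ∈ M.triangles, K.MemW1Inf (S.invLift w)) →
    ∀ wh : Tri → E3 → E3, (∀ K ∈ M.triangles, M.IsRTInterpolant (S.invLift w) K (wh K)) →
      ∀ K ∈ M.triangles,
        K.normLinf (K.surfDiv (wh K)) ≤ ENNReal.ofReal (C * (M.meshSize : ℝ) ^ p₂)

end

end SurfaceDG

/-! The fields `x - xᵢ` form a basis of `RT⁰` that is dual, up to the factor `2|K|`, to the three
edge fluxes. Hence the interpolant exists, is unique, and has the constant divergence (sum of the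
prescribed fluxes) / `|K|` (`existsUnique_isRTInterpolant`). Shape regularity bounds `|K|` from
below by a multiple of `h²` (`sq_diam_le`), so it suffices that the prescribed fluxes sum to
`O(h³)`.

They nearly cancel because the flux of `w` out of the curved triangle `ξ(K)` vanishes exactly
(`sum_liftedFlux_eq_zero`). In the affine chart this flux is the boundary integral of the one-form
with coefficients `⟪w ∘ ξ, Dξ eⱼ × ν ∘ ξ⟫`. A continuous `W^{1,∞}` field is Lipschitz, the form is
closed almost everywhere because `∇_Γ · w = 0` and second derivatives of `ξ` commute, and Green's
theorem applies. The almost-everywhere statements pass between `Γ` and the chart because `ξ` is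
bi-Lipschitz on a small triangle and has a local inverse there (`GraphBall`).

Each prescribed flux differs from its curved counterpart by `O(h³)` (`abs_flux_sub_le`): the edge
has length at most `h`, and the densities differ by `O(h²)` relative to it. Averaging conormals
amounts to averaging the normals of the two triangles. Since `w` is orthogonal to the surface normal
`N`, the error is a triple product in which every term contains the normal component of the edge or
of the normal error. The former is of first order and multiplies another first-order factor, the
latter is already of second order (`abs_inner_avgConormal_sub_le`). The two conormals must be nearly
opposite rather than nearly equal; this no-fold property follows from injectivity of `ξ` on `Γ_h`
(`lt_norm_conormal_sub`).

Triangles that are not small are covered by the trivial flux bound, whose constant absorbs the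
missing powers of `h`. -/

namespace SurfaceDG

/-! ### The cross product of `ℝ³` -/

/-- The cross product on `ℝ³`. -/
def cross (a b : E3) : E3 :=
  !₂[a 1 * b 2 - a 2 * b 1, a 2 * b 0 - a 0 * b 2, a 0 * b 1 - a 1 * b 0]

theorem inner_eq_sum (a b : E3) : ⟪a, b⟫ = a 0 * b 0 + a 1 * b 1 + a 2 * b 2 := by
  simp [PiLp.inner_apply, Fin.sum_univ_three, mul_comm]

theorem ext_coord {a b : E3} (h0 : a 0 = b 0) (h1 : a 1 = b 1) (h2 : a 2 = b 2) : a = b := by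
  ext i; fin_cases i <;> assumption

theorem cross_apply (a b : E3) : cross a b 0 = a 1 * b 2 - a 2 * b 1 ∧
    cross a b 1 = a 2 * b 0 - a 0 * b 2 ∧ cross a b 2 = a 0 * b 1 - a 1 * b 0 := by
  simp [cross]

theorem cross_zero' (a b : E3) : cross a b 0 = a 1 * b 2 - a 2 * b 1 := (cross_apply a b).1
theorem cross_one' (a b : E3) : cross a b 1 = a 2 * b 0 - a 0 * b 2 := (cross_apply a b).2.1
theorem cross_two' (a b : E3) : cross a b 2 = a 0 * b 1 - a 1 * b 0 := (cross_apply a b).2.2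

theorem cross_add_left (a a' b : E3) : cross (a + a') b = cross a b + cross a' b := by
  apply ext_coord <;> simp [cross_zero', cross_one', cross_two'] <;> ring

theorem cross_add_right (a b b' : E3) : cross a (b + b') = cross a b + cross a b' := by
  apply ext_coord <;> simp [cross_zero', cross_one', cross_two'] <;> ring

theorem cross_smul_left (c : ℝ) (a b : E3) : cross (c • a) b = c • cross a b := by
  apply ext_coord <;> simp [cross_zero', cross_one', cross_two'] <;> ring

theorem cross_smul_right (c : ℝ) (a b : E3) : cross a (c • b) = c • cross a b := by
  apply ext_coord <;> simp [cross_zero', cross_one', cross_two'] <;> ring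

theorem cross_sub_left (a a' b : E3) : cross (a - a') b = cross a b - cross a' b := by
  apply ext_coord <;> simp [cross_zero', cross_one', cross_two'] <;> ring

theorem cross_sub_right (a b b' : E3) : cross a (b - b') = cross a b - cross a b' := by
  apply ext_coord <;> simp [cross_zero', cross_one', cross_two'] <;> ring

theorem cross_self (a : E3) : cross a a = 0 := by
  apply ext_coord <;> simp [cross_zero', cross_one', cross_two'] <;> ring

theorem inner_cross_left (a b : E3) : ⟪a, cross a b⟫ = 0 := by
  rw [inner_eq_sum, cross_zero', cross_one', cross_two']; ring

theorem inner_cross_right (a b : E3) : ⟪b, cross a b⟫ = 0 := by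
  rw [inner_eq_sum, cross_zero', cross_one', cross_two']; ring

theorem inner_cross_rotate (a b c : E3) : ⟪a, cross b c⟫ = ⟪b, cross c a⟫ := by
  simp only [inner_eq_sum, cross_zero', cross_one', cross_two']; ring

theorem inner_cross_swap (a b c : E3) : ⟪a, cross b c⟫ = -⟪b, cross a c⟫ := by
  simp only [inner_eq_sum, cross_zero', cross_one', cross_two']; ring

theorem cross_cross (a b c : E3) : cross a (cross b c) = ⟪a, c⟫ • b - ⟪a, b⟫ • c := by
  apply ext_coord <;>
    simp [inner_eq_sum, cross_zero', cross_one', cross_two'] <;> ring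

/-- Lagrange's identity. -/
theorem inner_cross_cross (a b c d : E3) :
    ⟪cross a b, cross c d⟫ = ⟪a, c⟫ * ⟪b, d⟫ - ⟪a, d⟫ * ⟪b, c⟫ := by
  simp only [inner_eq_sum, cross_zero', cross_one', cross_two']; ring

theorem norm_cross_sq (a b : E3) : ‖cross a b‖ ^ 2 = ‖a‖ ^ 2 * ‖b‖ ^ 2 - ⟪a, b⟫ ^ 2 := by
  rw [← real_inner_self_eq_norm_sq, inner_cross_cross, real_inner_self_eq_norm_sq,
    real_inner_self_eq_norm_sq, real_inner_comm b a]
  ring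

theorem norm_cross_le (a b : E3) : ‖cross a b‖ ≤ ‖a‖ * ‖b‖ := by
  refine (sq_le_sq₀ (norm_nonneg _) (by positivity)).1 ?_
  rw [norm_cross_sq, mul_pow]
  nlinarith [sq_nonneg ⟪a, b⟫]

theorem norm_cross_of_inner_eq_zero {a b : E3} (h : ⟪a, b⟫ = 0) : ‖cross a b‖ = ‖a‖ * ‖b‖ := by
  have h2 := norm_cross_sq a b
  rw [h] at h2
  have : ‖cross a b‖ ^ 2 = (‖a‖ * ‖b‖) ^ 2 := by rw [h2]; ring
  exact (sq_eq_sq₀ (norm_nonneg _) (by positivity)).1 this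

/-- The cross product as a continuous bilinear map. -/
noncomputable def crossL : E3 →L[ℝ] E3 →L[ℝ] E3 :=
  LinearMap.mkContinuous₂ (LinearMap.mk₂ ℝ cross cross_add_left cross_smul_left cross_add_right
    cross_smul_right) 1 (fun a b => by simpa using norm_cross_le a b)

@[simp] theorem crossL_apply (a b : E3) : crossL a b = cross a b := rfl

/-- The triple product of three vectors, resolved along a fourth one. -/
theorem inner_cross_mul_norm_sq (a b c n : E3) :
    ⟪a, cross b c⟫ * ‖n‖ ^ 2 =
      ⟪c, n⟫ * ⟪a, cross b n⟫ + ⟪a, n⟫ * ⟪b, cross c n⟫ + ⟪b, n⟫ * ⟪c, cross a n⟫ := by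
  rw [← real_inner_self_eq_norm_sq]
  simp only [inner_eq_sum, cross_zero', cross_one', cross_two']; ring

/-- Three vectors of one plane are linearly dependent. This removes the curvature terms from the
flux computation on the surface. -/
theorem inner_cross_eq_zero_of_orthogonal {a b c n : E3} (hn : ‖n‖ = 1) (ha : ⟪a, n⟫ = 0)
    (hb : ⟪b, n⟫ = 0) (hc : ⟪c, n⟫ = 0) : ⟪a, cross b c⟫ = 0 := by
  have := inner_cross_mul_norm_sq a b c n
  rw [hn, ha, hb, hc] at this
  simpa using this

theorem abs_inner_cross_le (a b c : E3) : |⟪a, cross b c⟫| ≤ ‖a‖ * (‖b‖ * ‖c‖) :=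
  (abs_real_inner_le_norm _ _).trans (by gcongr; exact norm_cross_le _ _)

/-- A triple product of two vectors that are nearly orthogonal to the unit vector `n` and one that
is orthogonal to it. -/
theorem abs_inner_cross_le_of_unit {a n : E3} (b c : E3) (hn : ‖n‖ = 1) (ha : ⟪a, n⟫ = 0) :
    |⟪a, cross b c⟫| ≤ ‖a‖ * (|⟪c, n⟫| * ‖b‖ + |⟪b, n⟫| * ‖c‖) := by
  have h := inner_cross_mul_norm_sq a b c n
  rw [hn, ha] at h
  -- Every surviving term carries the normal component of `b` or of `c`. This gain over the product
  -- of norms makes the conormal error quadratic.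
  have h' : ⟪a, cross b c⟫ = ⟪c, n⟫ * ⟪a, cross b n⟫ + ⟪b, n⟫ * ⟪c, cross a n⟫ := by linarith
  rw [h']
  refine (abs_add_le _ _).trans ?_
  rw [abs_mul, abs_mul]
  have h1 := abs_inner_cross_le a b n
  have h2 := abs_inner_cross_le c a n
  rw [hn, mul_one] at h1 h2
  calc _ ≤ |⟪c, n⟫| * (‖a‖ * ‖b‖) + |⟪b, n⟫| * (‖c‖ * ‖a‖) := by gcongr
    _ = _ := by ring

/-- The trace as the logarithmic derivative of the determinant. -/
theorem trace_mul_inner_cross (B : E3 →ₗ[ℝ] E3) (a b c : E3) :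
    LinearMap.trace ℝ E3 B * ⟪a, cross b c⟫ =
      ⟪B a, cross b c⟫ + ⟪a, cross (B b) c⟫ + ⟪a, cross b (B c)⟫ := by
  have ht : LinearMap.trace ℝ E3 B = ∑ i, B (EuclideanSpace.single i 1) i := by
    rw [LinearMap.trace_eq_matrix_trace ℝ (EuclideanSpace.basisFun (Fin 3) ℝ).toBasis]
    simp [Matrix.trace, LinearMap.toMatrix_apply]
  have hB : ∀ v : E3, B v = v 0 • B (EuclideanSpace.single 0 1) +
      v 1 • B (EuclideanSpace.single 1 1) + v 2 • B (EuclideanSpace.single 2 1) := by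
    intro v
    rw [← map_smul, ← map_smul, ← map_smul, ← map_add, ← map_add]
    congr 1
    apply ext_coord <;> simp
  rw [ht, Fin.sum_univ_three, hB a, hB b, hB c]
  simp only [inner_eq_sum, cross_zero', cross_one', cross_two', PiLp.add_apply, PiLp.smul_apply,
    smul_eq_mul]
  ring

/-! ### The signed distance function -/

namespace SmoothSurface

open Filter Topology

variable (S : SmoothSurface)

theorem carrier_subset : S.carrier ⊆ S.nhd := by
  rw [S.carrier_eq]; exact fun x hx => hx.1

theorem d_eq_zero {x : E3} (hx : x ∈ S.carrier) : S.d x = 0 := by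
  rw [S.carrier_eq] at hx; exact hx.2

theorem proj_eq_self {x : E3} (hx : x ∈ S.carrier) : S.proj x = x := by
  simp [proj, S.d_eq_zero hx]

theorem contDiffAt_d {x : E3} (hx : x ∈ S.nhd) : ContDiffAt ℝ ∞ S.d x :=
  S.smooth.contDiffAt (S.isOpen.mem_nhds hx)

theorem hasFDerivAt_d {x : E3} (hx : x ∈ S.nhd) :
    HasFDerivAt S.d (innerSL ℝ (S.normal x)) x := by
  have h := ((S.contDiffAt_d hx).differentiableAt (by simp)).hasGradientAt.hasFDerivAt
  exact h

theorem contDiffOn_normal : ContDiffOn ℝ ∞ S.normal S.nhd := by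
  have h : ContDiffOn ℝ ∞ (fderiv ℝ S.d) S.nhd :=
    S.smooth.fderiv_of_isOpen S.isOpen (by simp)
  exact (InnerProductSpace.toDual ℝ E3).symm.toContinuousLinearEquiv.contDiff.comp_contDiffOn h

theorem contDiffOn_proj : ContDiffOn ℝ ∞ S.proj S.nhd :=
  contDiffOn_id.sub (S.smooth.smul S.contDiffOn_normal)

theorem contDiffAt_normal {x : E3} (hx : x ∈ S.nhd) : ContDiffAt ℝ ∞ S.normal x :=
  S.contDiffOn_normal.contDiffAt (S.isOpen.mem_nhds hx)

theorem contDiffAt_proj {x : E3} (hx : x ∈ S.nhd) : ContDiffAt ℝ ∞ S.proj x :=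
  S.contDiffOn_proj.contDiffAt (S.isOpen.mem_nhds hx)

theorem hasFDerivAt_normal {x : E3} (hx : x ∈ S.nhd) :
    HasFDerivAt S.normal (fderiv ℝ S.normal x) x :=
  ((S.contDiffAt_normal hx).differentiableAt (by simp)).hasFDerivAt

theorem fderiv_proj_apply {x : E3} (hx : x ∈ S.nhd) (v : E3) :
    fderiv ℝ S.proj x v =
      v - (S.d x • fderiv ℝ S.normal x v + ⟪S.normal x, v⟫ • S.normal x) := by
  have h := (hasFDerivAt_id x).sub ((S.hasFDerivAt_d hx).smul (S.hasFDerivAt_normal hx))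
  have h' : HasFDerivAt S.proj _ x := h
  rw [h'.fderiv]
  simp

/-- Near a point off the surface the signed distance is the distance up to a constant sign. -/
theorem eventually_d_eq {x : E3} (hx : x ∈ S.nhd) (hd : S.d x ≠ 0) :
    ∃ s : ℝ, |s| = 1 ∧ ∀ᶠ y in 𝓝 x, s * S.d y = infDist y S.carrier := by
  have hc : ContinuousAt S.d x := (S.contDiffAt_d hx).continuousAt
  rcases lt_or_gt_of_ne hd with h | h
  · refine ⟨-1, by simp, ?_⟩
    filter_upwards [hc.eventually_lt_const h, S.isOpen.mem_nhds hx] with y hy hyU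
    rw [← S.abs_d y hyU, abs_of_neg hy]; ring
  · refine ⟨1, by simp, ?_⟩
    filter_upwards [hc.eventually_const_lt h, S.isOpen.mem_nhds hx] with y hy hyU
    rw [← S.abs_d y hyU, abs_of_pos hy]; ring

/-- Off `Γ` the function `d` is, up to a locally constant sign, the distance to `Γ`, which is
1-Lipschitz, so `‖ν‖ ≤ 1`. Moving towards a nearest point `z` decreases the distance at unit speed
or faster, and equality in Cauchy–Schwarz forces `ν` to be the unit vector along `±(x - z)`. -/
theorem exists_closest_point (hne : S.carrier.Nonempty) {x : E3} (hx : x ∈ S.nhd)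
    (hd : S.d x ≠ 0) :
    ∃ z ∈ S.carrier, |S.d x| = ‖x - z‖ ∧ S.d x • S.normal x = x - z ∧ ‖S.normal x‖ = 1 := by
  obtain ⟨z, hz, hxz⟩ := S.isCompact.exists_infDist_eq_dist hne x
  have hD : |S.d x| = ‖x - z‖ := by rw [S.abs_d x hx, hxz, dist_eq_norm]
  obtain ⟨s, hs, hsd⟩ := S.eventually_d_eq hx hd
  have hs2 : s * s = 1 := by rw [← abs_mul_abs_self, hs, one_mul]
  set D := ‖x - z‖ with hDdef
  have hDpos : 0 < D := by rw [← hD]; exact abs_pos.2 hd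
  have hder : HasFDerivAt (fun y => infDist y S.carrier) (s • innerSL ℝ (S.normal x)) x :=
    ((S.hasFDerivAt_d hx).const_mul s).congr_of_eventuallyEq (hsd.mono fun y hy => hy.symm)
  have hle : ‖S.normal x‖ ≤ 1 := by
    have h1 := hder.le_of_lipschitz (lipschitz_infDist_pt S.carrier)
    rw [norm_smul, Real.norm_eq_abs, hs, one_mul] at h1
    simpa using h1
  have hline : HasDerivAt (fun t : ℝ => infDist (x + t • (z - x)) S.carrier)
      (s * ⟪S.normal x, z - x⟫) 0 := by
    have h1 : HasDerivAt (fun t : ℝ => x + t • (z - x)) (z - x) 0 := by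
      simpa using ((hasDerivAt_id (0 : ℝ)).smul_const (z - x)).const_add x
    have h2 := (HasFDerivAt.comp_hasDerivAt (0 : ℝ) (f := fun t : ℝ => x + t • (z - x))
      (by simpa using hder) h1)
    simpa [Function.comp_def] using h2.congr_deriv (by simp)
  have hslope : s * ⟪S.normal x, z - x⟫ ≤ -D := by
    -- The difference vanishes at `t = 0` and is nonpositive for `0 < t < 1`, since `z` remains a
    -- competitor at distance `(1 - t) D`; so its right derivative is nonpositive.
    have h1 : HasDerivWithinAt (fun t : ℝ => infDist (x + t • (z - x)) S.carrier - (1 - t) * D)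
        (s * ⟪S.normal x, z - x⟫ - (-1) * D) (Ioi 0) 0 :=
      (hline.sub (((hasDerivAt_id (0 : ℝ)).const_sub 1).mul_const D)).hasDerivWithinAt
    have h2 := hasDerivWithinAt_iff_tendsto_slope' (by simp) |>.1 h1
    have h3 : s * ⟪S.normal x, z - x⟫ - (-1) * D ≤ 0 := by
      refine le_of_tendsto h2 ?_
      filter_upwards [Ioo_mem_nhdsGT (zero_lt_one' ℝ)] with t ht
      have h4 : infDist (x + t • (z - x)) S.carrier ≤ (1 - t) * D := by
        refine (infDist_le_dist_of_mem hz).trans ?_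
        rw [dist_eq_norm, hDdef]
        have : x + t • (z - x) - z = (1 - t) • (x - z) := by module
        rw [this, norm_smul, Real.norm_of_nonneg (by linarith [ht.2])]
      have h5 : infDist x S.carrier = D := by rw [hxz, dist_eq_norm]
      rw [slope_def_field]
      apply div_nonpos_of_nonpos_of_nonneg
      · simp only [zero_smul, add_zero, h5]; linarith
      · linarith [ht.1]
    linarith
  -- Expanding the square gives at most `D² - 2D² + D²`.
  have hkey : ‖(s * D) • S.normal x - (x - z)‖ ^ 2 ≤ 0 := by
    rw [norm_sub_sq_real, norm_smul, real_inner_smul_left, mul_pow, Real.norm_eq_abs, sq_abs,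
      ← hDdef]
    have h1 : ⟪S.normal x, x - z⟫ = -⟪S.normal x, z - x⟫ := by rw [← inner_neg_right, neg_sub]
    have h2 : ‖S.normal x‖ ^ 2 ≤ 1 := by nlinarith [norm_nonneg (S.normal x)]
    have h3 : (s * D) ^ 2 = D ^ 2 := by rw [mul_pow, pow_two s, hs2, one_mul]
    rw [h1, h3]
    nlinarith [sq_nonneg D]
  have hkey2 : (s * D) • S.normal x = x - z := by
    rw [← sub_eq_zero, ← norm_eq_zero]
    nlinarith [norm_nonneg ((s * D) • S.normal x - (x - z))]
  have hdx : S.d x = s * D := by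
    have h1 : s * S.d x = D := by rw [hsd.self_of_nhds, hxz, dist_eq_norm]
    rw [← h1, ← mul_assoc, hs2, one_mul]
  refine ⟨z, hz, hD, by rw [hdx]; exact hkey2, ?_⟩
  have h1 : ‖(s * D) • S.normal x‖ = D := by rw [hkey2]
  rw [norm_smul, norm_mul, Real.norm_eq_abs, hs, one_mul, Real.norm_of_nonneg hDpos.le] at h1
  exact mul_left_cancel₀ hDpos.ne' (by rw [h1, mul_one])

/-- `ξ` maps `U` into `Γ`. -/
theorem proj_mem (hne : S.carrier.Nonempty) {x : E3} (hx : x ∈ S.nhd) :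
    S.proj x ∈ S.carrier := by
  by_cases hd : S.d x = 0
  · have : x ∈ S.carrier := by rw [S.carrier_eq]; exact ⟨hx, hd⟩
    rwa [S.proj_eq_self this]
  · obtain ⟨z, hz, -, h, -⟩ := S.exists_closest_point hne hx hd
    rw [proj, h, sub_sub_cancel]
    exact hz

/-- The eikonal equation `|∇d| = 1`. -/
theorem norm_normal (hne : S.carrier.Nonempty) {x : E3} (hx : x ∈ S.nhd) : ‖S.normal x‖ = 1 := by
  by_cases hd : S.d x = 0
  · have hmem : x ∈ S.carrier := by rw [S.carrier_eq]; exact ⟨hx, hd⟩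
    by_contra hcon
    have hc : ContinuousAt (fun y => ‖S.normal y‖) x := (S.contDiffAt_normal hx).continuousAt.norm
    -- Points off `Γ` have `‖ν‖ = 1`, so a different value at `x` would, by continuity, make `d`
    -- vanish near `x` and contradict the nonzero gradient.
    have h1 : ∀ᶠ y in 𝓝 x, S.d y = 0 := by
      filter_upwards [hc.eventually_ne hcon, S.isOpen.mem_nhds hx] with y hy hyU
      by_contra h2
      obtain ⟨-, -, -, -, h⟩ := S.exists_closest_point hne hyU h2
      exact hy h
    refine S.gradient_ne_zero x hmem ?_
    have h2 : HasFDerivAt S.d (0 : E3 →L[ℝ] ℝ) x :=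
      (hasFDerivAt_const (0 : ℝ) x).congr_of_eventuallyEq h1
    rw [gradient, h2.fderiv, map_zero]
  · obtain ⟨-, -, -, -, h⟩ := S.exists_closest_point hne hx hd
    exact h

/-- Differentiate the constant `‖ν‖² = 1`. -/
theorem inner_normal_fderiv_normal (hne : S.carrier.Nonempty) {x : E3} (hx : x ∈ S.nhd) (v : E3) :
    ⟪fderiv ℝ S.normal x v, S.normal x⟫ = 0 := by
  have h1 := (S.hasFDerivAt_normal hx).inner ℝ (S.hasFDerivAt_normal hx)
  have h2 : HasFDerivAt (fun y => ⟪S.normal y, S.normal y⟫) (0 : E3 →L[ℝ] ℝ) x := by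
    refine (hasFDerivAt_const (1 : ℝ) x).congr_of_eventuallyEq ?_
    filter_upwards [S.isOpen.mem_nhds hx] with y hy
    rw [real_inner_self_eq_norm_sq, S.norm_normal hne hy, one_pow]
  have h3 := congrArg (fun A : E3 →L[ℝ] ℝ => A v) (h1.unique h2)
  simp [fderivInnerCLM_apply] at h3
  rw [real_inner_comm] at h3
  rw [real_inner_comm]
  linarith [h3, real_inner_comm (S.normal x) (fderiv ℝ S.normal x v)]

/-- First-order Taylor expansion of the signed distance function. -/
theorem abs_d_sub_le {z x y n : E3} {c ρ : ℝ} (hsub : ball z ρ ⊆ S.nhd)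
    (hx : x ∈ ball z ρ) (hy : y ∈ ball z ρ) (hn : ∀ u ∈ ball z ρ, ‖S.normal u - n‖ ≤ c) :
    |S.d y - S.d x - ⟪n, y - x⟫| ≤ c * ‖y - x‖ := by
  have := (convex_ball z ρ).norm_image_sub_le_of_norm_hasFDerivWithin_le' (f := S.d)
    (f' := fun u => innerSL ℝ (S.normal u)) (φ := innerSL ℝ n) (C := c)
    (fun _ hu => (S.hasFDerivAt_d (hsub hu)).hasFDerivWithinAt)
    (fun u hu => by rw [← map_sub, innerSL_apply_norm]; exact hn u hu) hx hy
  simpa using this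

/-! ### Uniform tubular bounds -/

/-- `S` has tubular radius `r` and its normal is Lipschitz with constant `L` on balls of that
radius. -/
structure TubeBound (r L : ℝ) : Prop where
  r_pos : 0 < r
  one_le : 1 ≤ L
  subset : ∀ z ∈ S.carrier, ball z r ⊆ S.nhd
  norm_fderiv_le : ∀ z ∈ S.carrier, ∀ x ∈ ball z r, ‖fderiv ℝ S.normal x‖ ≤ L

/-- A closed thickening of the compact `Γ` is compact and still inside `U`, so `Dν` is bounded on
it. The numbers `r` and `L` are all that the final constant retains of the geometry of `Γ`. -/
theorem exists_tubeBound : ∃ r L, S.TubeBound r L := by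
  obtain ⟨δ, hδ, hsub⟩ := S.isCompact.exists_cthickening_subset_open S.isOpen S.carrier_subset
  have hcomp : IsCompact (cthickening δ S.carrier) := S.isCompact.cthickening
  have hcont : ContinuousOn (fderiv ℝ S.normal) (cthickening δ S.carrier) :=
    (S.contDiffOn_normal.continuousOn_fderiv_of_isOpen S.isOpen (by simp)).mono hsub
  obtain ⟨C, hC⟩ := hcomp.exists_bound_of_continuousOn hcont
  have hball : ∀ z ∈ S.carrier, ball z δ ⊆ cthickening δ S.carrier := fun z hz =>
    ball_subset_closedBall.trans (closedBall_subset_cthickening hz δ)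
  exact ⟨δ, max 1 C, hδ, le_max_left _ _, fun z hz => (hball z hz).trans hsub,
    fun z hz x hx => (hC x (hball z hz hx)).trans (le_max_right _ _)⟩

namespace TubeBound

variable {S} {r L : ℝ}

theorem norm_normal_sub_le (hT : S.TubeBound r L) {z x y : E3} (hz : z ∈ S.carrier) (hx : x ∈ ball z r)
    (hy : y ∈ ball z r) : ‖S.normal x - S.normal y‖ ≤ L * ‖x - y‖ :=
  (convex_ball z r).norm_image_sub_le_of_norm_hasFDerivWithin_le
    (fun _ hu => (S.hasFDerivAt_normal (hT.subset z hz hu)).hasFDerivWithinAt)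
    (fun u hu => hT.norm_fderiv_le z hz u hu) hy hx

theorem abs_d_le (hT : S.TubeBound r L) {z x : E3} (hz : z ∈ S.carrier) (hx : x ∈ ball z r) : |S.d x| ≤ ‖x - z‖ := by
  rw [S.abs_d x (hT.subset z hz hx), ← dist_eq_norm]
  exact infDist_le_dist_of_mem hz

end TubeBound

end SmoothSurface

/-! ### Geometry of a triangle -/

namespace Tri

variable (K : Tri)

/-- The `i`-th edge vector. -/
def edgeVec (i : Fin 3) : E3 := K.points (i + 2) - K.points (i + 1)

/-- The cross product of two edge vectors. -/
def areaVec : E3 := cross (K.points 1 - K.points 0) (K.points 2 - K.points 0)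

/-- Twice the area. -/
noncomputable def area₂ : ℝ := ‖K.areaVec‖

/-- The unit normal given by the ordering of the vertices. -/
noncomputable def unitNormal : E3 := K.area₂⁻¹ • K.areaVec

theorem points_ne {i j : Fin 3} (h : i ≠ j) : K.points i ≠ K.points j :=
  K.independent.injective.ne h

theorem edgeVec_ne_zero (i : Fin 3) : K.edgeVec i ≠ 0 :=
  sub_ne_zero.2 (K.points_ne (by fin_cases i <;> decide))

theorem norm_edgeVec_pos (i : Fin 3) : 0 < ‖K.edgeVec i‖ := norm_pos_iff.2 (K.edgeVec_ne_zero i)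

theorem cross_points (i : Fin 3) :
    cross (K.points (i + 1) - K.points i) (K.edgeVec i) = K.areaVec := by
  fin_cases i <;> simp only [edgeVec, areaVec] <;> apply ext_coord <;>
    simp [cross_zero', cross_one', cross_two'] <;> ring

/-- If the cross product of the edge vectors `a`, `b` vanished, `a × (a × b) = ⟪a, b⟫ a - ⟪a, a⟫ b`
would be a linear relation with nonzero coefficient `⟪a, a⟫`, against affine independence. -/
theorem areaVec_ne_zero : K.areaVec ≠ 0 := by
  intro h
  have hli := (affineIndependent_iff_linearIndependent_vsub ℝ K.points 0).1 K.independent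
  set a := K.points 1 - K.points 0
  set b := K.points 2 - K.points 0
  have hab : LinearIndependent ℝ ![a, b] := by
    have := hli.comp (fun i : Fin 2 => (⟨i.succ, Fin.succ_ne_zero i⟩ : {x : Fin 3 // x ≠ 0}))
      (fun i j hij => by simpa using hij)
    have h2 : ((fun i : {x : Fin 3 // x ≠ 0} => K.points i -ᵥ K.points 0) ∘
        fun i : Fin 2 => (⟨i.succ, Fin.succ_ne_zero i⟩ : {x : Fin 3 // x ≠ 0})) = ![a, b] := by
      ext i : 1
      fin_cases i <;> rfl
    rwa [h2] at this
  have h1 : ⟪a, b⟫ • a - ⟪a, a⟫ • b = 0 := by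
    rw [← cross_cross, show cross a b = 0 from h]
    simpa using cross_smul_right 0 a 0
  rw [LinearIndependent.pair_iff] at hab
  have h2 := (hab ⟪a, b⟫ (-⟪a, a⟫) (by rw [neg_smul, ← sub_eq_add_neg, h1])).2
  rw [neg_eq_zero, inner_self_eq_zero] at h2
  exact K.points_ne (by decide) (sub_eq_zero.1 h2)

theorem area₂_pos : 0 < K.area₂ := norm_pos_iff.2 K.areaVec_ne_zero

theorem areaVec_eq : K.areaVec = K.area₂ • K.unitNormal := by
  rw [unitNormal, smul_smul, mul_inv_cancel₀ K.area₂_pos.ne', one_smul]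

theorem norm_unitNormal : ‖K.unitNormal‖ = 1 := by
  rw [unitNormal, norm_smul, norm_inv, Real.norm_of_nonneg K.area₂_pos.le]
  exact inv_mul_cancel₀ K.area₂_pos.ne'

theorem inner_areaVec_sub (i j : Fin 3) : ⟪K.areaVec, K.points i - K.points j⟫ = 0 := by
  have h : ∀ i, ⟪K.areaVec, K.points i - K.points 0⟫ = 0 := by
    intro i
    rw [real_inner_comm]
    fin_cases i
    · simp
    · exact inner_cross_left _ _
    · exact inner_cross_right _ _
  have : K.points i - K.points j = (K.points i - K.points 0) - (K.points j - K.points 0) := by abel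
  rw [this, inner_sub_right, h, h, sub_zero]

theorem inner_unitNormal_sub (i j : Fin 3) : ⟪K.unitNormal, K.points i - K.points j⟫ = 0 := by
  rw [unitNormal, real_inner_smul_left, inner_areaVec_sub, mul_zero]

theorem inner_unitNormal_edgeVec (i : Fin 3) : ⟪K.unitNormal, K.edgeVec i⟫ = 0 :=
  K.inner_unitNormal_sub _ _

theorem plane_le_orthogonal : K.plane ≤ (ℝ ∙ K.unitNormal)ᗮ := by
  rw [plane, vectorSpan, Submodule.span_le]
  rintro _ ⟨_, ⟨i, rfl⟩, _, ⟨j, rfl⟩, rfl⟩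
  exact Submodule.mem_orthogonal_singleton_iff_inner_right.2 (K.inner_unitNormal_sub i j)

theorem inner_unitNormal_of_mem {v : E3} (hv : v ∈ K.plane) : ⟪K.unitNormal, v⟫ = 0 :=
  Submodule.mem_orthogonal_singleton_iff_inner_right.1 (K.plane_le_orthogonal hv)

theorem height_eq_norm (i : Fin 3) : K.height i = ‖K.altitudeFoot i - K.points i‖ := by
  rw [Affine.Simplex.height, dist_comm, dist_eq_norm]

theorem inner_conormal_sub {i j : Fin 3} (h : i ≠ j) :
    ⟪K.conormal i, K.points j - K.points i⟫ = K.height i := by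
  have h1 := K.inner_vsub_altitudeFoot_vsub_altitudeFoot_eq_zero h
  simp only [vsub_eq_sub] at h1
  have h0 := K.height_pos i
  rw [K.height_eq_norm] at h0 ⊢
  rw [conormal, real_inner_smul_left]
  set F := K.altitudeFoot i - K.points i with hF
  have h2 : K.points j - K.points i = F + (K.points j - K.altitudeFoot i) := by rw [hF]; abel
  have h3 : ⟪F, K.points j - K.altitudeFoot i⟫ = 0 := by
    rw [hF, ← neg_sub, inner_neg_left, real_inner_comm, h1, neg_zero]
  rw [h2, inner_add_right, h3, real_inner_self_eq_norm_sq]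
  field_simp
  ring

theorem add_one_ne (i : Fin 3) : i ≠ i + 1 := by fin_cases i <;> decide

theorem add_two_ne (i : Fin 3) : i ≠ i + 2 := by fin_cases i <;> decide

theorem inner_conormal_edgeVec (i : Fin 3) : ⟪K.conormal i, K.edgeVec i⟫ = 0 := by
  have : K.edgeVec i = (K.points (i + 2) - K.points i) - (K.points (i + 1) - K.points i) := by
    rw [edgeVec]; abel
  rw [this, inner_sub_right, K.inner_conormal_sub (add_two_ne i),
    K.inner_conormal_sub (add_one_ne i), sub_self]

/-- A unit vector orthogonal to the unit vector `n` and to `e` is a multiple of `e × n`. -/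
theorem _root_.SurfaceDG.eq_or_eq_neg_cross {m e n : E3} (hm : ‖m‖ = 1) (hn : ‖n‖ = 1)
    (he : e ≠ 0) (hmn : ⟪m, n⟫ = 0) (hme : ⟪m, e⟫ = 0) (hen : ⟪e, n⟫ = 0) :
    m = ‖e‖⁻¹ • cross e n ∨ m = -(‖e‖⁻¹ • cross e n) := by
  have he' : ‖e‖ ≠ 0 := norm_ne_zero_iff.2 he
  set u := ‖e‖⁻¹ • cross e n with hu
  have hu1 : ‖u‖ = 1 := by
    rw [hu, norm_smul, norm_inv, norm_norm, norm_cross_of_inner_eq_zero hen, hn, mul_one,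
      inv_mul_cancel₀ he']
  have h1 : cross m u = 0 := by
    rw [hu, cross_smul_right, cross_cross, hmn, hme]; simp
  have h2 := norm_cross_sq m u
  rw [h1, hm, hu1] at h2
  have h3 : (⟪m, u⟫ - 1) * (⟪m, u⟫ + 1) = 0 := by
    rw [norm_zero] at h2; linarith
  rcases mul_eq_zero.1 h3 with h | h
  · left
    rw [← sub_eq_zero, ← norm_eq_zero, ← sq_eq_zero_iff, norm_sub_sq_real, hm, hu1]
    linarith
  · right
    rw [← sub_eq_zero, ← norm_eq_zero, ← sq_eq_zero_iff, sub_neg_eq_add, norm_add_sq_real, hm, hu1]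
    linarith

theorem inner_cross_edgeVec (i : Fin 3) :
    ⟪cross (K.edgeVec i) K.unitNormal, K.points (i + 1) - K.points i⟫ = K.area₂ := by
  rw [real_inner_comm, inner_cross_rotate, inner_cross_rotate, cross_points, areaVec_eq,
    real_inner_smul_right, real_inner_self_eq_norm_sq, norm_unitNormal]
  simp

/-- A unit vector of the plane orthogonal to the edge is determined up to sign, and positivity of
the height selects the sign. Conormals of neighbouring triangles are compared in this form. -/
theorem conormal_eq (i : Fin 3) :
    K.conormal i = ‖K.edgeVec i‖⁻¹ • cross (K.edgeVec i) K.unitNormal := by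
  have hn : ⟪K.conormal i, K.unitNormal⟫ = 0 := by
    rw [real_inner_comm]; exact K.inner_unitNormal_of_mem (K.conormal_mem_plane i)
  have he : ⟪K.edgeVec i, K.unitNormal⟫ = 0 := by
    rw [real_inner_comm]; exact K.inner_unitNormal_edgeVec i
  rcases eq_or_eq_neg_cross (K.norm_conormal i) K.norm_unitNormal (K.edgeVec_ne_zero i) hn
    (K.inner_conormal_edgeVec i) he with h | h
  · exact h
  · exfalso
    have h1 := K.inner_conormal_sub (add_one_ne i)
    rw [h, inner_neg_left, real_inner_smul_left, inner_cross_edgeVec] at h1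
    have := mul_pos (inv_pos.2 (K.norm_edgeVec_pos i)) K.area₂_pos
    linarith [K.height_pos i]

theorem height_mul_norm_edgeVec (i : Fin 3) : K.height i * ‖K.edgeVec i‖ = K.area₂ := by
  rw [← K.inner_conormal_sub (add_one_ne i), conormal_eq, real_inner_smul_left,
    inner_cross_edgeVec]
  field_simp [(K.norm_edgeVec_pos i).ne']

/-! #### Barycentric coordinates -/

/-- The `i`-th barycentric coordinate, extended constantly along the normal. -/
noncomputable def bary (i : Fin 3) (x : E3) : ℝ :=
  (K.height i)⁻¹ * ⟪K.conormal i, K.points (i + 1) - x⟫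

theorem continuous_bary (i : Fin 3) : Continuous (K.bary i) := by
  unfold bary; fun_prop

/-- Up to the factor `area₂⁻²` the coordinate becomes polynomial in the vertices and `x`, so the
partition of unity and the reconstruction of a point reduce to polynomial identities. -/
theorem bary_eq (i : Fin 3) (x : E3) :
    K.bary i x = (K.area₂ ^ 2)⁻¹ * ⟪cross (K.edgeVec i) K.areaVec, K.points (i + 1) - x⟫ := by
  have h1 := (K.norm_edgeVec_pos i).ne'
  have h2 := K.area₂_pos.ne'
  have h3 := (K.height_pos i).ne'
  rw [bary, conormal_eq, areaVec_eq, cross_smul_right, real_inner_smul_left, real_inner_smul_left,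
    ← K.height_mul_norm_edgeVec i]
  field_simp

theorem area₂_sq : K.area₂ ^ 2 = ⟪K.areaVec, K.areaVec⟫ := (real_inner_self_eq_norm_sq _).symm

theorem sum_bary (x : E3) : K.bary 0 x + K.bary 1 x + K.bary 2 x = 1 := by
  have h2 : K.area₂ ^ 2 ≠ 0 := pow_ne_zero 2 K.area₂_pos.ne'
  rw [bary_eq, bary_eq, bary_eq, ← mul_add, ← mul_add, inv_mul_eq_iff_eq_mul₀ h2, mul_one,
    area₂_sq]
  simp only [edgeVec, areaVec, inner_eq_sum, cross_zero', cross_one', cross_two', PiLp.sub_apply,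
    Fin.isValue, zero_add, Fin.reduceAdd]
  ring

theorem eq_of_inner_eq_zero {x : E3} (hx : ⟪K.unitNormal, x - K.points 0⟫ = 0) :
    x = K.points 0 + K.bary 1 x • (K.points 1 - K.points 0) +
      K.bary 2 x • (K.points 2 - K.points 0) := by
  have h2 : K.area₂ ^ 2 ≠ 0 := pow_ne_zero 2 K.area₂_pos.ne'
  have hx' : ⟪K.areaVec, x - K.points 0⟫ = 0 := by
    rw [areaVec_eq, real_inner_smul_left, hx, mul_zero]
  -- An identity valid for every `x`, resolving `x - x₀` along two edges and the normal; the normal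
  -- term drops out in the plane of `K`.
  have key : (K.area₂ ^ 2) • (x - K.points 0) =
      ⟪cross (K.edgeVec 1) K.areaVec, K.points 2 - x⟫ • (K.points 1 - K.points 0) +
      ⟪cross (K.edgeVec 2) K.areaVec, K.points 0 - x⟫ • (K.points 2 - K.points 0) +
      ⟪K.areaVec, x - K.points 0⟫ • K.areaVec := by
    rw [area₂_sq]
    apply ext_coord <;>
    simp only [edgeVec, areaVec, inner_eq_sum, cross_zero', cross_one', cross_two', PiLp.sub_apply,
      PiLp.add_apply, PiLp.smul_apply, smul_eq_mul, Fin.isValue, Fin.reduceAdd] <;>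
    ring
  rw [hx', zero_smul, add_zero] at key
  rw [bary_eq, bary_eq]
  have h3 : x - K.points 0 = (K.area₂ ^ 2)⁻¹ • ((K.area₂ ^ 2) • (x - K.points 0)) := by
    rw [smul_smul, inv_mul_cancel₀ h2, one_smul]
  rw [key, smul_add, smul_smul, smul_smul] at h3
  rw [add_assoc]
  exact sub_eq_iff_eq_add'.1 h3

theorem points_mem (i : Fin 3) : K.points i ∈ K.carrier :=
  subset_convexHull ℝ _ (mem_range_self i)

theorem convex_carrier : Convex ℝ K.carrier := convex_convexHull ℝ _

theorem isCompact_carrier : IsCompact K.carrier := (finite_range K.points).isCompact_convexHull ℝ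

theorem combination_mem {a b c : ℝ} (ha : 0 ≤ a) (hb : 0 ≤ b) (hc : 0 ≤ c) (h : a + b + c = 1) :
    a • K.points 0 + b • K.points 1 + c • K.points 2 ∈ K.carrier := by
  have := K.convex_carrier.sum_mem (t := Finset.univ) (w := ![a, b, c]) (z := K.points)
    (by intro i _; fin_cases i <;> assumption) (by simp [Fin.sum_univ_three, h])
    (fun i _ => K.points_mem i)
  simpa [Fin.sum_univ_three] using this

theorem mem_carrier {x : E3} (hx : ⟪K.unitNormal, x - K.points 0⟫ = 0)
    (h : ∀ i, 0 ≤ K.bary i x) : x ∈ K.carrier := by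
  have h1 := K.combination_mem (h 0) (h 1) (h 2) (K.sum_bary x)
  convert h1 using 1
  conv_lhs => rw [K.eq_of_inner_eq_zero hx]
  have : K.bary 0 x = 1 - K.bary 1 x - K.bary 2 x := by linarith [K.sum_bary x]
  rw [this]
  module

theorem bary_points_self (i : Fin 3) : K.bary i (K.points i) = 1 := by
  rw [bary, K.inner_conormal_sub (add_one_ne i), inv_mul_cancel₀ (K.height_pos i).ne']

theorem bary_points_of_ne {i j : Fin 3} (h : i ≠ j) : K.bary i (K.points j) = 0 := by
  have : K.points (i + 1) - K.points j =
      (K.points (i + 1) - K.points i) - (K.points j - K.points i) := by abel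
  rw [bary, this, inner_sub_right, K.inner_conormal_sub (add_one_ne i), K.inner_conormal_sub h,
    sub_self, mul_zero]

theorem bary_lineMap (i : Fin 3) (x y : E3) (t : ℝ) :
    K.bary i (AffineMap.lineMap x y t) = (1 - t) * K.bary i x + t * K.bary i y := by
  have : K.points (i + 1) - AffineMap.lineMap (k := ℝ) x y t =
      (1 - t) • (K.points (i + 1) - x) + t • (K.points (i + 1) - y) := by
    rw [AffineMap.lineMap_apply_module (k := ℝ)]; module
  rw [bary, bary, bary, this, inner_add_right, real_inner_smul_right, real_inner_smul_right]
  ring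

/-- The midpoint of the `i`-th edge. -/
noncomputable def mid (i : Fin 3) : E3 :=
  AffineMap.lineMap (K.points (i + 1)) (K.points (i + 2)) (1 / 2 : ℝ)

theorem inner_unitNormal_mid (i : Fin 3) : ⟪K.unitNormal, K.mid i - K.points 0⟫ = 0 := by
  have : K.mid i - K.points 0 = (1 / 2 : ℝ) • (K.points (i + 1) - K.points 0) +
      (1 / 2 : ℝ) • (K.points (i + 2) - K.points 0) := by
    rw [mid, AffineMap.lineMap_apply_module]; module
  rw [this, inner_add_right, real_inner_smul_right, real_inner_smul_right, inner_unitNormal_sub,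
    inner_unitNormal_sub]
  simp

/-- Near the midpoint of an edge, the triangle contains the side of its plane opposite to the
conormal. -/
theorem exists_ball_mid (i : Fin 3) : ∃ δ > 0, ∀ x, ‖x - K.mid i‖ < δ →
    ⟪K.unitNormal, x - K.points 0⟫ = 0 → ⟪K.conormal i, x - K.mid i⟫ ≤ 0 → x ∈ K.carrier := by
  -- The other two coordinates equal `1/2` at the midpoint and stay positive nearby; the `i`-th has
  -- the sign of `-⟪conormal, x - mid⟫`.
  have h1 : ∀ j, j ≠ i → 0 < K.bary j (K.mid i) := by
    intro j hj
    rw [mid, bary_lineMap]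
    have : j = i + 1 ∨ j = i + 2 := by
      revert hj; fin_cases i <;> fin_cases j <;> decide
    have h12 : i + 1 ≠ i + 2 := by fin_cases i <;> decide
    rcases this with rfl | rfl
    · rw [bary_points_self, K.bary_points_of_ne h12]; norm_num
    · rw [bary_points_self, K.bary_points_of_ne h12.symm]; norm_num
  have h2 : ∀ᶠ x in nhds (K.mid i), ∀ j, j ≠ i → 0 < K.bary j x := by
    rw [Filter.eventually_all]
    intro j
    by_cases hj : j = i
    · simp [hj]
    · filter_upwards [(K.continuous_bary j).continuousAt.eventually_const_lt (h1 j hj)] with x hx _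
      exact hx
  obtain ⟨δ, hδ, hball⟩ := Metric.eventually_nhds_iff.1 h2
  refine ⟨δ, hδ, fun x hx hn hc => K.mem_carrier hn fun j => ?_⟩
  by_cases hj : j = i
  · subst hj
    have h3 : K.points (j + 1) - x = -((x - K.mid j) + (1 / 2 : ℝ) • K.edgeVec j) := by
      rw [mid, AffineMap.lineMap_apply_module, edgeVec]; module
    rw [bary, h3, inner_neg_right, inner_add_right, real_inner_smul_right, inner_conormal_edgeVec]
    have := K.height_pos j
    have h4 : 0 ≤ -(⟪K.conormal j, x - K.mid j⟫ + 1 / 2 * 0) := by linarith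
    positivity
  · exact (hball (by rwa [dist_eq_norm]) j hj).le

/-! #### Size and shape -/

theorem dist_points_le (i j : Fin 3) : ‖K.points i - K.points j‖ ≤ diam K.carrier := by
  rw [← dist_eq_norm]
  exact dist_le_diam_of_mem K.isCompact_carrier.isBounded (K.points_mem i) (K.points_mem j)

theorem norm_edgeVec_le (i : Fin 3) : ‖K.edgeVec i‖ ≤ diam K.carrier := K.dist_points_le _ _

theorem norm_sub_le {x y : E3} (hx : x ∈ K.carrier) (hy : y ∈ K.carrier) :
    ‖x - y‖ ≤ diam K.carrier := by
  rw [← dist_eq_norm]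
  exact dist_le_diam_of_mem K.isCompact_carrier.isBounded hx hy

theorem diam_pos : 0 < diam K.carrier := (K.norm_edgeVec_pos 0).trans_le (K.norm_edgeVec_le 0)

theorem exists_diam_le : ∃ i, diam K.carrier ≤ ‖K.edgeVec i‖ := by
  obtain ⟨i, -, hi⟩ := Finset.exists_max_image Finset.univ (fun i => ‖K.edgeVec i‖)
    Finset.univ_nonempty
  refine ⟨i, ?_⟩
  rw [carrier, convexHull_diam]
  refine diam_le_of_forall_dist_le (norm_nonneg _) ?_
  rintro _ ⟨a, rfl⟩ _ ⟨b, rfl⟩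
  rw [dist_eq_norm]
  have h : ∀ j, ‖K.points (j + 2) - K.points (j + 1)‖ ≤ ‖K.edgeVec i‖ := fun j =>
    hi j (Finset.mem_univ _)
  have h0 := h 0
  have h1 := h 1
  have h2 := h 2
  have h0' := h0
  have h1' := h1
  have h2' := h2
  rw [norm_sub_rev] at h0' h1' h2'
  fin_cases a <;> fin_cases b <;> first | (simp; done) | assumption

/-- The inradius is the reciprocal of the sum of the reciprocal heights. -/
theorem inradius_le_height (i : Fin 3) : K.inradius ≤ K.height i := by
  rw [Affine.Simplex.inradius_eq_abs_inv_sum]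
  simp only [Affine.Simplex.excenterWeightsUnnorm_empty_apply]
  have hp : ∀ j, 0 < (K.height j)⁻¹ := fun j => inv_pos.2 (K.height_pos j)
  have h1 : (K.height i)⁻¹ ≤ ∑ j, (K.height j)⁻¹ :=
    Finset.single_le_sum (f := fun j => (K.height j)⁻¹) (fun j _ => (hp j).le) (Finset.mem_univ i)
  rw [abs_of_nonneg (inv_nonneg.2 ((hp i).le.trans h1))]
  exact inv_le_of_inv_le₀ (K.height_pos i) h1

/-- The edge with index `j` issues from vertex `j + 1` and ends on the side opposite to that vertex.
-/
theorem height_le_norm_edgeVec (j : Fin 3) : K.height (j + 1) ≤ ‖K.edgeVec j‖ := by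
  have h := K.inner_conormal_sub (add_one_ne (j + 1))
  rw [← h]
  refine (real_inner_le_norm _ _).trans ?_
  rw [norm_conormal, one_mul, edgeVec, add_assoc]
  exact le_rfl

/-- The longest edge times its height is twice the area, and that height is at least the inradius.
Dividing a flux sum of order `h³` by the area then leaves order `h`. -/
theorem sq_diam_le {σ : ℝ} (hσ : 0 ≤ σ) (h : diam K.carrier ≤ σ * (2 * K.inradius)) :
    diam K.carrier ^ 2 ≤ 2 * σ * K.area₂ := by
  obtain ⟨i, hi⟩ := K.exists_diam_le
  have h1 := K.inradius_le_height i
  have h2 : diam K.carrier ≤ 2 * σ * K.height i := h.trans (by nlinarith)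
  rw [pow_two, ← K.height_mul_norm_edgeVec i, ← mul_assoc]
  have := K.height_pos i
  gcongr

/-- Applied to a neighbour, this bounds its diameter by the length of the common edge. -/
theorem diam_le_edge {σ : ℝ} (hσ : 0 ≤ σ) (h : diam K.carrier ≤ σ * (2 * K.inradius)) (j : Fin 3) :
    diam K.carrier ≤ 2 * σ * ‖K.edgeVec j‖ := by
  have h1 := (K.inradius_le_height (j + 1)).trans (K.height_le_norm_edgeVec j)
  exact h.trans (by nlinarith)

end Tri

/-! ### The lowest order Raviart–Thomas element -/

namespace Tri

variable (K : Tri)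

/-- The field `x ↦ ∑ᵢ cᵢ (x - xᵢ)`. -/
def rtField (c : Fin 3 → ℝ) (x : E3) : E3 :=
  c 0 • (x - K.points 0) + c 1 • (x - K.points 1) + c 2 • (x - K.points 2)

theorem rtField_mem (c : Fin 3 → ℝ) : K.rtField c ∈ K.RT0 := by
  refine ⟨![-c 1, -c 2], c 0 + c 1 + c 2, ?_⟩
  funext x
  simp only [rtField, Matrix.cons_val_zero, Matrix.cons_val_one]
  module

theorem exists_eq_rtField {v : E3 → E3} (hv : v ∈ K.RT0) : ∃ c, v = K.rtField c := by
  obtain ⟨p, t, rfl⟩ := hv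
  refine ⟨![t + p 0 + p 1, -p 0, -p 1], ?_⟩
  funext x
  simp only [rtField, Matrix.cons_val_zero, Matrix.cons_val_one, Matrix.cons_val]
  module

theorem lineMap_sub_point (i j : Fin 3) (t : ℝ) :
    AffineMap.lineMap (K.points (i + 1)) (K.points (i + 2)) t - K.points j =
      (K.points (i + 1) - K.points j) + t • K.edgeVec i := by
  rw [AffineMap.lineMap_apply_module, edgeVec]; module

/-- The field `x - xⱼ` is parallel to the two edges through `xⱼ` and has constant normal component
on the third, so these fields are dual to the edge fluxes. -/
theorem inner_conormal_lineMap (i j : Fin 3) (t : ℝ) :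
    ⟪K.conormal i, AffineMap.lineMap (K.points (i + 1)) (K.points (i + 2)) t - K.points j⟫ =
      if j = i then K.height i else 0 := by
  rw [lineMap_sub_point, inner_add_right, real_inner_smul_right, inner_conormal_edgeVec, mul_zero,
    add_zero]
  split_ifs with h
  · rw [h, K.inner_conormal_sub (add_one_ne i)]
  · have : K.points (i + 1) - K.points j =
      (K.points (i + 1) - K.points i) - (K.points j - K.points i) := by abel
    rw [this, inner_sub_right, K.inner_conormal_sub (add_one_ne i),
      K.inner_conormal_sub (Ne.symm h), sub_self]

theorem edgeIntegral_rtField (c : Fin 3 → ℝ) (i : Fin 3) :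
    K.edgeIntegral i (fun x => ⟪K.rtField c x, K.conormal i⟫) = c i * K.area₂ := by
  have h : ∀ t : ℝ, ⟪K.rtField c (AffineMap.lineMap (K.points (i + 1)) (K.points (i + 2)) t),
      K.conormal i⟫ = c i * K.height i := by
    intro t
    rw [real_inner_comm, rtField, inner_add_right, inner_add_right, real_inner_smul_right,
      real_inner_smul_right, real_inner_smul_right, inner_conormal_lineMap, inner_conormal_lineMap,
      inner_conormal_lineMap]
    fin_cases i <;> simp
  rw [edgeIntegral]
  simp only [h]
  rw [intervalIntegral.integral_const, sub_zero, one_smul, dist_comm, dist_eq_norm,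
    ← K.height_mul_norm_edgeVec i, edgeVec]
  ring

theorem trace_starProjection_plane :
    LinearMap.trace ℝ E3 (K.plane.starProjection : E3 →ₗ[ℝ] E3) = 2 := by
  have h : LinearMap.IsProj K.plane (K.plane.starProjection : E3 →ₗ[ℝ] E3) :=
    ⟨fun x => K.plane.starProjection_apply_mem x,
      fun x hx => Submodule.starProjection_eq_self_iff.2 hx⟩
  rw [h.trace]
  have h2 : Module.finrank ℝ K.plane = 2 :=
    K.independent.finrank_vectorSpan (by simp)
  rw [h2]; norm_num

/-- The derivative is a multiple of the identity, and projection onto a plane has trace `2`. -/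
theorem surfDiv_rtField (c : Fin 3 → ℝ) (x : E3) :
    K.surfDiv (K.rtField c) x = 2 * (c 0 + c 1 + c 2) := by
  have h : HasFDerivAt (K.rtField c) ((c 0 + c 1 + c 2) • ContinuousLinearMap.id ℝ E3) x := by
    have h1 : ∀ i, HasFDerivAt (fun x => c i • (x - K.points i))
        (c i • ContinuousLinearMap.id ℝ E3) x := fun i =>
      ((hasFDerivAt_id x).sub_const _).const_smul (c i)
    refine HasFDerivAt.congr_fderiv (((h1 0).add (h1 1)).add (h1 2)) ?_
    ext1 v
    simp [add_smul]
  rw [surfDiv, tangentialDiv, h.fderiv, ContinuousLinearMap.comp_smul,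
    ContinuousLinearMap.comp_id, ContinuousLinearMap.toLinearMap_smul, map_smul,
    trace_starProjection_plane, smul_eq_mul, mul_comm]

theorem normLinf_const_le {f : E3 → ℝ} {c : ℝ} (h : ∀ x, |f x| ≤ c) :
    K.normLinf f ≤ ENNReal.ofReal c := by
  rw [normLinf, eLpNorm_exponent_top]
  refine eLpNormEssSup_le_of_ae_bound (Filter.Eventually.of_forall h)

theorem _root_.SurfaceDG.norm_inv_norm_smul_le (v : E3) : ‖‖v‖⁻¹ • v‖ ≤ 1 := by
  rw [norm_smul, norm_inv, norm_norm]
  exact inv_mul_le_one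

end Tri

/-! ### Existence, uniqueness and divergence of the interpolant -/

namespace SurfaceMesh

variable {S : SmoothSurface} (M : SurfaceMesh S)

/-- The prescribed flux through the `i`-th edge of `K`, when the neighbour across that edge is `p`.
-/
noncomputable def flux (f : E3 → E3) (K : Tri) (i : Fin 3) (p : Tri × Fin 3) : ℝ :=
  K.edgeIntegral i (fun x => ⟪f x, avgConormal (K.conormal i) (p.1.conormal p.2)⟫)

theorem exists_neighbours {K : Tri} (hK : K ∈ M.triangles) : ∃ nb : Fin 3 → Tri × Fin 3,
    ∀ i, (nb i).1 ∈ M.triangles ∧ (nb i).1 ≠ K ∧ (nb i).1.edge (nb i).2 = K.edge i ∧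
      ∀ p : Tri × Fin 3, p.1 ∈ M.triangles → p.1 ≠ K → p.1.edge p.2 = K.edge i → p = nb i := by
  choose nb h h' using M.closed K hK
  exact ⟨nb, fun i => ⟨(h i).1, (h i).2.1, (h i).2.2, fun p h1 h2 h3 => h' i p ⟨h1, h2, h3⟩⟩⟩

/-- Uniqueness of the neighbour reduces the conditions over all `K'` and `j` to one equation per
edge, and in the dual basis this system is diagonal. -/
theorem isRTInterpolant_rtField_iff {f : E3 → E3} {K : Tri} {nb : Fin 3 → Tri × Fin 3}
    (hnb : ∀ i, (nb i).1 ∈ M.triangles ∧ (nb i).1 ≠ K ∧ (nb i).1.edge (nb i).2 = K.edge i ∧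
      ∀ p : Tri × Fin 3, p.1 ∈ M.triangles → p.1 ≠ K → p.1.edge p.2 = K.edge i → p = nb i)
    (c : Fin 3 → ℝ) :
    M.IsRTInterpolant f K (K.rtField c) ↔ c = fun i => flux f K i (nb i) / K.area₂ := by
  have hA := K.area₂_pos.ne'
  constructor
  · rintro ⟨-, h⟩
    funext i
    rw [eq_div_iff hA, ← K.edgeIntegral_rtField c i]
    exact h i (nb i).2 (nb i).1 (hnb i).1 (hnb i).2.1 (hnb i).2.2.1
  · rintro rfl
    refine ⟨K.rtField_mem _, fun i j K' h1 h2 h3 => ?_⟩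
    have h4 := (hnb i).2.2.2 (K', j) h1 h2 h3
    rw [K.edgeIntegral_rtField, div_mul_cancel₀ _ hA, ← h4]
    rfl

/-- The Raviart–Thomas interpolant exists, is unique, and has constant divergence. -/
theorem existsUnique_isRTInterpolant (f : E3 → E3) {K : Tri} {nb : Fin 3 → Tri × Fin 3}
    (hnb : ∀ i, (nb i).1 ∈ M.triangles ∧ (nb i).1 ≠ K ∧ (nb i).1.edge (nb i).2 = K.edge i ∧
      ∀ p : Tri × Fin 3, p.1 ∈ M.triangles → p.1 ≠ K → p.1.edge p.2 = K.edge i → p = nb i) :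
    (∃! v, M.IsRTInterpolant f K v) ∧ ∀ v, M.IsRTInterpolant f K v → ∀ x,
      K.surfDiv v x = 2 * (flux f K 0 (nb 0) + flux f K 1 (nb 1) + flux f K 2 (nb 2)) / K.area₂ := by
  refine ⟨⟨_, (M.isRTInterpolant_rtField_iff hnb _).2 rfl, ?_⟩, ?_⟩
  · intro v hv
    obtain ⟨c, rfl⟩ := K.exists_eq_rtField hv.1
    rw [(M.isRTInterpolant_rtField_iff hnb c).1 hv]
  · intro v hv x
    obtain ⟨c, rfl⟩ := K.exists_eq_rtField hv.1
    rw [(M.isRTInterpolant_rtField_iff hnb c).1 hv, K.surfDiv_rtField]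
    ring

end SurfaceMesh

/-! ### Lipschitz continuity of `W^{1,∞}` functions -/

open scoped Convolution in
/-- The derivative of a mollified `W^{1,∞}` function is bounded by its weak derivative. -/
theorem norm_fderiv_mollify_le {Ω : Set E2} (hΩ : IsOpen Ω) {g : E2 → E3} {Dg : E2 → E2 →L[ℝ] E3}
    {C : ℝ} (hC0 : 0 ≤ C) (hC : ∀ᵐ x ∂(volume.restrict Ω), ‖Dg x‖ ≤ C)
    (hG : LocallyIntegrable (Ω.indicator g) volume)
    (hweak : ∀ φ : E2 → ℝ, ContDiff ℝ ∞ φ → HasCompactSupport φ → tsupport φ ⊆ Ω →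
        ∀ e : E2, ∫ x in Ω, fderiv ℝ φ x e • g x = -∫ x in Ω, φ x • Dg x e)
    (φ : ContDiffBump (0 : E2)) {p : E2} (hp : closedBall p φ.rOut ⊆ Ω) :
    ‖((fderiv ℝ (φ.normed volume)) ⋆[(ContinuousLinearMap.lsmul ℝ ℝ).precompL E2, volume]
      (Ω.indicator g)) p‖ ≤ C := by
  set f := φ.normed (volume : Measure E2) with hf
  have hfc : ContDiff ℝ ∞ f := φ.contDiff_normed (n := ⊤)
  have hfs : HasCompactSupport f := φ.hasCompactSupport_normed
  have hint := (hfs.fderiv ℝ).convolutionExists_left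
    ((ContinuousLinearMap.lsmul ℝ ℝ : ℝ →L[ℝ] E3 →L[ℝ] E3).precompL E2)
    (hfc.continuous_fderiv (by simp)) hG p
  refine ContinuousLinearMap.opNorm_le_bound _ hC0 fun v => ?_
  have hψd : ∀ z, fderiv ℝ (fun z => f (p - z)) z v = -fderiv ℝ f (p - z) v := by
    intro z
    have h1 : HasFDerivAt (fun z : E2 => p - z) (-ContinuousLinearMap.id ℝ E2) z :=
      (hasFDerivAt_id z).const_sub p
    have h2 : HasFDerivAt f (fderiv ℝ f (p - z)) (p - z) :=
      (hfc.differentiable (by simp) _).hasFDerivAt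
    have h3 : HasFDerivAt (fun z => f (p - z)) _ z := h2.comp z h1
    rw [h3.fderiv]
    simp
  have hψs : tsupport (fun z => f (p - z)) ⊆ closedBall p φ.rOut := by
    refine closure_minimal ?_ isClosed_closedBall
    intro z hz
    have h1 : p - z ∈ Function.support f := hz
    rw [hf, φ.support_normed_eq, mem_ball_zero_iff] at h1
    rw [mem_closedBall, dist_eq_norm, norm_sub_rev]
    exact h1.le
  have hψc : ContDiff ℝ ∞ (fun z => f (p - z)) := hfc.comp (contDiff_const.sub contDiff_id)
  -- The mollifier reflected about `p` is an admissible test function. The sign from the reflection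
  -- cancels the one in the weak derivative, so the mollified derivative is an average of `Dg` with
  -- nonnegative weights of total mass one.
  have h1 := hweak _ hψc (HasCompactSupport.of_support_subset_isCompact (isCompact_closedBall p _)
    (subset_closure.trans hψs)) (hψs.trans hp) v
  have h2 : (((fderiv ℝ f) ⋆[(ContinuousLinearMap.lsmul ℝ ℝ).precompL E2, volume]
      (Ω.indicator g)) p) v = ∫ x in Ω, f (p - x) • Dg x v := by
    rw [convolution_def, ContinuousLinearMap.integral_apply hint]
    have h3 : ∀ t, ((ContinuousLinearMap.lsmul ℝ ℝ : ℝ →L[ℝ] E3 →L[ℝ] E3).precompL E2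
        (fderiv ℝ f t) (Ω.indicator g (p - t))) v =
        (fun z => Ω.indicator (fun z => fderiv ℝ f (p - z) v • g z) z) (p - t) := by
      intro t
      simp only [ContinuousLinearMap.precompL_apply, ContinuousLinearMap.lsmul_apply, indicator]
      split_ifs <;> simp
    simp only [h3]
    rw [integral_sub_left_eq_self (fun z => Ω.indicator (fun z => fderiv ℝ f (p - z) v • g z) z)
      volume p, integral_indicator hΩ.measurableSet]
    simp only [hψd, neg_smul, integral_neg] at h1
    exact neg_injective h1
  rw [h2]
  have hfi : Integrable (fun x => f (p - x)) := by
    have : Integrable f := φ.integrable_normed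
    exact this.comp_sub_left p
  calc ‖∫ x in Ω, f (p - x) • Dg x v‖ ≤ ∫ x in Ω, f (p - x) * (C * ‖v‖) := by
        refine norm_integral_le_of_norm_le (hfi.restrict.mul_const _) ?_
        filter_upwards [hC] with x hx
        rw [norm_smul, Real.norm_of_nonneg (φ.nonneg_normed _)]
        have := φ.nonneg_normed (μ := volume) (p - x)
        gcongr
        exact (Dg x).le_of_opNorm_le hx v
    _ = (∫ x in Ω, f (p - x)) * (C * ‖v‖) := integral_mul_const _ _
    _ ≤ (∫ x, f (p - x)) * (C * ‖v‖) := by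
        gcongr
        · exact Filter.Eventually.of_forall fun x => φ.nonneg_normed _
        · exact Measure.restrict_le_self
    _ = C * ‖v‖ := by
        rw [integral_sub_left_eq_self f volume p, hf, φ.integral_normed, one_mul]

/-- A continuous function of class `W^{1,∞}` on a convex bounded open set is Lipschitz. -/
theorem MemW1Inf.exists_lipschitzOnWith {Ω : Set E2} (hΩ : IsOpen Ω) (hconv : Convex ℝ Ω)
    (hfin : volume Ω ≠ ⊤) {g : E2 → E3} (hg : ContinuousOn g Ω) (h : MemW1Inf Ω g) :
    ∃ C, LipschitzOnWith C g Ω := by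
  obtain ⟨hgi, Dg, hDg, hweak⟩ := h
  have : IsFiniteMeasure (volume.restrict Ω) := ⟨by simpa using hfin.lt_top⟩
  have hGi : Integrable (Ω.indicator g) volume :=
    (integrable_indicator_iff hΩ.measurableSet).2 (hgi.integrable le_top)
  set C : ℝ≥0 := (eLpNormEssSup Dg (volume.restrict Ω)).toNNReal with hCdef
  have hC : ∀ᵐ x ∂(volume.restrict Ω), ‖Dg x‖ ≤ C := by
    have h1 : eLpNormEssSup Dg (volume.restrict Ω) ≠ ⊤ := by
      have := hDg.2.ne
      rwa [eLpNorm_exponent_top] at this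
    filter_upwards [ae_le_eLpNormEssSup (f := Dg) (μ := volume.restrict Ω)] with x hx
    rw [← ENNReal.coe_toNNReal h1] at hx
    exact_mod_cast hx
  refine ⟨C, LipschitzOnWith.of_dist_le_mul fun x hx y hy => ?_⟩
  refine le_of_forall_pos_le_add fun η hη => ?_
  have hseg : IsCompact (segment ℝ x y) := by
    rw [segment_eq_image_lineMap]
    exact isCompact_Icc.image AffineMap.lineMap_continuous
  -- By convexity the segment lies in `Ω`, and by compactness so does a neighbourhood of it;
  -- mollification at radius at most `δ` therefore sees only `Ω` along the whole segment.
  obtain ⟨δ, hδ, hsub⟩ := hseg.exists_cthickening_subset_open hΩ (hconv.segment_subset hx hy)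
  have hcont : ∀ z ∈ Ω, ∃ ε > 0, ∀ u ∈ ball z ε, dist (Ω.indicator g u) (Ω.indicator g z) ≤ η / 2 := by
    intro z hz
    have h1 : ContinuousAt (Ω.indicator g) z := by
      refine (hg.continuousAt (hΩ.mem_nhds hz)).congr ?_
      filter_upwards [hΩ.mem_nhds hz] with u hu
      rw [indicator_of_mem hu]
    obtain ⟨ε, hε, h2⟩ := Metric.continuousAt_iff.1 h1 (η / 2) (half_pos hη)
    exact ⟨ε, hε, fun u hu => (h2 hu).le⟩
  obtain ⟨εx, hεx, hx'⟩ := hcont x hx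
  obtain ⟨εy, hεy, hy'⟩ := hcont y hy
  -- Below `δ` for the derivative bound along the segment, below `εx` and `εy` so that mollification
  -- moves each endpoint value by at most `η / 2`.
  set ε := min δ (min εx εy) with hεdef
  have hε : 0 < ε := lt_min hδ (lt_min hεx hεy)
  let φ : ContDiffBump (0 : E2) := ⟨ε / 2, ε, half_pos hε, half_lt_self hε⟩
  set F := convolution (φ.normed volume) (Ω.indicator g) (ContinuousLinearMap.lsmul ℝ ℝ) volume
    with hF
  have hFd : ∀ p, HasFDerivAt F _ p := fun p =>
    φ.hasCompactSupport_normed.hasFDerivAt_convolution_left (ContinuousLinearMap.lsmul ℝ ℝ)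
      (φ.contDiff_normed (n := 1)) hGi.locallyIntegrable p
  have hlip : ‖F x - F y‖ ≤ C * ‖x - y‖ := by
    refine (convex_segment x y).norm_image_sub_le_of_norm_hasFDerivWithin_le
      (fun p _ => (hFd p).hasFDerivWithinAt) (fun p hp => ?_) (right_mem_segment ℝ x y)
      (left_mem_segment ℝ x y)
    refine norm_fderiv_mollify_le hΩ C.2 hC hGi.locallyIntegrable hweak φ ?_
    exact ((closedBall_subset_closedBall (min_le_left _ _)).trans
      (closedBall_subset_cthickening hp δ)).trans hsub
  have hxF : dist (F x) (g x) ≤ η / 2 := by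
    have := φ.dist_normed_convolution_le (μ := volume) hGi.aestronglyMeasurable
      (fun u hu => hx' u (ball_subset_ball ((min_le_right _ _).trans (min_le_left _ _)) hu))
    rwa [indicator_of_mem hx] at this
  have hyF : dist (F y) (g y) ≤ η / 2 := by
    have := φ.dist_normed_convolution_le (μ := volume) hGi.aestronglyMeasurable
      (fun u hu => hy' u (ball_subset_ball ((min_le_right _ _).trans (min_le_right _ _)) hu))
    rwa [indicator_of_mem hy] at this
  calc dist (g x) (g y) ≤ dist (g x) (F x) + dist (F x) (F y) + dist (F y) (g y) :=
        dist_triangle4 _ _ _ _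
    _ ≤ η / 2 + C * dist x y + η / 2 := by
        rw [dist_comm (g x)]
        gcongr
        rw [dist_eq_norm, dist_eq_norm]
        exact hlip
    _ = C * dist x y + η := by ring

/-! ### Green's theorem on the reference triangle -/

/-- The closed reference triangle in `ℝ × ℝ`. -/
def refTri : Set (ℝ × ℝ) := {u | 0 ≤ u.1 ∧ 0 ≤ u.2 ∧ u.1 + u.2 ≤ 1}

/-- The open reference triangle in `ℝ × ℝ`. -/
def refTriInt : Set (ℝ × ℝ) := {u | 0 < u.1 ∧ 0 < u.2 ∧ u.1 + u.2 < 1}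

theorem isOpen_refTriInt : IsOpen refTriInt :=
  (isOpen_lt continuous_const continuous_fst).inter
    ((isOpen_lt continuous_const continuous_snd).inter
      (isOpen_lt (continuous_fst.add continuous_snd) continuous_const))

theorem refTriInt_subset : refTriInt ⊆ refTri := fun _ h => ⟨h.1.le, h.2.1.le, h.2.2.le⟩

/-- The integral over the reference triangle of the derivative of a Lipschitz function in the first
variable. -/
theorem setIntegral_deriv_fst {a : ℝ × ℝ → ℝ} {C : ℝ≥0} (ha : LipschitzWith C a) :
    ∫ u in refTriInt, deriv (fun s => a (s, u.2)) u.1 =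
      ∫ y in (0 : ℝ)..1, (a (1 - y, y) - a (0, y)) := by
  have hmeas : Measurable fun u : ℝ × ℝ => deriv (fun s => a (s, u.2)) u.1 := by
    have h1 : Continuous (Function.uncurry fun (y s : ℝ) => a (s, y)) :=
      ha.continuous.comp continuous_swap
    exact (measurable_deriv_with_param h1).comp measurable_swap
  have hlip : ∀ y, LipschitzWith C fun s => a (s, y) := fun y =>
    LipschitzWith.of_dist_le_mul fun s t => by
      refine (ha.dist_le_mul _ _).trans ?_
      rw [Prod.dist_eq, dist_self, max_eq_left dist_nonneg]
  have hbound : ∀ u : ℝ × ℝ, ‖deriv (fun s => a (s, u.2)) u.1‖ ≤ C := fun u =>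
    norm_deriv_le_of_lipschitz (hlip u.2)
  have hfin : volume refTriInt < ⊤ := by
    refine (measure_mono (t := Icc (0 : ℝ) 1 ×ˢ Icc (0 : ℝ) 1) ?_).trans_lt
      (isCompact_Icc.prod isCompact_Icc).measure_lt_top
    rintro ⟨x, y⟩ ⟨h1, h2, h3⟩
    simp only at h1 h2 h3
    exact ⟨⟨h1.le, by linarith⟩, ⟨h2.le, by linarith⟩⟩
  have hint : Integrable (refTriInt.indicator fun u => deriv (fun s => a (s, u.2)) u.1)
      (volume.prod volume) := by
    rw [integrable_indicator_iff isOpen_refTriInt.measurableSet]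
    exact Measure.integrableOn_of_bounded hfin.ne hmeas.aestronglyMeasurable
      (Filter.Eventually.of_forall hbound)
  rw [← integral_indicator isOpen_refTriInt.measurableSet, Measure.volume_eq_prod,
    integral_prod_symm _ hint, intervalIntegral.integral_of_le zero_le_one,
    integral_Ioc_eq_integral_Ioo, ← integral_indicator measurableSet_Ioo]
  congr 1
  funext y
  by_cases hy : y ∈ Ioo (0 : ℝ) 1
  · rw [indicator_of_mem hy]
    have h1 : (fun x => refTriInt.indicator (fun u => deriv (fun s => a (s, u.2)) u.1) (x, y)) =
        (Ioo 0 (1 - y)).indicator (deriv fun s => a (s, y)) := by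
      funext x
      by_cases hx : x ∈ Ioo 0 (1 - y)
      · rw [indicator_of_mem hx, indicator_of_mem]
        exact ⟨hx.1, hy.1, by simpa using by linarith [hx.2]⟩
      · rw [indicator_of_notMem hx, indicator_of_notMem]
        exact fun h => hx ⟨h.1, by linarith [h.2.2]⟩
    -- On the slice at height `y`, the interval `(0, 1 - y)`, a Lipschitz function is absolutely
    -- continuous and is recovered from its derivative.
    rw [h1, integral_indicator measurableSet_Ioo, ← integral_Ioc_eq_integral_Ioo,
      ← intervalIntegral.integral_of_le (by linarith [hy.2]),
      ((hlip y).lipschitzOnWith.absolutelyContinuousOnInterval).integral_deriv_eq_sub]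
  · rw [indicator_of_notMem hy]
    have h1 : ∀ x, refTriInt.indicator (fun u => deriv (fun s => a (s, u.2)) u.1) (x, y) = 0 := by
      intro x
      refine indicator_of_notMem (fun h => hy ⟨h.2.1, ?_⟩) _
      linarith [h.1, h.2.2]
    simp [h1]

/-- Green's theorem for a closed Lipschitz one-form `a₁ du₁ + a₂ du₂` on the reference triangle. -/
theorem green_refTri {a₁ a₂ : ℝ × ℝ → ℝ} {C : ℝ≥0} (h₁ : LipschitzOnWith C a₁ refTri)
    (h₂ : LipschitzOnWith C a₂ refTri)
    (h : ∀ᵐ u : ℝ × ℝ, u ∈ refTriInt → ∃ q, HasDerivAt (fun s => a₂ (s, u.2)) q u.1 ∧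
      HasDerivAt (fun t => a₁ (u.1, t)) q u.2) :
    (∫ t in (0 : ℝ)..1, (a₂ (1 - t, t) - a₁ (1 - t, t))) - (∫ t in (0 : ℝ)..1, a₂ (0, t)) +
      (∫ t in (0 : ℝ)..1, a₁ (t, 0)) = 0 := by
  -- The extensions are globally Lipschitz, as the slice integrals require. They agree with `a₁`,
  -- `a₂` on the closed triangle, hence have the same partial derivatives in its interior.
  obtain ⟨b₁, hb₁, he₁⟩ := h₁.extend_real
  obtain ⟨b₂, hb₂, he₂⟩ := h₂.extend_real
  have hswap : LipschitzWith C (fun u : ℝ × ℝ => b₁ u.swap) := by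
    refine LipschitzWith.of_dist_le_mul fun u v => (hb₁.dist_le_mul _ _).trans ?_
    rw [Prod.dist_eq, Prod.dist_eq]
    simp [max_comm]
  have e₂ := setIntegral_deriv_fst hb₂
  have e₁ := setIntegral_deriv_fst hswap
  have hpre : Prod.swap ⁻¹' refTriInt = refTriInt := by
    ext u; simp only [refTriInt, mem_preimage, mem_ofPred_eq, Prod.fst_swap, Prod.snd_swap]
    constructor <;> rintro ⟨h1, h2, h3⟩ <;> exact ⟨h2, h1, by linarith⟩
  have e₁' : ∫ u in refTriInt, deriv (fun t => b₁ (u.1, t)) u.2 =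
      ∫ y in (0 : ℝ)..1, (b₁ (y, 1 - y) - b₁ (y, 0)) := by
    have := (Measure.measurePreserving_swap (μ := (volume : Measure ℝ))
      (ν := (volume : Measure ℝ))).setIntegral_preimage_emb
      MeasurableEquiv.prodComm.measurableEmbedding
      (fun u : ℝ × ℝ => deriv (fun t => b₁ (u.1, t)) u.2) refTriInt
    rw [← Measure.volume_eq_prod, hpre] at this
    rw [← this]
    exact e₁
  have hae : ∀ᵐ u : ℝ × ℝ ∂(volume.restrict refTriInt),
      deriv (fun s => b₂ (s, u.2)) u.1 = deriv (fun t => b₁ (u.1, t)) u.2 := by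
    rw [ae_restrict_iff' isOpen_refTriInt.measurableSet]
    filter_upwards [h] with u hu hmem
    obtain ⟨q, hq₂, hq₁⟩ := hu hmem
    have c₂ : (fun s => a₂ (s, u.2)) =ᶠ[nhds u.1] fun s => b₂ (s, u.2) := by
      have hc : Continuous fun s : ℝ => (s, u.2) := by fun_prop
      filter_upwards [(isOpen_refTriInt.preimage hc).mem_nhds hmem] with s hs
      exact he₂ (refTriInt_subset hs)
    have c₁ : (fun t => a₁ (u.1, t)) =ᶠ[nhds u.2] fun t => b₁ (u.1, t) := by
      have hc : Continuous fun t : ℝ => (u.1, t) := by fun_prop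
      filter_upwards [(isOpen_refTriInt.preimage hc).mem_nhds hmem] with s hs
      exact he₁ (refTriInt_subset hs)
    rw [← c₂.deriv_eq, ← c₁.deriv_eq, hq₂.deriv, hq₁.deriv]
  have key := integral_congr_ae hae
  rw [e₂, e₁'] at key
  have hc₁ := hb₁.continuous
  have hc₂ := hb₂.continuous
  have ii : ∀ {f : ℝ → ℝ}, Continuous f → IntervalIntegrable f volume 0 1 :=
    fun hf => hf.intervalIntegrable _ _
  -- The two slicings traverse the hypotenuse in opposite directions.
  have hsub : ∫ y in (0 : ℝ)..1, b₁ (y, 1 - y) = ∫ y in (0 : ℝ)..1, b₁ (1 - y, y) := by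
    have := intervalIntegral.integral_comp_sub_left (fun y => b₁ (1 - y, y)) (a := 0) (b := 1) 1
    simpa using this
  rw [intervalIntegral.integral_sub (ii (by fun_prop)) (ii (by fun_prop)),
    intervalIntegral.integral_sub (ii (by fun_prop)) (ii (by fun_prop)), hsub] at key
  have cg : ∀ {f g : ℝ → ℝ}, (∀ t ∈ Icc (0 : ℝ) 1, f t = g t) →
      ∫ t in (0 : ℝ)..1, f t = ∫ t in (0 : ℝ)..1, g t := fun hfg =>
    intervalIntegral.integral_congr fun t ht => hfg t (by rwa [uIcc_of_le zero_le_one] at ht)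
  have m : ∀ t ∈ Icc (0 : ℝ) 1, ((1 - t, t) : ℝ × ℝ) ∈ refTri ∧ ((0, t) : ℝ × ℝ) ∈ refTri ∧
      ((t, 0) : ℝ × ℝ) ∈ refTri := fun t ht =>
    ⟨⟨by simpa using ht.2, ht.1, by simp⟩, ⟨le_rfl, ht.1, by simpa using ht.2⟩,
      ⟨ht.1, le_rfl, by simpa using ht.2⟩⟩
  rw [cg (g := fun t => b₂ (1 - t, t) - b₁ (1 - t, t)) fun t ht => by
      rw [he₁ (m t ht).1, he₂ (m t ht).1],
    cg (f := fun t => a₂ (0, t)) (g := fun t => b₂ (0, t)) fun t ht => by rw [he₂ (m t ht).2.1],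
    cg (f := fun t => a₁ (t, 0)) (g := fun t => b₁ (t, 0)) fun t ht => by rw [he₁ (m t ht).2.2],
    intervalIntegral.integral_sub (ii (by fun_prop)) (ii (by fun_prop))]
  linarith

/-! ### Local graph coordinates -/

/-- The unit vector `n` is nearly normal to `S` on the ball of radius `ρ` around the point `z` of
`S`. -/
structure SmoothSurface.GraphBall (S : SmoothSurface) (z n : E3) (ρ : ℝ) : Prop where
  mem : z ∈ S.carrier
  subset : ball z ρ ⊆ S.nhd
  norm_eq : ‖n‖ = 1
  normal_close : ∀ x ∈ ball z ρ, ‖S.normal x - n‖ ≤ 1 / 16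
  curvature : ∀ x ∈ ball z ρ, |S.d x| * ‖fderiv ℝ S.normal x‖ ≤ 1 / 16

namespace SmoothSurface.GraphBall

open Filter Topology

variable {S : SmoothSurface} {z n : E3} {ρ : ℝ}

theorem nonempty (h : S.GraphBall z n ρ) : S.carrier.Nonempty := ⟨z, h.mem⟩

/-- Two points of the surface on a line parallel to `n` coincide. -/
theorem eq_of_sub_eq_smul (h : S.GraphBall z n ρ) {x y : E3} {s : ℝ} (hx : x ∈ S.carrier)
    (hy : y ∈ S.carrier) (hx' : x ∈ ball z ρ) (hy' : y ∈ ball z ρ) (hs : y - x = s • n) :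
    y = x := by
  -- Both values of `d` vanish, so the expansion reads `|s| ≤ |s| / 16`.
  have h1 := S.abs_d_sub_le h.subset hx' hy' h.normal_close
  rw [S.d_eq_zero hx, S.d_eq_zero hy, hs, real_inner_smul_right, real_inner_self_eq_norm_sq,
    h.norm_eq, norm_smul, h.norm_eq, Real.norm_eq_abs] at h1
  have h2 : |s| = 0 := by
    have : |(0 : ℝ) - 0 - s * 1 ^ 2| = |s| := by rw [← abs_neg]; ring_nf
    rw [this] at h1
    linarith [abs_nonneg s]
  rw [abs_eq_zero] at h2
  rw [h2, zero_smul, sub_eq_zero] at hs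
  exact hs

theorem mem_ball_of_half (_h : S.GraphBall z n ρ) {x : E3} (hx : x ∈ ball z (ρ / 2)) :
    x ∈ ball z ρ := by
  rw [mem_ball] at hx ⊢
  linarith [dist_nonneg (x := x) (y := z)]

theorem proj_mem_ball (h : S.GraphBall z n ρ) {x : E3} (hx : x ∈ ball z (ρ / 2)) :
    S.proj x ∈ ball z ρ := by
  have hxU := h.subset (h.mem_ball_of_half hx)
  have h1 : |S.d x| ≤ ‖x - z‖ := by
    rw [S.abs_d x hxU, ← dist_eq_norm]
    exact infDist_le_dist_of_mem h.mem
  rw [mem_ball, dist_eq_norm] at hx ⊢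
  have h2 : S.proj x - z = (x - z) - S.d x • S.normal x := by rw [proj]; abel
  rw [h2]
  refine (norm_sub_le _ _).trans_lt ?_
  rw [norm_smul, S.norm_normal h.nonempty hxU, mul_one, Real.norm_eq_abs]
  linarith

end SmoothSurface.GraphBall

namespace SmoothSurface

open Filter Topology

/-- The projection `ξ`, made invertible near `z` by keeping the component along `n`. -/
noncomputable def fiberMap (S : SmoothSurface) (z n x : E3) : E3 :=
  S.proj x + ⟪n, x - z⟫ • n

variable {S : SmoothSurface} {z n : E3} {ρ : ℝ}

theorem fiberMap_eq_proj {x : E3} (hx : ⟪n, x - z⟫ = 0) : S.fiberMap z n x = S.proj x := by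
  rw [fiberMap, hx, zero_smul, add_zero]

theorem hasFDerivAt_fiberMap {x : E3} (hx : x ∈ S.nhd) :
    HasFDerivAt (S.fiberMap z n) (fderiv ℝ S.proj x + (innerSL ℝ n).smulRight n) x := by
  have h1 : HasFDerivAt S.proj (fderiv ℝ S.proj x) x :=
    ((S.contDiffAt_proj hx).differentiableAt (by simp)).hasFDerivAt
  have h2 : HasFDerivAt (fun x => ⟪n, x - z⟫) (innerSL ℝ n) x :=
    (innerSL ℝ n).hasFDerivAt.comp x ((hasFDerivAt_id x).sub_const z)
  exact h1.add (h2.smul_const n)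

namespace GraphBall

/-- Since `Dξ = I - ν ⊗ ν - d Dν`, adding `n ⊗ n` almost cancels `ν ⊗ ν`. Three terms remain, each
of norm at most `1/16`. -/
theorem norm_fderiv_fiberMap_sub_le (h : S.GraphBall z n ρ) {x : E3} (hx : x ∈ ball z ρ) :
    ‖fderiv ℝ S.proj x + (innerSL ℝ n).smulRight n - ContinuousLinearMap.id ℝ E3‖ ≤ 1 / 4 := by
  refine ContinuousLinearMap.opNorm_le_bound _ (by norm_num) fun v => ?_
  have hν := S.norm_normal h.nonempty (h.subset hx)
  have h1 : (fderiv ℝ S.proj x + (innerSL ℝ n).smulRight n - ContinuousLinearMap.id ℝ E3) v =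
      -(S.d x • fderiv ℝ S.normal x v) - ⟪S.normal x - n, v⟫ • n -
        ⟪S.normal x, v⟫ • (S.normal x - n) := by
    simp only [sub_apply, add_apply,
      ContinuousLinearMap.smulRight_apply, innerSL_apply_apply, ContinuousLinearMap.id_apply]
    rw [S.fderiv_proj_apply (h.subset hx), inner_sub_left]
    module
  rw [h1]
  have hc := h.normal_close x hx
  have e1 : ‖-(S.d x • fderiv ℝ S.normal x v)‖ ≤ 1 / 16 * ‖v‖ := by
    rw [norm_neg, norm_smul, Real.norm_eq_abs]
    calc _ ≤ |S.d x| * (‖fderiv ℝ S.normal x‖ * ‖v‖) := by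
          gcongr; exact (fderiv ℝ S.normal x).le_opNorm v
      _ = (|S.d x| * ‖fderiv ℝ S.normal x‖) * ‖v‖ := by ring
      _ ≤ _ := by gcongr; exact h.curvature x hx
  have e2 : ‖⟪S.normal x - n, v⟫ • n‖ ≤ 1 / 16 * ‖v‖ := by
    rw [norm_smul, h.norm_eq, mul_one]
    exact (norm_inner_le_norm _ _).trans (by gcongr)
  have e3 : ‖⟪S.normal x, v⟫ • (S.normal x - n)‖ ≤ 1 / 16 * ‖v‖ := by
    rw [norm_smul]
    calc _ ≤ (‖S.normal x‖ * ‖v‖) * (1 / 16) := by gcongr; exact norm_inner_le_norm _ _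
      _ = _ := by rw [hν]; ring
  have := norm_nonneg v
  refine (norm_sub_le _ _).trans ?_
  have := norm_sub_le (-(S.d x • fderiv ℝ S.normal x v)) (⟪S.normal x - n, v⟫ • n)
  linarith

theorem approximatesLinearOn (h : S.GraphBall z n ρ) :
    ApproximatesLinearOn (S.fiberMap z n) (ContinuousLinearMap.id ℝ E3) (ball z ρ) (1 / 4) := by
  intro x hx y hy
  have := (convex_ball z ρ).norm_image_sub_le_of_norm_hasFDerivWithin_le'
    (f := S.fiberMap z n) (φ := ContinuousLinearMap.id ℝ E3) (C := 1 / 4)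
    (fun u hu => (hasFDerivAt_fiberMap (h.subset hu)).hasFDerivWithinAt)
    (fun u hu => h.norm_fderiv_fiberMap_sub_le hu) hy hx
  simpa using this

/-- On the plane the fibre map is `ξ` itself and is a small perturbation of the identity. This lower
bound lets null sets of `Γ` be pulled back to the triangle. -/
theorem norm_sub_le_of_plane (h : S.GraphBall z n ρ) {x y : E3} (hx : x ∈ ball z ρ)
    (hy : y ∈ ball z ρ) (hxn : ⟪n, x - z⟫ = 0) (hyn : ⟪n, y - z⟫ = 0) :
    ‖x - y‖ ≤ 2 * ‖S.proj x - S.proj y‖ := by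
  have h1 := h.approximatesLinearOn x hx y hy
  rw [fiberMap_eq_proj hxn, fiberMap_eq_proj hyn] at h1
  simp only [ContinuousLinearMap.id_apply] at h1
  have h2 := norm_sub_norm_le (x - y) (S.proj x - S.proj y)
  rw [norm_sub_rev (x - y)] at h2
  have h3 : ((1 / 4 : ℝ≥0) : ℝ) = 1 / 4 := by norm_num
  rw [h3] at h1
  linarith [norm_nonneg (x - y)]

theorem norm_proj_sub_le (h : S.GraphBall z n ρ) {x y : E3} (hx : x ∈ ball z ρ)
    (hy : y ∈ ball z ρ) : ‖S.proj x - S.proj y‖ ≤ 3 * ‖x - y‖ := by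
  have h1 := h.approximatesLinearOn x hx y hy
  simp only [ContinuousLinearMap.id_apply] at h1
  have h3 : ((1 / 4 : ℝ≥0) : ℝ) = 1 / 4 := by norm_num
  rw [h3] at h1
  have h4 : S.proj x - S.proj y = (S.fiberMap z n x - S.fiberMap z n y - (x - y)) + (x - y) -
      ⟪n, x - y⟫ • n := by
    have : ⟪n, x - y⟫ = ⟪n, x - z⟫ - ⟪n, y - z⟫ := by rw [← inner_sub_right]; congr 1; abel
    rw [fiberMap, fiberMap, this]; module
  rw [h4]
  refine (norm_sub_le _ _).trans ?_
  have h5 : ‖⟪n, x - y⟫ • n‖ ≤ ‖x - y‖ := by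
    rw [norm_smul, h.norm_eq, mul_one]
    simpa [h.norm_eq] using norm_inner_le_norm (𝕜 := ℝ) n (x - y)
  have := norm_add_le (S.fiberMap z n x - S.fiberMap z n y - (x - y)) (x - y)
  linarith [norm_nonneg (x - y)]

/-- The points `y` and `ξ x` both lie on `Γ` and differ by a multiple of `n`, so they coincide: a
preimage of a point of `Γ` lies automatically in the plane. -/
theorem plane_of_fiberMap_eq (h : S.GraphBall z n ρ) {x y : E3} (hx : x ∈ ball z (ρ / 2))
    (hy : y ∈ S.carrier) (hy' : y ∈ ball z ρ) (hxy : S.fiberMap z n x = y) :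
    ⟪n, x - z⟫ = 0 ∧ S.proj x = y := by
  have hxU := h.subset (h.mem_ball_of_half hx)
  have h1 : y - S.proj x = ⟪n, x - z⟫ • n := by rw [← hxy, fiberMap]; abel
  have h2 := h.eq_of_sub_eq_smul (S.proj_mem h.nonempty hxU) hy (h.proj_mem_ball hx) hy' h1
  refine ⟨?_, h2.symm⟩
  rw [h2, sub_self] at h1
  have h3 : n ≠ 0 := by intro h0; simpa [h0] using h.norm_eq
  exact (smul_eq_zero.1 h1.symm).resolve_right h3

/-- Surjectivity of `ξ` from the plane through `z` orthogonal to `n`, with a lower bound for the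
radius. -/
theorem exists_plane_proj_eq (h : S.GraphBall z n ρ) {b y : E3} {ε : ℝ} (hε : 0 ≤ ε)
    (hb : closedBall b ε ⊆ ball z (ρ / 2)) (hbn : ⟪n, b - z⟫ = 0) (hy : y ∈ S.carrier)
    (hy' : y ∈ ball z ρ) (hby : ‖y - S.proj b‖ ≤ 3 / 4 * ε) :
    ∃ x ∈ closedBall b ε, ⟪n, x - z⟫ = 0 ∧ S.proj x = y := by
  let ri : (ContinuousLinearMap.id ℝ E3).NonlinearRightInverse :=
    ⟨id, 1, fun y => by simp, fun y => by simp⟩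
  have hsub : closedBall b ε ⊆ ball z ρ := fun x hx => h.mem_ball_of_half (hb hx)
  -- The identity is its own right inverse with bound `1`, which gives the radius `(1 - 1/4) ε` of
  -- the hypothesis.
  have h1 := h.approximatesLinearOn.surjOn_closedBall_of_nonlinearRightInverse ri hε hsub
  have h2 : y ∈ closedBall (S.fiberMap z n b) (((ri.nnnorm : ℝ)⁻¹ - (1 / 4 : ℝ≥0)) * ε) := by
    rw [mem_closedBall, dist_eq_norm, fiberMap_eq_proj hbn]
    refine hby.trans (le_of_eq ?_)
    have : (ri.nnnorm : ℝ) = 1 := rfl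
    rw [this]; push_cast; ring
  obtain ⟨x, hx, hxy⟩ := h1 h2
  exact ⟨x, hx, h.plane_of_fiberMap_eq (hb hx) hy hy' hxy⟩

/-- If `w ∘ ξ` is differentiable at `x` within the plane through `z` orthogonal to `n`, then it is
differentiable at `ξ x`. -/
theorem differentiableAt_invLift (h : S.GraphBall z n ρ) {x : E3} (hx : x ∈ ball z (ρ / 2))
    (hxn : ⟪n, x - z⟫ = 0) {w : E3 → E3} {q : ℝ × ℝ → E3} {r : E3 → ℝ × ℝ}
    (hqr : ∀ y, ⟪n, y - z⟫ = 0 → q (r y) = y) (hr : DifferentiableAt ℝ r x)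
    (hd : DifferentiableAt ℝ (fun u => w (S.proj (q u))) (r x)) :
    DifferentiableAt ℝ (S.invLift w) (S.proj x) := by
  have hxb := h.mem_ball_of_half hx
  have hxU := h.subset hxb
  have hyC := S.proj_mem h.nonempty hxU
  have hyU := S.carrier_subset hyC
  set D := fderiv ℝ S.proj x + (innerSL ℝ n).smulRight n with hD
  have hlt : ‖ContinuousLinearMap.id ℝ E3 - D‖ < 1 := by
    rw [norm_sub_rev]
    exact (h.norm_fderiv_fiberMap_sub_le hxb).trans_lt (by norm_num)
  -- A map at distance less than `1` from the identity is invertible by the Neumann series.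
  let e : E3 ≃L[ℝ] E3 := ContinuousLinearEquiv.unitsEquiv ℝ E3
    (Units.oneSub (ContinuousLinearMap.id ℝ E3 - D) hlt)
  have he : (e : E3 →L[ℝ] E3) = D := by
    have h1 : (e : E3 →L[ℝ] E3) = 1 - (ContinuousLinearMap.id ℝ E3 - D) := rfl
    rw [h1, ← ContinuousLinearMap.one_def, sub_sub_cancel]
  have hs : HasStrictFDerivAt (S.fiberMap z n) (e : E3 →L[ℝ] E3) x := by
    rw [he]
    have hc : ContDiffAt ℝ ∞ (S.fiberMap z n) x := by
      unfold fiberMap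
      exact (S.contDiffAt_proj hxU).add
        ((contDiffAt_const.inner ℝ (contDiffAt_id.sub contDiffAt_const)).smul contDiffAt_const)
    exact hc.hasStrictFDerivAt' (hasFDerivAt_fiberMap hxU) (by simp)
  set G := hs.localInverse with hG
  have hΦx : S.fiberMap z n x = S.proj x := fiberMap_eq_proj hxn
  have hGx : G (S.proj x) = x := by rw [← hΦx]; exact hs.localInverse_apply_image
  have hGd : DifferentiableAt ℝ G (S.proj x) := by
    rw [← hΦx]; exact hs.to_localInverse.hasFDerivAt.differentiableAt
  have hpp : S.proj (S.proj x) = S.proj x := S.proj_eq_self hyC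
  have hpd : DifferentiableAt ℝ S.proj (S.proj x) :=
    (S.contDiffAt_proj hyU).differentiableAt (by simp)
  have hproj : Tendsto S.proj (𝓝 (S.proj x)) (𝓝 (S.proj x)) := by
    have := hpd.continuousAt.tendsto
    rwa [hpp] at this
  have hGproj : Tendsto (fun y => G (S.proj y)) (𝓝 (S.proj x)) (𝓝 x) := by
    have h1 := hGd.continuousAt.tendsto.comp hproj
    rwa [hGx] at h1
  -- Near `ξ x` the local inverse `G` sends `ξ y` to a point of the plane that projects to `ξ y`.
  -- Thus `w ∘ ξ` factors through its planar representation and inherits differentiability.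
  have hev : S.invLift w =ᶠ[𝓝 (S.proj x)] fun y => w (S.proj (q (r (G (S.proj y))))) := by
    have hri : ∀ᶠ y in 𝓝 (S.proj x), S.fiberMap z n (G y) = y := by
      have := hs.eventually_right_inverse
      rwa [hΦx] at this
    filter_upwards [hproj.eventually hri, hGproj.eventually (isOpen_ball.mem_nhds hx),
      hproj.eventually (isOpen_ball.mem_nhds (h.proj_mem_ball hx)), S.isOpen.mem_nhds hyU]
      with y h1 h2 h3 h4
    obtain ⟨h5, h6⟩ := h.plane_of_fiberMap_eq h2 (S.proj_mem h.nonempty h4) h3 h1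
    rw [hqr _ h5, h6, invLift]
  refine DifferentiableAt.congr_of_eventuallyEq ?_ hev
  have h1 : DifferentiableAt ℝ (fun y => G (S.proj y)) (S.proj x) := by
    refine DifferentiableAt.comp (S.proj x) ?_ hpd
    rwa [hpp]
  have h2 : DifferentiableAt ℝ (fun y => r (G (S.proj y))) (S.proj x) := by
    refine DifferentiableAt.comp (S.proj x) (g := r) ?_ h1
    rwa [hpp, hGx]
  refine DifferentiableAt.comp (S.proj x) (g := fun u => w (S.proj (q u))) ?_ h2
  rwa [hpp, hGx]

end GraphBall

end SmoothSurface

/-! ### The affine chart of a triangle -/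

namespace Tri

variable (K : Tri)

/-- The affine parametrisation of the plane of `K` by `ℝ × ℝ`. -/
def chart (u : ℝ × ℝ) : E3 :=
  K.points 0 + u.1 • (K.points 1 - K.points 0) + u.2 • (K.points 2 - K.points 0)

/-- Planar coordinates, inverse to `chart`. -/
noncomputable def coords (x : E3) : ℝ × ℝ := (K.bary 1 x, K.bary 2 x)

/-- The derivative of the affine chart. -/
noncomputable def chartDeriv : ℝ × ℝ →L[ℝ] E3 :=
  (ContinuousLinearMap.fst ℝ ℝ ℝ).smulRight (K.points 1 - K.points 0) +
    (ContinuousLinearMap.snd ℝ ℝ ℝ).smulRight (K.points 2 - K.points 0)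

theorem hasFDerivAt_chart (u : ℝ × ℝ) : HasFDerivAt K.chart K.chartDeriv u := by
  have h1 : HasFDerivAt (fun u : ℝ × ℝ => u.1 • (K.points 1 - K.points 0)) _ u :=
    (ContinuousLinearMap.fst ℝ ℝ ℝ).hasFDerivAt.smul_const _
  have h2 : HasFDerivAt (fun u : ℝ × ℝ => u.2 • (K.points 2 - K.points 0)) _ u :=
    (ContinuousLinearMap.snd ℝ ℝ ℝ).hasFDerivAt.smul_const _
  exact (h1.const_add (K.points 0)).add h2

theorem contDiff_chart : ContDiff ℝ ∞ K.chart := by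
  unfold chart; fun_prop

theorem continuous_chart : Continuous K.chart := K.contDiff_chart.continuous

theorem chart_mem {u : ℝ × ℝ} (hu : u ∈ refTri) : K.chart u ∈ K.carrier := by
  have := K.combination_mem (a := 1 - u.1 - u.2) (b := u.1) (c := u.2)
    (by linarith [hu.2.2]) hu.1 hu.2.1 (by ring)
  convert this using 1
  rw [chart]; module

theorem inner_unitNormal_chart (u : ℝ × ℝ) : ⟪K.unitNormal, K.chart u - K.points 0⟫ = 0 := by
  have : K.chart u - K.points 0 = u.1 • (K.points 1 - K.points 0) +
      u.2 • (K.points 2 - K.points 0) := by rw [chart]; abel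
  rw [this, inner_add_right, real_inner_smul_right, real_inner_smul_right, inner_unitNormal_sub,
    inner_unitNormal_sub]
  simp

theorem chart_coords {x : E3} (hx : ⟪K.unitNormal, x - K.points 0⟫ = 0) :
    K.chart (K.coords x) = x := (K.eq_of_inner_eq_zero hx).symm

theorem bary_add_smul (i j k : Fin 3) (x : E3) (t : ℝ) :
    K.bary i (x + t • (K.points j - K.points k)) =
      K.bary i x + t * (K.bary i (K.points j) - K.bary i (K.points k)) := by
  simp only [bary, inner_sub_right, inner_add_right, real_inner_smul_right]
  ring

theorem coords_chart (u : ℝ × ℝ) : K.coords (K.chart u) = u := by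
  have h10 := K.bary_points_of_ne (i := 1) (j := 0) (by decide)
  have h12 := K.bary_points_of_ne (i := 1) (j := 2) (by decide)
  have h20 := K.bary_points_of_ne (i := 2) (j := 0) (by decide)
  have h21 := K.bary_points_of_ne (i := 2) (j := 1) (by decide)
  ext <;> simp [coords, chart, bary_add_smul, bary_points_self, h10, h12, h20, h21]

theorem differentiable_coords : Differentiable ℝ K.coords := by
  unfold coords bary
  exact ((((differentiable_const _).inner ℝ ((differentiable_const _).sub
    differentiable_id)).const_mul _)).prodMk
    ((((differentiable_const _).inner ℝ ((differentiable_const _).sub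
    differentiable_id)).const_mul _))

theorem abs_bary_sub_le (i : Fin 3) (x y : E3) :
    |K.bary i x - K.bary i y| ≤ (K.height i)⁻¹ * ‖x - y‖ := by
  have : K.bary i x - K.bary i y = (K.height i)⁻¹ * ⟪K.conormal i, y - x⟫ := by
    simp only [bary, inner_sub_right]; ring
  have h0 := (inv_pos.2 (K.height_pos i)).le
  rw [this, abs_mul, abs_of_nonneg h0, norm_sub_rev]
  gcongr
  simpa [norm_conormal] using abs_real_inner_le_norm (K.conormal i) (y - x)

theorem exists_antilipschitz_chart : ∃ C : ℝ≥0, ∀ u v, ‖u - v‖ ≤ C * ‖K.chart u - K.chart v‖ := by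
  have h1 := (inv_pos.2 (K.height_pos 1)).le
  have h2 := (inv_pos.2 (K.height_pos 2)).le
  refine ⟨⟨(K.height 1)⁻¹ + (K.height 2)⁻¹, by positivity⟩, fun u v => ?_⟩
  conv_lhs => rw [← K.coords_chart u, ← K.coords_chart v]
  rw [Prod.norm_def]
  simp only [coords, Prod.fst_sub, Prod.snd_sub, Real.norm_eq_abs]
  change _ ≤ ((K.height 1)⁻¹ + (K.height 2)⁻¹) * _
  have := norm_nonneg (K.chart u - K.chart v)
  refine max_le ((K.abs_bary_sub_le _ _ _).trans ?_) ((K.abs_bary_sub_le _ _ _).trans ?_) <;>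
    gcongr <;> linarith

/-- The middle edge is traversed backwards in the chart; this accounts for the minus sign in Green's
formula. -/
theorem lineMap_eq_chart (t : ℝ) :
    AffineMap.lineMap (K.points (0 + 1)) (K.points (0 + 2)) t = K.chart (1 - t, t) ∧
    AffineMap.lineMap (K.points (1 + 1)) (K.points (1 + 2)) t = K.chart (0, 1 - t) ∧
    AffineMap.lineMap (K.points (2 + 1)) (K.points (2 + 2)) t = K.chart (t, 0) := by
  simp only [AffineMap.lineMap_apply_module, chart, Fin.isValue, Fin.reduceAdd]
  refine ⟨?_, ?_, ?_⟩ <;> module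

theorem lineMap_mem (i : Fin 3) {t : ℝ} (ht : t ∈ Icc (0 : ℝ) 1) :
    AffineMap.lineMap (K.points (i + 1)) (K.points (i + 2)) t ∈ K.carrier :=
  K.convex_carrier.lineMap_mem (K.points_mem _) (K.points_mem _) ht

end Tri

/-! ### The reference triangle -/

theorem isCompact_refTri : IsCompact refTri := by
  refine IsCompact.of_isClosed_subset ((isCompact_Icc (a := (0 : ℝ)) (b := 1)).prod
    (isCompact_Icc (a := (0 : ℝ)) (b := 1))) ?_ ?_
  · exact (isClosed_le continuous_const continuous_fst).inter
      ((isClosed_le continuous_const continuous_snd).inter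
        (isClosed_le (continuous_fst.add continuous_snd) continuous_const))
  · rintro ⟨x, y⟩ ⟨h1, h2, h3⟩
    simp only at h1 h2 h3
    exact ⟨⟨h1, by linarith⟩, ⟨h2, by linarith⟩⟩

theorem convex_refTri : Convex ℝ refTri := by
  rintro ⟨x, y⟩ ⟨h1, h2, h3⟩ ⟨x', y'⟩ ⟨h1', h2', h3'⟩ a b ha hb hab
  simp only at h1 h2 h3 h1' h2' h3'
  refine ⟨?_, ?_, ?_⟩ <;> simp only [Prod.smul_mk, Prod.mk_add_mk, smul_eq_mul]
  · positivity
  · positivity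
  · nlinarith

theorem refTri_subset_closure : refTri ⊆ closure refTriInt := by
  intro u hu
  -- Each point is approached along the segment towards the centroid, which lies in the interior.
  have hc : Filter.Tendsto (fun t : ℝ => (1 - t) • u + t • ((1 / 3, 1 / 3) : ℝ × ℝ))
      (nhdsWithin 0 (Ioi 0)) (nhds u) := by
    have : Continuous (fun t : ℝ => (1 - t) • u + t • ((1 / 3, 1 / 3) : ℝ × ℝ)) := by fun_prop
    have h := this.tendsto 0
    simp only [sub_zero, one_smul, zero_smul, add_zero] at h
    exact h.mono_left nhdsWithin_le_nhds
  refine mem_closure_of_tendsto hc ?_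
  filter_upwards [Ioo_mem_nhdsGT (zero_lt_one' ℝ)] with t ht
  obtain ⟨h1, h2, h3⟩ := hu
  have a1 : 0 < 1 - t := by linarith [ht.2]
  have a2 := ht.1
  refine ⟨?_, ?_, ?_⟩ <;>
    simp only [Prod.fst_add, Prod.snd_add, Prod.smul_fst, Prod.smul_snd, smul_eq_mul]
  · positivity
  · positivity
  · nlinarith

theorem isOpen_refInterior : IsOpen refInterior := by
  have h0 : Continuous fun x : E2 => x 0 := by fun_prop
  have h1 : Continuous fun x : E2 => x 1 := by fun_prop
  exact (isOpen_lt continuous_const h0).inter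
    ((isOpen_lt continuous_const h1).inter (isOpen_lt (h0.add h1) continuous_const))

theorem convex_refInterior : Convex ℝ refInterior := by
  intro x hx y hy a b ha hb hab
  obtain ⟨h1, h2, h3⟩ := hx
  obtain ⟨h1', h2', h3'⟩ := hy
  have key : ∀ {p q : ℝ}, 0 < p → 0 < q → 0 < a * p + b * q := by
    intro p q hp hq
    rcases ha.eq_or_lt with rfl | ha'
    · have : b = 1 := by linarith
      subst this; simpa using hq
    · have := mul_nonneg hb hq.le
      have := mul_pos ha' hp
      linarith
  refine ⟨?_, ?_, ?_⟩ <;> simp only [PiLp.add_apply, PiLp.smul_apply, smul_eq_mul]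
  · exact key h1 h1'
  · exact key h2 h2'
  · have := key (sub_pos.2 h3) (sub_pos.2 h3')
    nlinarith

theorem volume_refInterior_ne_top : volume refInterior ≠ ⊤ := by
  have hb : refInterior ⊆ closedBall (0 : E2) 2 := by
    rintro x ⟨h1, h2, h3⟩
    rw [mem_closedBall_zero_iff, EuclideanSpace.norm_eq, Fin.sum_univ_two]
    rw [Real.sqrt_le_left (by norm_num), Real.norm_eq_abs, Real.norm_eq_abs, sq_abs, sq_abs]
    nlinarith
  exact ((measure_mono hb).trans_lt measure_closedBall_lt_top).ne

/-- A continuous field of class `W^{1,∞}` on a triangle is Lipschitz in the affine chart. -/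
theorem Tri.MemW1Inf.exists_lipschitzOnWith_chart {K : Tri} {f : E3 → E3} (h : K.MemW1Inf f)
    (hf : ContinuousOn f K.carrier) : ∃ C, LipschitzOnWith C (fun u => f (K.chart u)) refTri := by
  have hparam : ∀ x : E2, K.param x = K.chart (x 0, x 1) := fun x => rfl
  have hcont : ContinuousOn (f ∘ K.param) refInterior := by
    refine hf.comp ?_ ?_
    · have : Continuous K.param := by unfold Tri.param; fun_prop
      exact this.continuousOn
    · intro x hx
      exact K.chart_mem (u := (x 0, x 1)) ⟨hx.1.le, hx.2.1.le, hx.2.2.le⟩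
  obtain ⟨C, hC⟩ := SurfaceDG.MemW1Inf.exists_lipschitzOnWith isOpen_refInterior convex_refInterior
    volume_refInterior_ne_top hcont h
  -- The Euclidean distance on `E2` is at most twice the maximum distance on `ℝ × ℝ`.
  refine ⟨C * 2, ?_⟩
  have hcc : ContinuousOn (fun u => f (K.chart u)) refTri :=
    hf.comp K.continuous_chart.continuousOn fun u hu => K.chart_mem hu
  have hcl : closure refTriInt = refTri :=
    subset_antisymm (closure_minimal refTriInt_subset isCompact_refTri.isClosed)
      refTri_subset_closure
  rw [← hcl] at hcc ⊢
  refine LipschitzOnWith.closure hcc (LipschitzOnWith.of_dist_le_mul fun u hu v hv => ?_)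
  have h1 := hC.dist_le_mul !₂[u.1, u.2] (by simpa [refInterior, refTriInt] using hu) !₂[v.1, v.2]
    (by simpa [refInterior, refTriInt] using hv)
  simp only [Function.comp_apply, hparam] at h1
  refine h1.trans ?_
  push_cast
  rw [mul_assoc]
  gcongr
  rw [EuclideanSpace.dist_eq, Fin.sum_univ_two]
  have a1 : dist u.1 v.1 ≤ dist u v := le_max_left _ _
  have a2 : dist u.2 v.2 ≤ dist u v := le_max_right _ _
  have a3 : 0 ≤ dist u v := dist_nonneg
  rw [Real.sqrt_le_left (by positivity)]
  simp only [Matrix.cons_val_zero, Matrix.cons_val_one]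
  have b1 := dist_nonneg (x := u.1) (y := v.1)
  have b2 := dist_nonneg (x := u.2) (y := v.2)
  nlinarith

/-! ### The flux of a divergence-free field through the image of a triangle -/

/-- The tangential divergence in terms of a pair of tangent vectors. -/
theorem inner_cross_of_tangentialDiv_eq_zero {ν a b x : E3} {v : E3 → E3} (hν : ‖ν‖ = 1)
    (ha : ⟪a, ν⟫ = 0) (hb : ⟪b, ν⟫ = 0) (h : tangentialDiv (ℝ ∙ ν)ᗮ v x = 0) :
    ⟪fderiv ℝ v x a, cross b ν⟫ = ⟪fderiv ℝ v x b, cross a ν⟫ := by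
  set A := fderiv ℝ v x
  set B : E3 →ₗ[ℝ] E3 := (((ℝ ∙ ν)ᗮ.starProjection ∘L A : E3 →L[ℝ] E3) : E3 →ₗ[ℝ] E3)
    with hB
  have h1 := trace_mul_inner_cross B a b ν
  have hBa : ∀ y, B y = A y - ⟪ν, A y⟫ • ν := by
    intro y
    have : B y = (ℝ ∙ ν)ᗮ.starProjection (A y) := rfl
    rw [this, Submodule.starProjection_orthogonal_val, Submodule.starProjection_unit_singleton ℝ hν]
  have hBν : ⟪B ν, ν⟫ = 0 := by
    rw [hBa, inner_sub_left, real_inner_smul_left, real_inner_self_eq_norm_sq, hν,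
      real_inner_comm]
    ring
  -- In the trace identity for `a`, `b`, `ν` the left side vanishes by hypothesis and the last term
  -- because `B ν` is tangential; the remaining two terms give the claim.
  have h0 : LinearMap.trace ℝ E3 B = 0 := h
  rw [h0, zero_mul, inner_cross_eq_zero_of_orthogonal hν ha hb hBν, hBa a, hBa b, inner_sub_left,
    real_inner_smul_left, inner_cross_right, cross_sub_left, cross_smul_left, cross_self] at h1
  simp only [mul_zero, smul_zero, sub_zero, add_zero] at h1
  rw [inner_cross_swap a] at h1
  linarith

theorem LipschitzOnWith.inner_of_bounded {X : Type*} [PseudoMetricSpace X] {s : Set X}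
    {f g : X → E3} {Cf Cg Bf Bg : ℝ≥0} (hf : LipschitzOnWith Cf f s) (hg : LipschitzOnWith Cg g s)
    (bf : ∀ x ∈ s, ‖f x‖ ≤ Bf) (bg : ∀ x ∈ s, ‖g x‖ ≤ Bg) :
    LipschitzOnWith (Bf * Cg + Cf * Bg) (fun x => ⟪f x, g x⟫) s := by
  refine LipschitzOnWith.of_dist_le_mul fun x hx y hy => ?_
  have e : ⟪f x, g x⟫ - ⟪f y, g y⟫ = ⟪f x, g x - g y⟫ + ⟪f x - f y, g y⟫ := by
    rw [inner_sub_right, inner_sub_left]; ring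
  have h1 := hf.dist_le_mul x hx y hy
  have h2 := hg.dist_le_mul x hx y hy
  rw [dist_eq_norm] at h1 h2
  rw [Real.dist_eq, e]
  calc _ ≤ ‖f x‖ * ‖g x - g y‖ + ‖f x - f y‖ * ‖g y‖ :=
        (abs_add_le _ _).trans (add_le_add (abs_real_inner_le_norm _ _)
          (abs_real_inner_le_norm _ _))
    _ ≤ Bf * (Cg * dist x y) + (Cf * dist x y) * Bg := by
        gcongr
        · exact bf x hx
        · exact bg y hy
    _ = _ := by push_cast; ring

/-! ### The flux densities along `ξ` and their curl -/

namespace SmoothSurface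

variable (S : SmoothSurface)

/-- Differentiate `d ∘ ξ = 0`. -/
theorem inner_normal_fderiv_proj (hne : S.carrier.Nonempty) {x : E3} (hx : x ∈ S.nhd) (v : E3) :
    ⟪fderiv ℝ S.proj x v, S.normal (S.proj x)⟫ = 0 := by
  have hy := S.carrier_subset (S.proj_mem hne hx)
  have h1 := (S.hasFDerivAt_d hy).comp x
    ((S.contDiffAt_proj hx).differentiableAt (by simp)).hasFDerivAt
  have h2 : HasFDerivAt (S.d ∘ S.proj) (0 : E3 →L[ℝ] ℝ) x := by
    refine (hasFDerivAt_const (0 : ℝ) x).congr_of_eventuallyEq ?_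
    filter_upwards [S.isOpen.mem_nhds hx] with y hy
    exact S.d_eq_zero (S.proj_mem hne hy)
  have h3 := congrArg (fun A : E3 →L[ℝ] ℝ => A v) (h1.unique h2)
  rw [real_inner_comm]
  simpa using h3

/-- The conormal density of the image under `ξ` of a line in direction `e`. -/
noncomputable def fluxVec (e x : E3) : E3 := cross (fderiv ℝ S.proj x e) (S.normal (S.proj x))

theorem contDiffOn_fluxVec (hne : S.carrier.Nonempty) (e : E3) :
    ContDiffOn ℝ ∞ (S.fluxVec e) S.nhd := by
  have h1 : ContDiffOn ℝ ∞ (fun x => fderiv ℝ S.proj x e) S.nhd :=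
    (S.contDiffOn_proj.fderiv_of_isOpen S.isOpen (by simp)).clm_apply contDiffOn_const
  have h2 : ContDiffOn ℝ ∞ (fun x => S.normal (S.proj x)) S.nhd :=
    S.contDiffOn_normal.comp S.contDiffOn_proj fun x hx => S.carrier_subset (S.proj_mem hne hx)
  exact (crossL.contDiff.comp_contDiffOn h1).clm_apply h2

theorem fderiv_fluxVec_apply (hne : S.carrier.Nonempty) (e : E3) {x : E3} (hx : x ∈ S.nhd)
    (v : E3) : fderiv ℝ (S.fluxVec e) x v =
      cross (fderiv ℝ (fderiv ℝ S.proj) x v e) (S.normal (S.proj x)) +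
      cross (fderiv ℝ S.proj x e) (fderiv ℝ S.normal (S.proj x) (fderiv ℝ S.proj x v)) := by
  have hy := S.carrier_subset (S.proj_mem hne hx)
  have hp := S.contDiffAt_proj hx
  have h1 : HasFDerivAt (fderiv ℝ S.proj) (fderiv ℝ (fderiv ℝ S.proj) x) x :=
    (((S.contDiffOn_proj.fderiv_of_isOpen S.isOpen (m := ∞) (by simp)).contDiffAt
      (S.isOpen.mem_nhds hx)).differentiableAt (by simp)).hasFDerivAt
  have h2 := (ContinuousLinearMap.apply ℝ E3 e).hasFDerivAt.comp x h1
  have h3 := (S.hasFDerivAt_normal hy).comp x (hp.differentiableAt (by simp)).hasFDerivAt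
  have h4 := crossL.hasFDerivAt_of_bilinear h2 h3
  have h5 : HasFDerivAt (S.fluxVec e) _ x := h4
  rw [h5.fderiv]
  simp [add_comm]

/-- The flux densities of a tangential field have no curl apart from the divergence of the field. -/
theorem inner_fderiv_fluxVec_comm (hne : S.carrier.Nonempty) {x : E3} (hx : x ∈ S.nhd) {f : E3}
    (hf : ⟪f, S.normal (S.proj x)⟫ = 0) (a b : E3) :
    ⟪f, fderiv ℝ (S.fluxVec b) x a⟫ = ⟪f, fderiv ℝ (S.fluxVec a) x b⟫ := by
  have hy := S.carrier_subset (S.proj_mem hne hx)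
  have hν := S.norm_normal hne hy
  have hsymm : fderiv ℝ (fderiv ℝ S.proj) x a b = fderiv ℝ (fderiv ℝ S.proj) x b a :=
    ((S.contDiffAt_proj hx).isSymmSndFDerivAt (by simpa using ENat.LEInfty.out)).eq a b
  -- The derivative of the normal contributes triple products of three tangent vectors, which
  -- vanish; the second derivatives of `ξ` are symmetric.
  have hz : ∀ u v, ⟪f, cross (fderiv ℝ S.proj x u)
      (fderiv ℝ S.normal (S.proj x) (fderiv ℝ S.proj x v))⟫ = 0 := fun u v =>
    inner_cross_eq_zero_of_orthogonal hν hf (S.inner_normal_fderiv_proj hne hx u)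
      (S.inner_normal_fderiv_normal hne hy _)
  rw [S.fderiv_fluxVec_apply hne b hx, S.fderiv_fluxVec_apply hne a hx, inner_add_right,
    inner_add_right, hz, hz, hsymm]

end SmoothSurface

namespace Tri

/-- The flux of `w` through the image under `ξ` of the boundary of `K`. -/
noncomputable def liftedFlux (S : SmoothSurface) (w : E3 → E3) (K : Tri) (i : Fin 3) : ℝ :=
  ∫ t in (0 : ℝ)..1,
    ⟪S.invLift w (AffineMap.lineMap (K.points (i + 1)) (K.points (i + 2)) t),
      S.fluxVec (K.edgeVec i) (AffineMap.lineMap (K.points (i + 1)) (K.points (i + 2)) t)⟫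

variable {S : SmoothSurface} {K : Tri} {n : E3} {ρ : ℝ} {w : E3 → E3}

theorem inner_chart (hn : n = K.unitNormal ∨ n = -K.unitNormal) (u : ℝ × ℝ) :
    ⟪n, K.chart u - K.points 0⟫ = 0 := by
  rcases hn with rfl | rfl <;> simp [K.inner_unitNormal_chart]

theorem chart_coords' (hn : n = K.unitNormal ∨ n = -K.unitNormal) {x : E3}
    (hx : ⟪n, x - K.points 0⟫ = 0) : K.chart (K.coords x) = x := by
  apply K.chart_coords
  rcases hn with rfl | rfl
  · exact hx
  · simpa using hx

/-- The image in `ℝ × ℝ` of a null set of the surface is a null set. -/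
theorem volume_preimage_eq_zero (h : S.GraphBall (K.points 0) n ρ)
    (hn : n = K.unitNormal ∨ n = -K.unitNormal) (hK : K.carrier ⊆ ball (K.points 0) (ρ / 2))
    {N : Set E3} (hN : (Measure.hausdorffMeasure 2 : Measure E3) N = 0) :
    volume (refTri ∩ (fun u => S.proj (K.chart u)) ⁻¹' N) = 0 := by
  set ψ : ℝ × ℝ → E3 := fun u => S.proj (K.chart u) with hψ
  obtain ⟨C, hC⟩ := K.exists_antilipschitz_chart
  -- So `ψ` is injective with Lipschitz inverse, and Lipschitz maps preserve null sets of the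
  -- two-dimensional Hausdorff measure, which on `ℝ × ℝ` is Lebesgue measure.
  have hanti : ∀ u ∈ refTri, ∀ v ∈ refTri, dist u v ≤ (C * 2 : ℝ≥0) * dist (ψ u) (ψ v) := by
    intro u hu v hv
    have h1 := h.norm_sub_le_of_plane (h.mem_ball_of_half (hK (K.chart_mem hu)))
      (h.mem_ball_of_half (hK (K.chart_mem hv))) (inner_chart hn u) (inner_chart hn v)
    rw [dist_eq_norm, dist_eq_norm]
    refine (hC u v).trans ?_
    push_cast
    rw [mul_assoc]
    gcongr
  have hinj : InjOn ψ refTri := by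
    intro u hu v hv huv
    have := hanti u hu v hv
    rw [huv, dist_self, mul_zero] at this
    exact dist_le_zero.1 this
  set g := Function.invFunOn ψ refTri with hg
  have hgl : ∀ u ∈ refTri, g (ψ u) = u := fun u hu => hinj.leftInvOn_invFunOn hu
  have hlip : LipschitzOnWith (C * 2) g (ψ '' refTri) := by
    refine LipschitzOnWith.of_dist_le_mul ?_
    rintro _ ⟨u, hu, rfl⟩ _ ⟨v, hv, rfl⟩
    rw [hgl u hu, hgl v hv]
    exact hanti u hu v hv
  set B := refTri ∩ ψ ⁻¹' N
  have hB : B = g '' (ψ '' B) := by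
    rw [image_image]
    refine (EqOn.image_eq_self ?_).symm
    intro u hu; exact hgl u hu.1
  rw [← hausdorffMeasure_prod_real, hB]
  refine le_antisymm (((hlip.mono (image_mono inter_subset_left)).hausdorffMeasure_image_le
    (d := 2) (by norm_num)).trans ?_) zero_le
  have : (Measure.hausdorffMeasure 2 : Measure E3) (ψ '' B) = 0 :=
    measure_mono_null (by rintro _ ⟨u, hu, rfl⟩; exact hu.2) hN
  rw [this, mul_zero]

/-- The total flux of a divergence-free field out of the image of a small triangle vanishes. -/
theorem sum_liftedFlux_eq_zero (hw : ContinuousOn w S.carrier) (hw_tan : S.IsTangential w)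
    (hw_div : S.IsDivFree w) (h : S.GraphBall (K.points 0) n ρ)
    (hn : n = K.unitNormal ∨ n = -K.unitNormal) (hK : K.carrier ⊆ ball (K.points 0) (ρ / 2))
    (hW : K.MemW1Inf (S.invLift w)) :
    K.liftedFlux S w 0 + K.liftedFlux S w 1 + K.liftedFlux S w 2 = 0 := by
  have hne := h.nonempty
  have hKU : K.carrier ⊆ S.nhd := fun x hx => h.subset (h.mem_ball_of_half (hK hx))
  have hTU : ∀ u ∈ refTri, K.chart u ∈ S.nhd := fun u hu => hKU (K.chart_mem hu)
  have hcont : ContinuousOn (S.invLift w) K.carrier :=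
    hw.comp (S.contDiffOn_proj.continuousOn.mono hKU) fun x hx => S.proj_mem hne (hKU hx)
  set g : ℝ × ℝ → E3 := fun u => S.invLift w (K.chart u) with hg
  obtain ⟨C, hC⟩ := hW.exists_lipschitzOnWith_chart hcont
  set e : Fin 2 → E3 := ![K.points 1 - K.points 0, K.points 2 - K.points 0] with he
  set m : Fin 2 → ℝ × ℝ → E3 := fun j u => S.fluxVec (e j) (K.chart u) with hm
  have hmc : ∀ j, ContDiffOn ℝ ∞ (m j) (K.chart ⁻¹' S.nhd) := fun j =>
    (S.contDiffOn_fluxVec hne (e j)).comp K.contDiff_chart.contDiffOn fun u hu => hu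
  have hlip : ∀ j, ∃ D, LipschitzOnWith D (fun u => ⟪g u, m j u⟫) refTri := by
    intro j
    obtain ⟨D, hD⟩ := ((hmc j).mono hTU).exists_lipschitzOnWith (by simp) convex_refTri
      isCompact_refTri
    obtain ⟨b, hb⟩ := isCompact_refTri.exists_bound_of_continuousOn hC.continuousOn
    obtain ⟨b', hb'⟩ := isCompact_refTri.exists_bound_of_continuousOn hD.continuousOn
    exact ⟨_, LipschitzOnWith.inner_of_bounded (Bf := b.toNNReal) (Bg := b'.toNNReal) hC hD
      (fun x hx => (hb x hx).trans (Real.le_coe_toNNReal b))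
      (fun x hx => (hb' x hx).trans (Real.le_coe_toNNReal b'))⟩
  obtain ⟨D₁, hD₁⟩ := hlip 0
  obtain ⟨D₂, hD₂⟩ := hlip 1
  -- The one-form has coefficients `⟪g, m j⟫`; its closedness almost everywhere is the goal left
  -- open here and proved last.
  have hgreen := green_refTri (C := max D₁ D₂) (hD₁.weaken (le_max_left _ _))
    (hD₂.weaken (le_max_right _ _)) ?_
  · have cI : ∀ {f : ℝ → E3} {x : E3}, Continuous f → (∀ t ∈ Icc (0 : ℝ) 1, f t ∈ K.carrier) →
        ContinuousOn (fun t => ⟪S.invLift w (f t), S.fluxVec x (f t)⟫) (Icc 0 1) := by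
      intro f x hf hfK
      exact (hcont.comp hf.continuousOn hfK).inner ((S.contDiffOn_fluxVec hne x).continuousOn.comp
        hf.continuousOn fun t ht => hKU (hfK t ht))
    have e0 : K.liftedFlux S w 0 =
        ∫ t in (0 : ℝ)..1, (⟪g (1 - t, t), m 1 (1 - t, t)⟫ - ⟪g (1 - t, t), m 0 (1 - t, t)⟫) := by
      rw [liftedFlux]
      congr 1
      funext t
      have hE : K.edgeVec 0 = e 1 - e 0 := by simp [edgeVec, he]
      rw [(K.lineMap_eq_chart t).1, ← inner_sub_right, hE]
      congr 1
      simp only [hm, SmoothSurface.fluxVec, map_sub, cross_sub_left]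
    have e1 : K.liftedFlux S w 1 = -∫ t in (0 : ℝ)..1, ⟪g (0, t), m 1 (0, t)⟫ := by
      have hs := intervalIntegral.integral_comp_sub_left
        (fun t => ⟪g (0, t), m 1 (0, t)⟫) (a := 0) (b := 1) 1
      simp only [sub_self, sub_zero] at hs
      rw [liftedFlux, ← hs, ← intervalIntegral.integral_neg]
      congr 1
      funext t
      have hE : K.edgeVec 1 = -e 1 := by simp [edgeVec, he]
      rw [(K.lineMap_eq_chart t).2.1, hE, ← inner_neg_right]
      congr 1
      simp only [hm, SmoothSurface.fluxVec, map_neg]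
      rw [← neg_one_smul ℝ, cross_smul_left, neg_one_smul]
    have e2 : K.liftedFlux S w 2 = ∫ t in (0 : ℝ)..1, ⟪g (t, 0), m 0 (t, 0)⟫ := by
      rw [liftedFlux]
      congr 1
      funext t
      have hE : K.edgeVec 2 = e 0 := by simp [edgeVec, he]
      rw [(K.lineMap_eq_chart t).2.2, hE]
    rw [e0, e1, e2, ← sub_eq_add_neg]
    exact hgreen
  -- The exceptional set of the divergence condition lives on `Γ` and is pulled back to the chart.
  have hnull : ∀ᵐ u : ℝ × ℝ, u ∈ refTri →
      tangentialDiv (S.tangent (S.proj (K.chart u))) (S.invLift w) (S.proj (K.chart u)) = 0 := by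
    have h1 := hw_div
    rw [SmoothSurface.IsDivFree, ae_restrict_iff' S.isCompact.measurableSet, ae_iff] at h1
    have h2 := volume_preimage_eq_zero h hn hK h1
    rw [ae_iff]
    refine measure_mono_null ?_ h2
    intro u hu
    simp only [mem_ofPred_eq, Classical.not_imp] at hu
    exact ⟨hu.1, by simpa using ⟨S.proj_mem hne (hTU u hu.1), hu.2⟩⟩
  -- Rademacher's theorem in the chart; differentiability is then transferred to `w ∘ ξ` at the
  -- surface point.
  filter_upwards [hnull, hC.ae_differentiableWithinAt_of_mem] with u hu1 hu2 hmem
  have hT := refTriInt_subset hmem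
  have hgd : DifferentiableAt ℝ g u := (hu2 hT).differentiableAt
    (Filter.mem_of_superset (isOpen_refTriInt.mem_nhds hmem) refTriInt_subset)
  set x := K.chart u with hx
  have hxU : x ∈ S.nhd := hTU u hT
  have hy : S.proj x ∈ S.carrier := S.proj_mem hne hxU
  have hyU := S.carrier_subset hy
  have hA : DifferentiableAt ℝ (S.invLift w) (S.proj x) := by
    refine h.differentiableAt_invLift (hK (K.chart_mem hT)) (inner_chart hn u) (q := K.chart)
      (r := K.coords) (fun y hy => chart_coords' hn hy) (K.differentiable_coords x) ?_
    rw [K.coords_chart]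
    exact hgd
  set A := fderiv ℝ (S.invLift w) (S.proj x) with hAdef
  have hDg : HasFDerivAt g (A ∘L fderiv ℝ S.proj x ∘L K.chartDeriv) u := by
    have h1 : HasFDerivAt (fun u => S.proj (K.chart u)) (fderiv ℝ S.proj x ∘L K.chartDeriv) u :=
      HasFDerivAt.comp (g := S.proj) u ((S.contDiffAt_proj hxU).differentiableAt (by simp)).hasFDerivAt
        (K.hasFDerivAt_chart u)
    have h2 : HasFDerivAt (fun u => S.invLift w (S.proj (K.chart u))) _ u :=
      HasFDerivAt.comp (g := S.invLift w) u hA.hasFDerivAt h1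
    refine h2.congr_of_eventuallyEq ?_
    filter_upwards [K.continuous_chart.continuousAt.preimage_mem_nhds (S.isOpen.mem_nhds hxU)]
      with v hv
    change w (S.proj (K.chart v)) = w (S.proj (S.proj (K.chart v)))
    rw [S.proj_eq_self (S.proj_mem hne hv)]
  have hmd : ∀ j, HasFDerivAt (m j) (fderiv ℝ (S.fluxVec (e j)) x ∘L K.chartDeriv) u := fun j =>
    HasFDerivAt.comp (g := S.fluxVec (e j)) u (((S.contDiffOn_fluxVec hne (e j)).contDiffAt
      (S.isOpen.mem_nhds hxU)).differentiableAt (by simp)).hasFDerivAt (K.hasFDerivAt_chart u)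
  have hcd : K.chartDeriv (1, 0) = e 0 ∧ K.chartDeriv (0, 1) = e 1 := by
    simp [chartDeriv, he]
  have hline1 : HasDerivAt (fun s : ℝ => (s, u.2)) ((1, 0) : ℝ × ℝ) u.1 :=
    (hasDerivAt_id u.1).prodMk (hasDerivAt_const u.1 u.2)
  have hline2 : HasDerivAt (fun t : ℝ => (u.1, t)) ((0, 1) : ℝ × ℝ) u.2 :=
    (hasDerivAt_const u.2 u.1).prodMk (hasDerivAt_id u.2)
  have hg1 : HasDerivAt (fun s => g (s, u.2)) (A (fderiv ℝ S.proj x (e 0))) u.1 := by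
    have := HasFDerivAt.comp_hasDerivAt u.1 (f := fun s : ℝ => (s, u.2)) hDg hline1
    simpa [Function.comp_def, hcd.1] using this
  have hg2 : HasDerivAt (fun t => g (u.1, t)) (A (fderiv ℝ S.proj x (e 1))) u.2 := by
    have := HasFDerivAt.comp_hasDerivAt u.2 (f := fun t : ℝ => (u.1, t)) hDg hline2
    simpa [Function.comp_def, hcd.2] using this
  have hm1 : HasDerivAt (fun s => m 1 (s, u.2)) (fderiv ℝ (S.fluxVec (e 1)) x (e 0)) u.1 := by
    have := HasFDerivAt.comp_hasDerivAt u.1 (f := fun s : ℝ => (s, u.2)) (hmd 1) hline1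
    simpa [Function.comp_def, hcd.1] using this
  have hm2 : HasDerivAt (fun t => m 0 (u.1, t)) (fderiv ℝ (S.fluxVec (e 0)) x (e 1)) u.2 := by
    have := HasFDerivAt.comp_hasDerivAt u.2 (f := fun t : ℝ => (u.1, t)) (hmd 0) hline2
    simpa [Function.comp_def, hcd.2] using this
  -- Product rule for both mixed derivatives: the terms differentiating `m` agree by symmetry
  -- (`k1`), those differentiating `g` because the divergence vanishes (`k2`).
  refine ⟨_, hg1.inner ℝ hm1, ?_⟩
  have k1 : ⟪g u, fderiv ℝ (S.fluxVec (e 1)) x (e 0)⟫ = ⟪g u, fderiv ℝ (S.fluxVec (e 0)) x (e 1)⟫ :=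
    S.inner_fderiv_fluxVec_comm hne hxU (hw_tan _ hy) _ _
  have k2 := inner_cross_of_tangentialDiv_eq_zero (S.norm_normal hne hyU)
    (S.inner_normal_fderiv_proj hne hxU (e 0)) (S.inner_normal_fderiv_proj hne hxU (e 1)) (hu1 hT)
  exact (hg2.inner ℝ hm2).congr_deriv (congrArg₂ (· + ·) k1 k2).symm

end Tri

/-! ### Neighbouring triangles -/

namespace Tri

variable (K : Tri)

theorem edge_eq (i : Fin 3) : K.edge i = {K.points (i + 1), K.points (i + 2)} := by
  have : ({i}ᶜ : Set (Fin 3)) = {i + 1, i + 2} := by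
    ext k; fin_cases i <;> fin_cases k <;> simp
  rw [edge, this, image_pair]

theorem mid_eq (i : Fin 3) :
    K.mid i = (1 / 2 : ℝ) • K.points (i + 1) + (1 / 2 : ℝ) • K.points (i + 2) := by
  rw [mid, AffineMap.lineMap_apply_module]
  norm_num

theorem mid_mem (i : Fin 3) : K.mid i ∈ K.carrier := K.lineMap_mem i (by norm_num)

theorem edge_subset (i : Fin 3) : K.edge i ⊆ range K.points := image_subset_range _ _

variable {K} {K' : Tri} {i j : Fin 3}

theorem mid_eq_of_edge_eq (h : K'.edge j = K.edge i) : K'.mid j = K.mid i := by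
  rw [edge_eq, edge_eq, pair_eq_pair_iff] at h
  rw [mid_eq, mid_eq]
  rcases h with ⟨h1, h2⟩ | ⟨h1, h2⟩
  · rw [h1, h2]
  · rw [h1, h2, add_comm]

theorem edgeVec_of_edge_eq (h : K'.edge j = K.edge i) :
    K'.edgeVec j = K.edgeVec i ∨ K'.edgeVec j = -K.edgeVec i := by
  rw [edge_eq, edge_eq, pair_eq_pair_iff] at h
  rcases h with ⟨h1, h2⟩ | ⟨h1, h2⟩
  · left; rw [edgeVec, edgeVec, h1, h2]
  · right; rw [edgeVec, edgeVec, h1, h2, neg_sub]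

theorem norm_edgeVec_of_edge_eq (h : K'.edge j = K.edge i) : ‖K'.edgeVec j‖ = ‖K.edgeVec i‖ := by
  rcases edgeVec_of_edge_eq h with h | h <;> simp [h]

/-- Two different triangles have at most an edge in common. -/
theorem range_inter_subset (h : K'.edge j = K.edge i) (hne : range K.points ≠ range K'.points) :
    range K.points ∩ range K'.points ⊆ K'.edge j := by
  rintro y ⟨hy, k, rfl⟩
  by_contra hcon
  have hk : k = j := by
    by_contra hkj
    exact hcon ⟨k, hkj, rfl⟩
  subst hk
  have hsub : ∀ l, ∃ m, K.points m = K'.points l := by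
    intro l
    by_cases hl : l = k
    · rw [hl]; exact hy
    · have : K'.points l ∈ K'.edge k := ⟨l, hl, rfl⟩
      rw [h] at this
      exact K.edge_subset i this
  choose f hf using hsub
  have hfi : Function.Injective f := fun a b hab =>
    K'.independent.injective (by rw [← hf a, ← hf b, hab])
  have hfs : Function.Surjective f := Finite.surjective_of_injective hfi
  apply hne
  ext z
  constructor
  · rintro ⟨m, rfl⟩
    obtain ⟨l, rfl⟩ := hfs m
    exact ⟨l, (hf l).symm⟩
  · rintro ⟨l, rfl⟩
    exact ⟨f l, hf l⟩

theorem inner_conormal_edge {y : E3} (hy : y ∈ K.edge i) :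
    ⟪K.conormal i, y⟫ = ⟪K.conormal i, K.mid i⟫ := by
  rw [← sub_eq_zero, ← inner_sub_right]
  rw [edge_eq] at hy
  rcases hy with rfl | rfl
  · have : K.points (i + 1) - K.mid i = -((1 / 2 : ℝ) • K.edgeVec i) := by
      rw [mid_eq, edgeVec]; module
    rw [this, inner_neg_right, real_inner_smul_right, inner_conormal_edgeVec]; simp
  · have : K.points (i + 2) - K.mid i = (1 / 2 : ℝ) • K.edgeVec i := by
      rw [mid_eq, edgeVec]; module
    rw [this, real_inner_smul_right, inner_conormal_edgeVec]; simp

theorem inner_unitNormal_conormal (K : Tri) (i : Fin 3) : ⟪K.unitNormal, K.conormal i⟫ = 0 :=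
  K.inner_unitNormal_of_mem (K.conormal_mem_plane i)

theorem inner_unitNormal_mid_sub (K : Tri) (i : Fin 3) (ε : ℝ) :
    ⟪K.unitNormal, K.mid i - ε • K.conormal i - K.points 0⟫ = 0 := by
  have : K.mid i - ε • K.conormal i - K.points 0 =
      (K.mid i - K.points 0) - ε • K.conormal i := by abel
  rw [this, inner_sub_right, real_inner_smul_right, inner_unitNormal_mid,
    inner_unitNormal_conormal]
  simp

end Tri

open Tri in
/-- Since `ξ` is injective, the surface `Γ_h` is not folded along an edge. -/
theorem SurfaceMesh.lt_norm_conormal_sub {S : SmoothSurface} (M : SurfaceMesh S) {K K' : Tri}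
    (hK : K ∈ M.triangles) (hK' : K' ∈ M.triangles) (hne : K' ≠ K) {i j : Fin 3}
    (he : K'.edge j = K.edge i) {n : E3} {ρ : ℝ} (h : S.GraphBall (K.points 0) n ρ)
    (hn : n = K.unitNormal ∨ n = -K.unitNormal) (hKb : K.carrier ⊆ ball (K.points 0) (ρ / 2)) :
    1 / 8 < ‖K.conormal i - K'.conormal j‖ := by
  -- If the conormals nearly agree, both triangles lie on the same side of the edge. A point `x'` of
  -- `K'` just inside the edge midpoint then has the same projection as some point of `K`;
  -- injectivity puts `x'` in `K ∩ K'`, yet conformity confines that intersection to the common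
  -- edge.
  by_contra! hc
  set p := K.mid i with hp
  have hp' : K'.mid j = p := mid_eq_of_edge_eq he
  have hnU : ∀ {v : E3}, ⟪n, v⟫ = 0 ↔ ⟪K.unitNormal, v⟫ = 0 := by
    intro v; rcases hn with rfl | rfl <;> simp
  obtain ⟨δ₁, hδ₁, hb₁⟩ := K.exists_ball_mid i
  obtain ⟨δ₂, hδ₂, hb₂⟩ := K'.exists_ball_mid j
  obtain ⟨δ₃, hδ₃, hb₃⟩ := Metric.isOpen_ball.mem_nhds (hKb (K.mid_mem i)) |>
    Metric.mem_nhds_iff.1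
  rw [← hp] at hb₁ hb₃
  rw [hp'] at hb₂
  -- The division by `3` keeps `2ε` below all three radii.
  set ε := min δ₁ (min δ₂ δ₃) / 3 with hε
  have hm : 0 < min δ₁ (min δ₂ δ₃) := lt_min hδ₁ (lt_min hδ₂ hδ₃)
  have hε0 : 0 < ε := by positivity
  have hε1 : 2 * ε < δ₁ := by linarith [min_le_left δ₁ (min δ₂ δ₃)]
  have hε2 : 2 * ε < δ₂ := by
    linarith [(min_le_right δ₁ (min δ₂ δ₃)).trans (min_le_left δ₂ δ₃)]
  have hε3 : 2 * ε < δ₃ := by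
    linarith [(min_le_right δ₁ (min δ₂ δ₃)).trans (min_le_right δ₂ δ₃)]
  set x' := p - ε • K'.conormal j with hx'
  set b := p - ε • K.conormal i with hb
  have hx'p : x' - p = -(ε • K'.conormal j) := by rw [hx']; abel
  have hbp : b - p = -(ε • K.conormal i) := by rw [hb]; abel
  have hnx' : ‖x' - p‖ = ε := by
    rw [hx'p, norm_neg, norm_smul, norm_conormal, mul_one, Real.norm_of_nonneg hε0.le]
  have hnb : ‖b - p‖ = ε := by
    rw [hbp, norm_neg, norm_smul, norm_conormal, mul_one, Real.norm_of_nonneg hε0.le]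
  have hin' : ⟪K'.conormal j, x' - p⟫ = -ε := by
    rw [hx'p, inner_neg_right, real_inner_smul_right, real_inner_self_eq_norm_sq, norm_conormal]
    ring
  have hx'K : x' ∈ K'.carrier := by
    refine hb₂ x' (by rw [hnx']; linarith) ?_ (by rw [hin']; linarith)
    rw [hx', ← hp']; exact K'.inner_unitNormal_mid_sub j ε
  have hx'b : x' ∈ ball (K.points 0) (ρ / 2) :=
    hb₃ (by rw [mem_ball, dist_eq_norm, hnx']; linarith)
  have hclosed : closedBall b (ε / 2) ⊆ ball p (2 * ε) := by
    intro x hx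
    rw [mem_closedBall, dist_eq_norm] at hx
    rw [mem_ball, dist_eq_norm]
    have : x - p = (x - b) + (b - p) := by abel
    rw [this]
    linarith [norm_add_le (x - b) (b - p)]
  have hbb : b ∈ ball (K.points 0) (ρ / 2) :=
    hb₃ (by rw [mem_ball, dist_eq_norm, hnb]; linarith)
  -- Origin of the threshold `1/8`: `ξ` is 3-Lipschitz and `3ε/8` is exactly `3/4` of the radius
  -- `ε/2`, as surjectivity of `ξ` from the plane requires.
  have hdist : ‖S.proj x' - S.proj b‖ ≤ 3 / 4 * (ε / 2) := by
    have h1 := h.norm_proj_sub_le (h.mem_ball_of_half hx'b) (h.mem_ball_of_half hbb)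
    have h2 : x' - b = ε • (K.conormal i - K'.conormal j) := by rw [hx', hb, smul_sub]; abel
    rw [h2, norm_smul, Real.norm_of_nonneg hε0.le] at h1
    nlinarith
  have hx'U : x' ∈ S.nhd := h.subset (h.mem_ball_of_half hx'b)
  obtain ⟨x, hxb, hxn, hxx'⟩ := h.exists_plane_proj_eq (half_pos hε0).le
    (hclosed.trans ((ball_subset_ball hε3.le).trans hb₃))
    (hnU.2 (K.inner_unitNormal_mid_sub i ε)) (S.proj_mem h.nonempty hx'U)
    (h.proj_mem_ball hx'b) hdist
  have hxp := hclosed hxb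
  rw [mem_ball, dist_eq_norm] at hxp
  have hxK : x ∈ K.carrier := by
    refine hb₁ x (hxp.trans hε1) (hnU.1 hxn) ?_
    have h1 : x - p = (x - b) + (b - p) := by abel
    rw [h1, inner_add_right, hbp, inner_neg_right, real_inner_smul_right,
      real_inner_self_eq_norm_sq, norm_conormal]
    have h2 := real_inner_le_norm (K.conormal i) (x - b)
    rw [mem_closedBall, dist_eq_norm] at hxb
    rw [norm_conormal, one_mul] at h2
    linarith
  have hxeq : x = x' := M.bijOn_proj.injOn (mem_iUnion₂.2 ⟨K, hK, hxK⟩)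
    (mem_iUnion₂.2 ⟨K', hK', hx'K⟩) hxx'
  have hmem : x' ∈ K.carrier ∩ K'.carrier := ⟨hxeq ▸ hxK, hx'K⟩
  rw [M.conforming K hK K' hK' hne.symm] at hmem
  have hsub : range K.points ∩ range K'.points ⊆
      {y | innerSL ℝ (K'.conormal j) y = ⟪K'.conormal j, p⟫} := fun y hy => by
    have := inner_conormal_edge (range_inter_subset he (M.vertices_ne K hK K' hK' hne.symm) hy)
    rw [hp'] at this
    exact this
  have h1 : ⟪K'.conormal j, x'⟫ = ⟪K'.conormal j, p⟫ :=
    convexHull_min hsub (convex_hyperplane (innerSL ℝ (K'.conormal j)).isLinear _) hmem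
  rw [inner_sub_right, h1] at hin'
  linarith

/-! ### Consistency of the averaged conormal -/

/-- Comparison of the averaged conormal across an edge with the conormal of the smooth surface. -/
theorem abs_inner_avgConormal_sub_le {w N n n' e np nm : E3} {s η : ℝ} (hs : s = 1 ∨ s = -1)
    (hN : ‖N‖ = 1) (hn' : ‖n'‖ = 1) (he : e ≠ 0) (hen : ⟪e, n⟫ = 0)
    (hen' : ⟪e, n'⟫ = 0) (hwN : ⟪w, N⟫ = 0) (h1 : ‖N - n‖ ≤ η) (h2 : ‖N - n'‖ ≤ η)
    (hη : η ≤ 1 / 16) (hnp : np = s • (‖e‖⁻¹ • cross e n)) (hnm : ‖nm‖ = 1)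
    (hnme : ⟪nm, e⟫ = 0) (hnmn : ⟪nm, n'⟫ = 0) (hfold : 1 / 8 < ‖np - nm‖) :
    |‖e‖ * ⟪w, SurfaceMesh.avgConormal np nm⟫ - s * ⟪w, cross e N⟫| ≤
      4 * η ^ 2 * (‖w‖ * ‖e‖) := by
  have he' : 0 < ‖e‖ := norm_pos_iff.2 he
  have hs2 : s * s = 1 := by rcases hs with rfl | rfl <;> norm_num
  have hη0 : 0 ≤ η := (norm_nonneg _).trans h1
  have habs : |s| = 1 := by rcases hs with rfl | rfl <;> norm_num
  have hnm' : nm = -(s • (‖e‖⁻¹ • cross e n')) := by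
    have h3 := eq_or_eq_neg_cross hnm hn' he hnmn hnme hen'
    -- With the other sign the conormals would differ by at most `‖n - n'‖ ≤ 2η ≤ 1/8`, which
    -- `hfold` excludes.
    have h4 : nm ≠ s • (‖e‖⁻¹ • cross e n') := by
      intro h5
      rw [hnp, h5, ← smul_sub, ← smul_sub, ← cross_sub_right, norm_smul, norm_smul,
        Real.norm_eq_abs, habs, one_mul, norm_inv, norm_norm] at hfold
      have h6 := norm_cross_le e (n - n')
      have h7 : ‖e‖⁻¹ * ‖cross e (n - n')‖ ≤ ‖n - n'‖ := by
        rw [inv_mul_le_iff₀ he']; exact h6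
      have h8 : n - n' = (N - n') - (N - n) := by abel
      have h9 := norm_sub_le (N - n') (N - n)
      rw [← h8] at h9
      linarith
    rcases hs with rfl | rfl
    · rcases h3 with h3 | h3
      · exact absurd (by simpa using h3) h4
      · simpa using h3
    · rcases h3 with h3 | h3
      · simpa using h3
      · exact absurd (by simpa using h3) h4
  -- As the conormals have opposite signs, their half difference is a multiple of `e × m` with `m`
  -- the mean of the normals; normalising it means normalising `m`, since `e ⊥ m`.
  obtain ⟨m, hm⟩ : ∃ m, m = (1 / 2 : ℝ) • (n + n') := ⟨_, rfl⟩
  have hem : ⟪e, m⟫ = 0 := by rw [hm, real_inner_smul_right, inner_add_right, hen, hen']; simp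
  have hmN : ‖m - N‖ ≤ η := by
    have h3 : m - N = -((1 / 2 : ℝ) • ((N - n) + (N - n'))) := by rw [hm]; module
    rw [h3, norm_neg, norm_smul]
    have := norm_add_le (N - n) (N - n')
    rw [Real.norm_of_nonneg (by norm_num)]
    linarith
  have hm1 : |‖m‖ - 1| ≤ η := by
    rw [← hN]; exact (abs_norm_sub_norm_le m N).trans hmN
  have hmpos : 0 < ‖m‖ := by linarith [(abs_le.1 hm1).1]
  obtain ⟨m', hm'⟩ : ∃ m', m' = ‖m‖⁻¹ • m := ⟨_, rfl⟩
  have hm'1 : ‖m'‖ = 1 := by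
    rw [hm', norm_smul, norm_inv, norm_norm, inv_mul_cancel₀ hmpos.ne']
  have hm'N : ‖m' - N‖ ≤ 2 * η := by
    have h3 : m' - N = (m - N) + (1 - ‖m‖) • m' := by
      have h4 : ‖m‖ • m' = m := by rw [hm', smul_smul, mul_inv_cancel₀ hmpos.ne', one_smul]
      rw [sub_smul, one_smul, h4]; abel
    rw [h3]
    refine (norm_add_le _ _).trans ?_
    rw [norm_smul, hm'1, mul_one, Real.norm_eq_abs, abs_sub_comm]
    linarith
  have havg : ‖e‖ • SurfaceMesh.avgConormal np nm = s • cross e m' := by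
    have h3 : (1 / 2 : ℝ) • (np - nm) = s • (‖e‖⁻¹ • cross e m) := by
      rw [hnp, hnm', hm, cross_smul_right, cross_add_right]; module
    have h4 : ‖s • (‖e‖⁻¹ • cross e m)‖ = ‖m‖ := by
      rw [norm_smul, norm_smul, Real.norm_eq_abs, habs, one_mul, norm_inv, norm_norm,
        norm_cross_of_inner_eq_zero hem, inv_mul_cancel_left₀ he'.ne']
    rw [SurfaceMesh.avgConormal, h3, h4, hm', cross_smul_right]
    simp only [smul_smul]
    congr 1
    field_simp
  have hlhs : ‖e‖ * ⟪w, SurfaceMesh.avgConormal np nm⟫ - s * ⟪w, cross e N⟫ =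
      s * ⟪w, cross e (m' - N)⟫ := by
    rw [← real_inner_smul_right, havg, real_inner_smul_right, cross_sub_right, inner_sub_right]
    ring
  rw [hlhs, abs_mul, habs, one_mul]
  refine (abs_inner_cross_le_of_unit e (m' - N) hN hwN).trans ?_
  -- The difference of two unit vectors is orthogonal to either of them up to second order.
  have k1 : |⟪m' - N, N⟫| ≤ 2 * η ^ 2 := by
    have h3 : ⟪m' - N, N⟫ = -(‖m' - N‖ ^ 2 / 2) := by
      rw [norm_sub_sq_real, hm'1, hN, inner_sub_left, real_inner_self_eq_norm_sq, hN]; ring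
    rw [h3, abs_neg, abs_of_nonneg (by positivity)]
    nlinarith [norm_nonneg (m' - N)]
  -- Only first order, but in the estimate it multiplies `‖m' - N‖`, which is also of first order.
  have k2 : |⟪e, N⟫| ≤ ‖e‖ * η := by
    have h3 : ⟪e, N⟫ = ⟪e, N - n⟫ := by rw [inner_sub_right, hen, sub_zero]
    rw [h3]
    exact (abs_real_inner_le_norm _ _).trans (by gcongr)
  calc ‖w‖ * (|⟪m' - N, N⟫| * ‖e‖ + |⟪e, N⟫| * ‖m' - N‖)
      ≤ ‖w‖ * ((2 * η ^ 2) * ‖e‖ + (‖e‖ * η) * (2 * η)) := by gcongr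
    _ = _ := by ring

namespace SmoothSurface

variable {S : SmoothSurface} {r L : ℝ}

/-- Comparison of the flux density on the surface with that on a plane. -/
theorem TubeBound.abs_inner_fluxVec_sub_le (hT : S.TubeBound r L) {z x w : E3}
    (hz : z ∈ S.carrier) (hx : x ∈ ball z r) (hx' : S.proj x ∈ ball z r) (e : E3) :
    |⟪w, S.fluxVec e x⟫ - ⟪w, cross e (S.normal (S.proj x))⟫| ≤
      2 * L * |S.d x| * (‖w‖ * ‖e‖) := by
  have hne : S.carrier.Nonempty := ⟨z, hz⟩
  have hxU := hT.subset z hz hx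
  set N := S.normal (S.proj x) with hN
  have hN1 : ‖N‖ = 1 := S.norm_normal hne (hT.subset z hz hx')
  have hν1 : ‖S.normal x‖ = 1 := S.norm_normal hne hxU
  have hνN : ‖S.normal x - N‖ ≤ L * |S.d x| := by
    refine (hT.norm_normal_sub_le hz hx hx').trans (le_of_eq ?_)
    rw [proj, sub_sub_cancel, norm_smul, hν1, mul_one, Real.norm_eq_abs]
  -- Insert `Dξ e = e - d Dν e - ⟪ν, e⟫ ν` and use `ν × N = (ν - N) × N`; both corrections are of
  -- the order of `|d|`.
  have hexp : ⟪w, S.fluxVec e x⟫ - ⟪w, cross e N⟫ =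
      -(S.d x * ⟪w, cross (fderiv ℝ S.normal x e) N⟫) -
        ⟪S.normal x, e⟫ * ⟪w, cross (S.normal x - N) N⟫ := by
    rw [fluxVec, S.fderiv_proj_apply hxU, cross_sub_left, cross_add_left, cross_smul_left,
      cross_smul_left, cross_sub_left, cross_self, sub_zero, inner_sub_right, inner_add_right,
      real_inner_smul_right, real_inner_smul_right]
    ring
  rw [hexp]
  have k1 : |S.d x * ⟪w, cross (fderiv ℝ S.normal x e) N⟫| ≤ L * |S.d x| * (‖w‖ * ‖e‖) := by
    rw [abs_mul]
    have h1 := abs_inner_cross_le w (fderiv ℝ S.normal x e) N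
    rw [hN1, mul_one] at h1
    have h2 := (fderiv ℝ S.normal x).le_of_opNorm_le (hT.norm_fderiv_le z hz x hx) e
    calc _ ≤ |S.d x| * (‖w‖ * (L * ‖e‖)) := by
          gcongr; exact h1.trans (by gcongr)
      _ = _ := by ring
  have k2 : |⟪S.normal x, e⟫ * ⟪w, cross (S.normal x - N) N⟫| ≤ L * |S.d x| * (‖w‖ * ‖e‖) := by
    rw [abs_mul]
    have h1 := abs_inner_cross_le w (S.normal x - N) N
    rw [hN1, mul_one] at h1
    have h2 := abs_real_inner_le_norm (S.normal x) e
    rw [hν1, one_mul] at h2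
    calc _ ≤ ‖e‖ * (‖w‖ * (L * |S.d x|)) := by
          gcongr; exact h1.trans (by gcongr)
      _ = _ := by ring
  refine (abs_sub _ _).trans ?_
  rw [abs_neg]
  linarith

end SmoothSurface

namespace Tri

variable {S : SmoothSurface} {r L σ : ℝ} (K : Tri)

/-- The unit normal of a small inscribed triangle, suitably oriented, approximates the normal of the
surface. -/
theorem exists_sign_norm_normal_sub_le (hT : S.TubeBound r L)
    (hv : ∀ i, K.points i ∈ S.carrier) (hr : 2 * diam K.carrier ≤ r)
    (hA : diam K.carrier ^ 2 ≤ 2 * σ * K.area₂) (hσ : 0 ≤ σ) :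
    ∃ s : ℝ, (s = 1 ∨ s = -1) ∧
      ‖S.normal (K.points 0) - s • K.unitNormal‖ ≤ 12 * L * σ * diam K.carrier := by
  set h := diam K.carrier with hh
  have hh0 : 0 < h := K.diam_pos
  have hL := hT.one_le
  set z := K.points 0 with hz
  have hzC : z ∈ S.carrier := hv 0
  have hne : S.carrier.Nonempty := ⟨z, hzC⟩
  have hzb : z ∈ ball z (2 * h) := mem_ball_self (by linarith)
  have hsub : ball z (2 * h) ⊆ ball z r := ball_subset_ball hr
  set ν := S.normal z with hν
  have hν1 : ‖ν‖ = 1 := S.norm_normal hne (S.carrier_subset hzC)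
  -- The vertices lie on `Γ`, where `d = 0`, so the first-order expansion of `d` leaves only the
  -- quadratic remainder.
  have hin : ∀ i, |⟪ν, K.points i - z⟫| ≤ 2 * L * h ^ 2 := by
    intro i
    have hi : K.points i ∈ ball z (2 * h) := by
      rw [mem_ball, dist_eq_norm]
      linarith [K.dist_points_le i 0]
    have h1 := S.abs_d_sub_le (n := ν) (c := L * (2 * h)) (hsub.trans (hT.subset z hzC)) hzb hi
      (fun u hu => by
        refine (hT.norm_normal_sub_le hzC (hsub hu) (hsub hzb)).trans ?_
        rw [mem_ball, dist_eq_norm] at hu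
        gcongr)
    rw [S.d_eq_zero (hv i), S.d_eq_zero hzC, sub_self, zero_sub, abs_neg] at h1
    refine h1.trans ?_
    calc _ ≤ L * (2 * h) * h := by gcongr; exact K.dist_points_le i 0
      _ = _ := by ring
  -- The double cross product contains only these quadratic quantities times edge lengths; dividing
  -- by the area, which is at least of order `h²`, yields order `h`.
  have hcross : ‖cross ν K.areaVec‖ ≤ 4 * L * h ^ 3 := by
    rw [areaVec, cross_cross]
    refine (_root_.norm_sub_le _ _).trans ?_
    rw [norm_smul, norm_smul, Real.norm_eq_abs, Real.norm_eq_abs]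
    have h1 := mul_le_mul (hin 2) (K.dist_points_le 1 0) (norm_nonneg _) (by positivity)
    have h2 := mul_le_mul (hin 1) (K.dist_points_le 2 0) (norm_nonneg _) (by positivity)
    calc _ ≤ 2 * L * h ^ 2 * h + 2 * L * h ^ 2 * h := add_le_add h1 h2
      _ = _ := by ring
  have hcu : ‖cross ν K.unitNormal‖ ≤ 8 * L * σ * h := by
    have hAp := K.area₂_pos
    rw [unitNormal, cross_smul_right, norm_smul, norm_inv, Real.norm_of_nonneg hAp.le,
      inv_mul_le_iff₀ hAp]
    calc _ ≤ 4 * L * h * h ^ 2 := by linarith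
      _ ≤ 4 * L * h * (2 * σ * K.area₂) := by gcongr
      _ = _ := by ring
  have hsq := norm_cross_sq ν K.unitNormal
  rw [hν1, K.norm_unitNormal] at hsq
  set c := ⟪ν, K.unitNormal⟫ with hc
  have hc1 : |c| ≤ 1 := by
    have := abs_real_inner_le_norm ν K.unitNormal
    rwa [hν1, K.norm_unitNormal, one_mul] at this
  have hB : 0 ≤ 12 * L * σ * h := by positivity
  have hfin : ∀ s : ℝ, s * s = 1 → s * c = |c| →
      ‖ν - s • K.unitNormal‖ ≤ 12 * L * σ * h := by
    intro s hs hsc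
    refine (sq_le_sq₀ (norm_nonneg _) hB).1 ?_
    have hs' : ‖s • K.unitNormal‖ ^ 2 = 1 := by
      rw [norm_smul, K.norm_unitNormal, mul_one, Real.norm_eq_abs, sq_abs, pow_two, hs]
    rw [norm_sub_sq_real, hν1, hs', real_inner_smul_right, ← hc, hsc]
    -- Hence `‖ν - s u‖² = 2 - 2|c| ≤ 2‖ν × u‖²` for the unit normal `u`, and `2 · 8² ≤ 12²`
    -- explains the constant `12`.
    have h1 : 1 - |c| ≤ 1 - c ^ 2 := by nlinarith [abs_nonneg c, sq_abs c]
    have h2 : ‖cross ν K.unitNormal‖ ^ 2 ≤ (8 * L * σ * h) ^ 2 := by gcongr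
    nlinarith [sq_nonneg (L * σ * h)]
  rcases le_total 0 c with h0 | h0
  · exact ⟨1, Or.inl rfl, hfin 1 (by norm_num) (by rw [one_mul, abs_of_nonneg h0])⟩
  · exact ⟨-1, Or.inr rfl, hfin (-1) (by norm_num) (by rw [abs_of_nonpos h0]; ring)⟩

end Tri

/-! ### Consistency of the flux -/

namespace Tri

variable {S : SmoothSurface} {r L σ : ℝ} {K K' : Tri} {w : E3 → E3}

/-- The prescribed flux through an edge agrees to high order with the flux through its image on the
surface. -/
theorem abs_flux_sub_le (hT : S.TubeBound r L) (hw : ContinuousOn w S.carrier)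
    (hw_tan : S.IsTangential w) {z n n' : E3} {s W η δ : ℝ} {i j : Fin 3}
    (hz : z ∈ S.carrier) (hW : ∀ y ∈ S.carrier, ‖w y‖ ≤ W) (hs : s = 1 ∨ s = -1)
    (hn : n = s • K.unitNormal) (hn' : n' = K'.unitNormal ∨ n' = -K'.unitNormal)
    (he : K'.edge j = K.edge i) (hKr : K.carrier ⊆ ball z r)
    (hξr : ∀ x ∈ K.carrier, S.proj x ∈ ball z r)
    (h1 : ∀ x ∈ K.carrier, ‖S.normal (S.proj x) - n‖ ≤ η)
    (h2 : ∀ x ∈ K.carrier, ‖S.normal (S.proj x) - n'‖ ≤ η) (hη : η ≤ 1 / 16)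
    (hd : ∀ x ∈ K.carrier, |S.d x| ≤ δ) (hfold : 1 / 8 < ‖K.conormal i - K'.conormal j‖) :
    |SurfaceMesh.flux (S.invLift w) K i (K', j) - s * K.liftedFlux S w i| ≤
      (4 * η ^ 2 + 2 * L * δ) * (W * ‖K.edgeVec i‖) := by
  have hne : S.carrier.Nonempty := ⟨z, hz⟩
  have hKU : K.carrier ⊆ S.nhd := hKr.trans (hT.subset z hz)
  have hL := hT.one_le
  have hs2 : s * s = 1 := by rcases hs with rfl | rfl <;> norm_num
  have habs : |s| = 1 := by rcases hs with rfl | rfl <;> norm_num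
  have huN := K.norm_unitNormal
  have huN' := K'.norm_unitNormal
  set γ : ℝ → E3 := fun t => AffineMap.lineMap (K.points (i + 1)) (K.points (i + 2)) t with hγ
  have hγK : ∀ t ∈ Icc (0 : ℝ) 1, γ t ∈ K.carrier := fun t ht => K.lineMap_mem i ht
  have hγc : ContinuousOn γ (Icc 0 1) := AffineMap.lineMap_continuous.continuousOn
  have hfc : ContinuousOn (fun t => S.invLift w (γ t)) (Icc 0 1) :=
    (hw.comp (S.contDiffOn_proj.continuousOn.mono hKU)
      fun x hx => S.proj_mem hne (hKU hx)).comp hγc hγK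
  have hmc : ContinuousOn (fun t => S.fluxVec (K.edgeVec i) (γ t)) (Icc 0 1) :=
    (S.contDiffOn_fluxVec hne _).continuousOn.comp hγc fun t ht => hKU (hγK t ht)
  set a := SurfaceMesh.avgConormal (K.conormal i) (K'.conormal j) with ha
  have hint1 : IntervalIntegrable (fun t => ‖K.edgeVec i‖ * ⟪S.invLift w (γ t), a⟫) volume 0 1 := by
    refine ContinuousOn.intervalIntegrable ?_
    rw [uIcc_of_le zero_le_one]
    exact continuousOn_const.mul (hfc.inner continuousOn_const)
  have hint2 : IntervalIntegrable
      (fun t => s * ⟪S.invLift w (γ t), S.fluxVec (K.edgeVec i) (γ t)⟫) volume 0 1 := by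
    refine ContinuousOn.intervalIntegrable ?_
    rw [uIcc_of_le zero_le_one]
    exact continuousOn_const.mul (hfc.inner hmc)
  have hexp : SurfaceMesh.flux (S.invLift w) K i (K', j) - s * K.liftedFlux S w i =
      ∫ t in (0 : ℝ)..1, (‖K.edgeVec i‖ * ⟪S.invLift w (γ t), a⟫ -
        s * ⟪S.invLift w (γ t), S.fluxVec (K.edgeVec i) (γ t)⟫) := by
    rw [intervalIntegral.integral_sub hint1 hint2, intervalIntegral.integral_const_mul,
      intervalIntegral.integral_const_mul, SurfaceMesh.flux, edgeIntegral, liftedFlux, dist_comm,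
      dist_eq_norm, edgeVec]
  have hpt : ∀ t ∈ Icc (0 : ℝ) 1, |‖K.edgeVec i‖ * ⟪S.invLift w (γ t), a⟫ -
      s * ⟪S.invLift w (γ t), S.fluxVec (K.edgeVec i) (γ t)⟫| ≤
      (4 * η ^ 2 + 2 * L * δ) * (W * ‖K.edgeVec i‖) := by
    intro t ht
    have hx := hγK t ht
    set x := γ t
    have hξ : S.proj x ∈ S.carrier := S.proj_mem hne (hKU hx)
    have hinv : S.invLift w x = w (S.proj x) := rfl
    have hwW := hW _ hξ
    have hen : ∀ s : ℝ, ⟪K.edgeVec i, s • K.unitNormal⟫ = 0 := fun s => by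
      rw [real_inner_smul_right, real_inner_comm, K.inner_unitNormal_edgeVec, mul_zero]
    have hen' : ⟪K.edgeVec i, n'⟫ = 0 := by
      have h3 : ⟪K.edgeVec i, K'.unitNormal⟫ = 0 := by
        have h4 := K'.inner_unitNormal_edgeVec j
        rw [real_inner_comm] at h4
        rcases edgeVec_of_edge_eq he with h5 | h5
        · rwa [h5] at h4
        · rwa [h5, inner_neg_left, neg_eq_zero] at h4
      rcases hn' with rfl | rfl
      · exact h3
      · rw [inner_neg_right, h3, neg_zero]
    have hce : ⟪K'.conormal j, K.edgeVec i⟫ = 0 := by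
      have h4 := K'.inner_conormal_edgeVec j
      rcases edgeVec_of_edge_eq he with h5 | h5
      · rwa [h5] at h4
      · rwa [h5, inner_neg_right, neg_eq_zero] at h4
    have hcn : ⟪K'.conormal j, n'⟫ = 0 := by
      have h4 := K'.inner_unitNormal_conormal j
      rw [real_inner_comm] at h4
      rcases hn' with rfl | rfl
      · exact h4
      · rw [inner_neg_right, h4, neg_zero]
    have hn'1 : ‖n'‖ = 1 := by rcases hn' with rfl | rfl <;> simp [huN']
    have hnp : K.conormal i = s • (‖K.edgeVec i‖⁻¹ • cross (K.edgeVec i) n) := by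
      rw [K.conormal_eq, hn, cross_smul_right, smul_comm _ s, smul_smul, hs2, one_smul]
    have b1 := abs_inner_avgConormal_sub_le hs (S.norm_normal hne (S.carrier_subset hξ)) hn'1
      (K.edgeVec_ne_zero i) (hn ▸ hen s) hen' (hw_tan _ hξ) (h1 x hx) (h2 x hx) hη hnp
      (K'.norm_conormal j) hce hcn hfold
    have b2 := hT.abs_inner_fluxVec_sub_le hz (hKr hx) (hξr x hx) (w := w (S.proj x)) (K.edgeVec i)
    rw [hinv]
    have hsplit : ‖K.edgeVec i‖ * ⟪w (S.proj x), a⟫ -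
        s * ⟪w (S.proj x), S.fluxVec (K.edgeVec i) x⟫ =
        (‖K.edgeVec i‖ * ⟪w (S.proj x), a⟫ -
          s * ⟪w (S.proj x), cross (K.edgeVec i) (S.normal (S.proj x))⟫) -
        s * (⟪w (S.proj x), S.fluxVec (K.edgeVec i) x⟫ -
          ⟪w (S.proj x), cross (K.edgeVec i) (S.normal (S.proj x))⟫) := by ring
    rw [hsplit]
    refine (abs_sub _ _).trans ?_
    rw [abs_mul, habs, one_mul]
    calc _ ≤ 4 * η ^ 2 * (‖w (S.proj x)‖ * ‖K.edgeVec i‖) +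
          2 * L * |S.d x| * (‖w (S.proj x)‖ * ‖K.edgeVec i‖) := add_le_add b1 b2
      _ = (4 * η ^ 2 + 2 * L * |S.d x|) * (‖w (S.proj x)‖ * ‖K.edgeVec i‖) := by ring
      _ ≤ _ := by
        have := (abs_nonneg _).trans (hd x hx)
        gcongr
        exact hd x hx
  rw [hexp]
  have := intervalIntegral.norm_integral_le_of_norm_le_const (a := (0 : ℝ)) (b := 1)
    (f := fun t => ‖K.edgeVec i‖ * ⟪S.invLift w (γ t), a⟫ -
        s * ⟪S.invLift w (γ t), S.fluxVec (K.edgeVec i) (γ t)⟫)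
    (C := (4 * η ^ 2 + 2 * L * δ) * (W * ‖K.edgeVec i‖)) fun t ht => by
      rw [uIoc_of_le zero_le_one] at ht
      exact hpt t (Ioc_subset_Icc_self ht)
  simpa using this

/-- The averaged conormal has norm at most one. This crude bound serves the triangles that are not
small. -/
theorem abs_flux_le {f : E3 → E3} {W : ℝ} (hf : ∀ x ∈ K.carrier, ‖f x‖ ≤ W) (i : Fin 3)
    (p : Tri × Fin 3) : |SurfaceMesh.flux f K i p| ≤ diam K.carrier * W := by
  have hW : 0 ≤ W := (norm_nonneg _).trans (hf _ (K.points_mem 0))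
  rw [SurfaceMesh.flux, edgeIntegral, abs_mul, abs_of_nonneg dist_nonneg, dist_eq_norm]
  refine mul_le_mul (K.dist_points_le _ _) ?_ (abs_nonneg _) diam_nonneg
  have := intervalIntegral.norm_integral_le_of_norm_le_const (a := (0 : ℝ)) (b := 1)
    (f := fun t => ⟪f (AffineMap.lineMap (K.points (i + 1)) (K.points (i + 2)) t),
      SurfaceMesh.avgConormal (K.conormal i) (p.1.conormal p.2)⟫) (C := W) fun t ht => by
      rw [uIoc_of_le zero_le_one] at ht
      have h1 := hf _ (K.lineMap_mem i (Ioc_subset_Icc_self ht))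
      refine (norm_inner_le_norm _ _).trans ?_
      calc _ ≤ W * 1 := mul_le_mul h1 (norm_inv_norm_smul_le _) (norm_nonneg _) hW
        _ = W := mul_one W
  simpa using this

/-- A small inscribed triangle is close to the surface. -/
theorem abs_d_le_of_mem (hT : S.TubeBound r L) (hσ : 1 ≤ σ) (hz : K.points 0 ∈ S.carrier)
    (hr : 2 * diam K.carrier ≤ r) {s : ℝ}
    (hn : ‖S.normal (K.points 0) - s • K.unitNormal‖ ≤ 12 * L * σ * diam K.carrier) {x : E3}
    (hx : x ∈ K.carrier) : |S.d x| ≤ 14 * L * σ * diam K.carrier ^ 2 := by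
  set h := diam K.carrier with hh
  have hh0 : 0 < h := K.diam_pos
  have hL := hT.one_le
  have hsub : ball (K.points 0) (2 * h) ⊆ ball (K.points 0) r := ball_subset_ball hr
  have hzb : K.points 0 ∈ ball (K.points 0) (2 * h) := mem_ball_self (by linarith)
  have hxz := K.norm_sub_le hx (K.points_mem 0)
  -- The constant `14` is `12` for the tilt of the triangle plus `2` for the variation of the normal
  -- on the ball of radius `2h`. The linear term vanishes since `x - x₀` lies in the plane of `K`.
  have h1 := S.abs_d_sub_le (n := s • K.unitNormal) (c := 14 * L * σ * h)
    (hsub.trans (hT.subset _ hz)) hzb (y := x)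
    (by rw [mem_ball, dist_eq_norm]; linarith) fun u hu => by
      have h2 := hT.norm_normal_sub_le hz (hsub hu) (hsub hzb)
      rw [mem_ball, dist_eq_norm] at hu
      have h3 : L * ‖u - K.points 0‖ ≤ 2 * L * σ * h := by
        calc _ ≤ L * (2 * h) := by gcongr
          _ = 2 * L * 1 * h := by ring
          _ ≤ _ := by gcongr
      have h4 := norm_add_le (S.normal u - S.normal (K.points 0))
        (S.normal (K.points 0) - s • K.unitNormal)
      rw [sub_add_sub_cancel] at h4
      linarith
  have h2 : ⟪K.unitNormal, x - K.points 0⟫ = 0 :=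
    K.inner_unitNormal_of_mem (by
      have h3 := AffineSubspace.vsub_mem_direction
        (convexHull_subset_affineSpan _ hx) (mem_affineSpan ℝ (mem_range_self (f := K.points) 0))
      rwa [direction_affineSpan] at h3)
  rw [S.d_eq_zero hz, sub_zero, real_inner_smul_left, h2, mul_zero, sub_zero] at h1
  refine h1.trans ?_
  calc _ ≤ 14 * L * σ * h * h := by gcongr
    _ = _ := by ring

/-- On a small triangle of a mesh the prescribed fluxes nearly cancel. -/
theorem abs_sum_flux_le (M : SurfaceMesh S) (hT : S.TubeBound r L) (hσ : 1 ≤ σ)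
    (hreg : M.IsRegular σ) (hw : ContinuousOn w S.carrier) (hw_tan : S.IsTangential w)
    (hw_div : S.IsDivFree w) {W : ℝ} (hW : ∀ y ∈ S.carrier, ‖w y‖ ≤ W) (hK : K ∈ M.triangles)
    (hKW : K.MemW1Inf (S.invLift w)) {nb : Fin 3 → Tri × Fin 3}
    (hnb : ∀ i, (nb i).1 ∈ M.triangles ∧ (nb i).1 ≠ K ∧ (nb i).1.edge (nb i).2 = K.edge i)
    (hr : 8 * σ * diam K.carrier ≤ r) (hκ : 32 * (29 * L * σ ^ 2) * diam K.carrier ≤ 1) :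
    |SurfaceMesh.flux (S.invLift w) K 0 (nb 0) + SurfaceMesh.flux (S.invLift w) K 1 (nb 1) +
      SurfaceMesh.flux (S.invLift w) K 2 (nb 2)| ≤
      18 * W * (29 * L * σ ^ 2) ^ 2 * diam K.carrier ^ 3 := by
  set h := diam K.carrier with hh
  -- Chosen so that `κ h` bounds the deviation of the surface normal from the normals of `K` and of
  -- its neighbours. The neighbour is the worse case: `5Lσ` for the distance to its first vertex and
  -- `24Lσ²` for its tilt.
  set κ := 29 * L * σ ^ 2 with hκdef
  have hh0 : 0 < h := K.diam_pos
  have hL := hT.one_le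
  have hL0 : 0 < L := by linarith
  have hσ0 : 0 < σ := by linarith
  have hσh : h ≤ σ * h := le_mul_of_one_le_left hh0.le hσ
  have hLσ : L * h ≤ L * σ * h := by
    calc L * h ≤ L * (σ * h) := by gcongr
      _ = _ := by ring
  have hLσ2 : L * σ * h ≤ L * σ ^ 2 * h := by
    have : σ ≤ σ ^ 2 := by nlinarith
    gcongr
  have hκh : κ * h = 29 * (L * σ ^ 2 * h) := by rw [hκdef]; ring
  have hLh0 : 0 ≤ L * σ ^ 2 * h := by positivity
  have hκ1 : κ * h ≤ 1 / 32 := by linarith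
  have hv := M.vertices_mem K hK
  set z := K.points 0 with hzdef
  have hz : z ∈ S.carrier := hv 0
  have hne : S.carrier.Nonempty := ⟨z, hz⟩
  have hW0 : 0 ≤ W := (norm_nonneg _).trans (hW z hz)
  obtain ⟨s, hs, hsn⟩ := K.exists_sign_norm_normal_sub_le hT hv (by linarith)
    (K.sq_diam_le hσ0.le (hreg K hK)) hσ0.le
  set n := s • K.unitNormal with hn
  have hnU : n = K.unitNormal ∨ n = -K.unitNormal := by
    rcases hs with h | h
    · left; rw [hn, h, one_smul]
    · right; rw [hn, h, neg_one_smul]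
  have hn1 : ‖n‖ = 1 := by rcases hnU with h | h <;> rw [h] <;> simp [K.norm_unitNormal]
  -- Variation of the normal and tilt of the triangle may each use `1/32` of the `1/16` allowed by
  -- `GraphBall`.
  set ρ := min r (1 / (32 * L)) with hρ
  have hρr : ρ ≤ r := min_le_left _ _
  have hρL : L * ρ ≤ 1 / 32 := by
    calc L * ρ ≤ L * (1 / (32 * L)) := by gcongr; exact min_le_right _ _
      _ = 1 / 32 := by field_simp
  have hhρ : h < ρ / 2 := by
    have h1 : 2 * h < r := by linarith
    have h2 : 2 * h < 1 / (32 * L) := by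
      rw [lt_div_iff₀ (by positivity)]
      nlinarith
    have := lt_min h1 h2
    linarith
  have hzr : z ∈ ball z r := mem_ball_self hT.r_pos
  have hxz : ∀ x ∈ K.carrier, ‖x - z‖ ≤ h := fun x hx => K.norm_sub_le hx (K.points_mem 0)
  have hKr : K.carrier ⊆ ball z r := fun x hx => by
    rw [mem_ball, dist_eq_norm]; linarith [hxz x hx]
  have hKρ : K.carrier ⊆ ball z (ρ / 2) := fun x hx => by
    rw [mem_ball, dist_eq_norm]; linarith [hxz x hx]
  have hgb : S.GraphBall z n ρ := by
    refine ⟨hz, (ball_subset_ball hρr).trans (hT.subset z hz), hn1, fun x hx => ?_, fun x hx => ?_⟩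
    · have h1 := hT.norm_normal_sub_le hz (ball_subset_ball hρr hx) hzr
      have h2 := norm_add_le (S.normal x - S.normal z) (S.normal z - n)
      rw [sub_add_sub_cancel] at h2
      rw [mem_ball, dist_eq_norm] at hx
      have h3 : L * ‖x - z‖ ≤ L * ρ := by gcongr
      have h4 : 12 * L * σ * h ≤ κ * h := by rw [hκh]; nlinarith
      linarith
    · have hxr := ball_subset_ball hρr hx
      have h1 := hT.abs_d_le hz hxr
      rw [mem_ball, dist_eq_norm] at hx
      calc _ ≤ ρ * L := mul_le_mul (h1.trans hx.le) (hT.norm_fderiv_le z hz x hxr)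
            (norm_nonneg _) (by linarith [norm_nonneg (x - z)])
        _ ≤ _ := by linarith
  have hξz : ∀ x ∈ K.carrier, ‖S.proj x - z‖ ≤ 2 * h := by
    intro x hx
    have h1 := hT.abs_d_le hz (hKr hx)
    have h2 : S.proj x - z = (x - z) - S.d x • S.normal x := by rw [SmoothSurface.proj]; abel
    rw [h2]
    refine (_root_.norm_sub_le _ _).trans ?_
    rw [norm_smul, S.norm_normal hne (hT.subset z hz (hKr hx)), mul_one, Real.norm_eq_abs]
    linarith [hxz x hx]
  have hξr : ∀ x ∈ K.carrier, S.proj x ∈ ball z r := fun x hx => by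
    rw [mem_ball, dist_eq_norm]; linarith [hξz x hx]
  have h1 : ∀ x ∈ K.carrier, ‖S.normal (S.proj x) - n‖ ≤ κ * h := by
    intro x hx
    have h1 := hT.norm_normal_sub_le hz (hξr x hx) hzr
    have h2 := norm_add_le (S.normal (S.proj x) - S.normal z) (S.normal z - n)
    rw [sub_add_sub_cancel] at h2
    have h3 : L * ‖S.proj x - z‖ ≤ L * (2 * h) := by gcongr; exact hξz x hx
    rw [hκh]
    linarith
  have hd : ∀ x ∈ K.carrier, |S.d x| ≤ 14 * L * σ * h ^ 2 := fun x hx =>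
    abs_d_le_of_mem hT hσ hz (by linarith) hsn hx
  have hedge : ∀ i, |SurfaceMesh.flux (S.invLift w) K i (nb i) - s * K.liftedFlux S w i| ≤
      6 * W * κ ^ 2 * h ^ 3 := by
    intro i
    obtain ⟨hK', hne', he⟩ := hnb i
    set K' := (nb i).1
    set j := (nb i).2
    set h' := diam K'.carrier with hh'
    -- The common edge transfers the size bound to the neighbour.
    have hh'2 : h' ≤ 2 * σ * h := by
      refine (K'.diam_le_edge hσ0.le (hreg K' hK') j).trans ?_
      rw [norm_edgeVec_of_edge_eq he]
      gcongr
      exact K.norm_edgeVec_le i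
    have hv' := M.vertices_mem K' hK'
    obtain ⟨s', hs', hsn'⟩ := K'.exists_sign_norm_normal_sub_le hT hv' (by linarith)
      (K'.sq_diam_le hσ0.le (hreg K' hK')) hσ0.le
    set n' := s' • K'.unitNormal with hn'
    have hn'U : n' = K'.unitNormal ∨ n' = -K'.unitNormal := by
      rcases hs' with h | h
      · left; rw [hn', h, one_smul]
      · right; rw [hn', h, neg_one_smul]
    set q := K'.points 0 with hq
    have hqz : ‖q - z‖ ≤ 3 * σ * h := by
      obtain ⟨k, -, hk⟩ : K.points (i + 1) ∈ K'.edge j := by rw [he, edge_eq]; simp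
      have a1 := K'.dist_points_le 0 k
      have a2 := K.dist_points_le (i + 1) 0
      rw [hk] at a1
      have a3 := norm_add_le (q - K.points (i + 1)) (K.points (i + 1) - z)
      rw [sub_add_sub_cancel] at a3
      linarith
    have hqr : q ∈ ball z r := by
      rw [mem_ball, dist_eq_norm]
      have : 0 < σ * h := by positivity
      linarith
    have h2 : ∀ x ∈ K.carrier, ‖S.normal (S.proj x) - n'‖ ≤ κ * h := by
      intro x hx
      have h1 := hT.norm_normal_sub_le hz (hξr x hx) hqr
      have h2 := norm_add_le (S.normal (S.proj x) - S.normal q) (S.normal q - n')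
      rw [sub_add_sub_cancel] at h2
      have h3 : ‖S.proj x - q‖ ≤ 5 * σ * h := by
        have h4 := _root_.norm_sub_le (S.proj x - z) (q - z)
        rw [sub_sub_sub_cancel_right] at h4
        linarith [hξz x hx]
      have h5 : L * ‖S.proj x - q‖ ≤ L * (5 * σ * h) := by gcongr
      have h6 : 12 * L * σ * h' ≤ 12 * L * σ * (2 * σ * h) := by gcongr
      rw [hκh]
      linarith
    have hfold := M.lt_norm_conormal_sub hK hK' hne' he hgb hnU hKρ
    have hfin := abs_flux_sub_le hT hw hw_tan hz hW hs hn hn'U he hKr hξr h1 h2 (by linarith) hd hfold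
    refine hfin.trans ?_
    -- The error from the distance to `Γ` is absorbed as `2(κh)²`, next to `4(κh)²` from the
    -- conormals.
    have hδ : 2 * L * (14 * L * σ * h ^ 2) ≤ 2 * (κ * h) ^ 2 := by
      have h3 : L * σ ^ 2 * h * (L * h) ≤ (L * σ ^ 2 * h) * (L * σ ^ 2 * h) :=
        mul_le_mul_of_nonneg_left (hLσ.trans hLσ2) hLh0
      have h4 : L * h * (L * σ * h) ≤ L * h * (L * σ ^ 2 * h) := by gcongr
      rw [hκh]
      nlinarith [mul_self_nonneg (L * σ ^ 2 * h)]
    calc _ ≤ (4 * (κ * h) ^ 2 + 2 * (κ * h) ^ 2) * (W * h) := by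
          gcongr; exact K.norm_edgeVec_le i
      _ = _ := by ring
  have hsum := sum_liftedFlux_eq_zero hw hw_tan hw_div hgb hnU hKρ hKW
  have e0 := hedge 0
  have e1 := hedge 1
  have e2 := hedge 2
  -- The orientation sign `s` is the same on the three edges, so the exact cancellation survives it.
  have hs0 : s * K.liftedFlux S w 0 + s * K.liftedFlux S w 1 + s * K.liftedFlux S w 2 = 0 := by
    rw [← mul_add, ← mul_add, hsum, mul_zero]
  rw [abs_le] at e0 e1 e2 ⊢
  constructor <;> linarith [e0.1, e0.2, e1.1, e1.2, e2.1, e2.2]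

end Tri

/-! ### The divergence bound, for small and for large triangles -/

/-- The first-order bound for the divergence of the Raviart–Thomas interpolant. -/
theorem exists_abs_surfDiv_le (S : SmoothSurface) (w : E3 → E3) (hw : ContinuousOn w S.carrier)
    (hw_tan : S.IsTangential w) (hw_div : S.IsDivFree w) (σ : ℝ) :
    ∃ C : ℝ, 0 < C ∧ ∀ M : SurfaceMesh S, M.IsRegular σ → ∀ K ∈ M.triangles,
      K.MemW1Inf (S.invLift w) → ∀ v, M.IsRTInterpolant (S.invLift w) K v → ∀ x,
        |K.surfDiv v x| ≤ C * diam K.carrier := by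
  obtain ⟨r, L, hT⟩ := S.exists_tubeBound
  obtain ⟨W', hW'⟩ := S.isCompact.exists_bound_of_continuousOn hw
  set W := max W' 0 with hWdef
  have hW : ∀ y ∈ S.carrier, ‖w y‖ ≤ W := fun y hy => (hW' y hy).trans (le_max_left _ _)
  have hW0 : 0 ≤ W := le_max_right _ _
  -- Weakening the regularity constant makes the requirement `1 ≤ σ` of the flux estimate available.
  set τ := max σ 1 with hτ
  have hτ1 : 1 ≤ τ := le_max_right _ _
  have hL := hT.one_le
  have hr0 := hT.r_pos
  set κ := 29 * L * τ ^ 2 with hκ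
  have hκ0 : 0 < κ := by positivity
  -- The size below which the flux estimate applies; it depends only on `r`, `L` and `τ`.
  set h₀ := min (r / (8 * τ)) (1 / (32 * κ)) with hh₀
  have hh₀0 : 0 < h₀ := lt_min (by positivity) (by positivity)
  -- The first summand serves `h ≤ h₀`, the second `h > h₀`; the `+ 1` keeps the constant positive
  -- when `W = 0`.
  refine ⟨72 * W * κ ^ 2 * τ + 12 * W * τ / h₀ ^ 2 + 1, by positivity, ?_⟩
  intro M hreg K hK hKW v hv x
  have hregτ : M.IsRegular τ := fun K hK => (hreg K hK).trans (by
    have := K.inradius_pos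
    gcongr
    exact le_max_left _ _)
  obtain ⟨nb, hnb⟩ := M.exists_neighbours hK
  rw [(M.existsUnique_isRTInterpolant _ hnb).2 v hv x]
  set F := SurfaceMesh.flux (S.invLift w) K 0 (nb 0) + SurfaceMesh.flux (S.invLift w) K 1 (nb 1) +
    SurfaceMesh.flux (S.invLift w) K 2 (nb 2) with hF
  set h := diam K.carrier with hh
  have hh0 : 0 < h := K.diam_pos
  have hA := K.area₂_pos
  have hA2 : h ^ 2 ≤ 2 * τ * K.area₂ := K.sq_diam_le (by linarith) (hregτ K hK)
  rw [abs_div, abs_mul, abs_of_pos hA, abs_of_pos (two_pos : (0 : ℝ) < 2), div_le_iff₀ hA]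
  have hne : S.carrier.Nonempty := ⟨_, M.vertices_mem K hK 0⟩
  rcases le_or_gt h h₀ with hsmall | hlarge
  · have hb := K.abs_sum_flux_le M hT hτ1 hregτ hw hw_tan hw_div hW hK hKW
      (fun i => ⟨(hnb i).1, (hnb i).2.1, (hnb i).2.2.1⟩)
      (by
        have := hsmall.trans (min_le_left _ _)
        rw [le_div_iff₀ (by positivity)] at this
        linarith)
      (by
        have := hsmall.trans (min_le_right _ _)
        rw [le_div_iff₀ (by positivity)] at this
        linarith)
    calc 2 * |F| ≤ 36 * W * κ ^ 2 * h * h ^ 2 := by linarith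
      _ ≤ 36 * W * κ ^ 2 * h * (2 * τ * K.area₂) := by gcongr
      _ = 72 * W * κ ^ 2 * τ * h * K.area₂ := by ring
      _ ≤ _ := by
        gcongr
        have : 0 ≤ 12 * W * τ / h₀ ^ 2 := by positivity
        linarith
  -- For `h > h₀` no cancellation is needed: the factor `h² / h₀² ≥ 1` supplies the power of `h`
  -- that the division by the area consumes.
  · have hf : ∀ y ∈ K.carrier, ‖S.invLift w y‖ ≤ W := fun y hy =>
      hW _ (S.proj_mem hne (M.subset_nhd (mem_iUnion₂.2 ⟨K, hK, hy⟩)))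
    have b : ∀ i, |SurfaceMesh.flux (S.invLift w) K i (nb i)| ≤ h * W := fun i =>
      Tri.abs_flux_le hf i _
    have hF3 : |F| ≤ 3 * (h * W) := by
      have := abs_add_three (SurfaceMesh.flux (S.invLift w) K 0 (nb 0))
        (SurfaceMesh.flux (S.invLift w) K 1 (nb 1)) (SurfaceMesh.flux (S.invLift w) K 2 (nb 2))
      linarith [b 0, b 1, b 2]
    have hq : 1 ≤ h ^ 2 / h₀ ^ 2 := by
      rw [one_le_div (by positivity)]
      gcongr
    calc 2 * |F| ≤ 6 * W * h * 1 := by linarith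
      _ ≤ 6 * W * h * (h ^ 2 / h₀ ^ 2) := by gcongr
      _ ≤ 6 * W * h * ((2 * τ * K.area₂) / h₀ ^ 2) := by gcongr
      _ = 12 * W * τ / h₀ ^ 2 * h * K.area₂ := by ring
      _ ≤ _ := by
        gcongr
        have : 0 ≤ 72 * W * κ ^ 2 * τ := by positivity
        linarith

theorem SurfaceMesh.diam_le_meshSize {S : SmoothSurface} (M : SurfaceMesh S) {K : Tri}
    (hK : K ∈ M.triangles) : diam K.carrier ≤ M.meshSize := by
  have h : (diam K.carrier).toNNReal ≤ M.meshSize :=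
    Finset.le_sup (f := fun K : Tri => (diam K.carrier).toNNReal) hK
  exact Real.toNNReal_le_iff_le_coe.1 h

end SurfaceDG

theorem mainTheorem6 (S : SurfaceDG.SmoothSurface) (w : SurfaceDG.E3 → SurfaceDG.E3)
    (hw_cont : ContinuousOn w S.carrier) (hw_tan : S.IsTangential w) (hw_div : S.IsDivFree w)
    (σ : ℝ) :
    (∃ C : ℝ, 0 < C ∧ ∀ M : SurfaceDG.SurfaceMesh S, M.IsRegular σ →
      ∀ K ∈ M.triangles, SurfaceDG.Tri.MemW1Inf K (S.invLift w) →
        (∃! v : SurfaceDG.E3 → SurfaceDG.E3, M.IsRTInterpolant (S.invLift w) K v) ∧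
        ∀ v : SurfaceDG.E3 → SurfaceDG.E3, M.IsRTInterpolant (S.invLift w) K v →
          SurfaceDG.Tri.normLinf K (SurfaceDG.Tri.surfDiv K v) ≤
            ENNReal.ofReal (C * (M.meshSize : ℝ))) ∧
    SurfaceDG.DivergenceAssumption S w σ 1 := by
  obtain ⟨C, hC, hb⟩ := SurfaceDG.exists_abs_surfDiv_le S w hw_cont hw_tan hw_div σ
  have key : ∀ M : SurfaceDG.SurfaceMesh S, M.IsRegular σ → ∀ K ∈ M.triangles,
      SurfaceDG.Tri.MemW1Inf K (S.invLift w) → ∀ v, M.IsRTInterpolant (S.invLift w) K v →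
        SurfaceDG.Tri.normLinf K (SurfaceDG.Tri.surfDiv K v) ≤
          ENNReal.ofReal (C * (M.meshSize : ℝ)) := fun M hM K hK hKW v hv =>
    -- The pointwise bound involves the diameter of `K` itself; the mesh size enters only here.
    SurfaceDG.Tri.normLinf_const_le K fun x => (hb M hM K hK hKW v hv x).trans
      (mul_le_mul_of_nonneg_left (M.diam_le_meshSize hK) hC.le)
  refine ⟨⟨C, hC, fun M hM K hK hKW => ?_⟩, C, hC, fun M hM hMW wh hwh K hK => ?_⟩
  · obtain ⟨nb, hnb⟩ := M.exists_neighbours hK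
    exact ⟨(M.existsUnique_isRTInterpolant _ hnb).1, key M hM K hK hKW⟩
  · rw [Real.rpow_one]
    exact key M hM K hK (hMW K hK) _ (hwh K hK)
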